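/- For a Gaussian integer $z=u+iv$ ($u,v\in\mathbb Z$) we say that $z$ is odd primitive if $u\not\equiv v \pmod 2$, $\gcd(u,v)=1$ and $uv\neq 0$. Let $A>0$, and for every $B>0$ let a constant $K_B$ be given. Then there is a constant $C>0$, depending only on $A$ and on the family $(K_B)_{B>0}$, such that the following holds. Let $X\ge 2$, put $L=\log X$, and let $c:\mathbb Z[i]\to\mathbb C$ be a function supported on odd primitive $z$ with $1<|z|^2\le X$, with $|c(z)|\le 1$ for all $z$, which satisfies the Siegel–Walfisz condition $$\Bigl|\sum_{z\equiv\alpha\,(\mathrm{mod}\ \ell)} c(z)\,(\bar z/z)^k\,|z|^{it}\Bigr|\le K_B\,\ell^2(k^2+1)(t^2+1)\,X L^{-B}$$ for all real $B>0$, all integers $k\ge 0$ and $\ell\ge 1$, all $\alpha\in\mathbb Z[i]$ and all $t\in\mathbb R$. Then for every real $Q\ge 1$ $$\Bigl|\sum_{1\le q\le Q}\ \ \sum_{\substack{z_1=u_1+iv_1,\ z_2=u_2+iv_2\\ u_1v_2\equiv u_2v_1\,(\mathrm{mod}\ q)}} c(z_1)\,\overline{c(z_2)}\Bigr|\le C\,\bigl(Q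 L^{28A+148}+X L^{-A}\bigr)X .$$ -/

import Mathlib

open scoped ComplexConjugate

namespace DetSums

/-- A Gaussian integer `u + iv` is odd primitive if its coordinates have different parity,
are coprime and are both non-zero. -/
def IsOddPrimitive (z : GaussianInt) : Prop :=
  ¬ z.re ≡ z.im [ZMOD 2] ∧ IsCoprime z.re z.im ∧ z.re * z.im ≠ 0

/-- The finite set of the Gaussian integers `z` with `|z| ^ 2 ≤ X` (see `mem_gaussianDisc`). -/
noncomputable def gaussianDisc (X : ℝ) : Finset GaussianInt :=
  ((Finset.Icc (-⌊X⌋) ⌊X⌋ ×ˢ Finset.Icc (-⌊X⌋) ⌊X⌋).image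
    (fun p : ℤ × ℤ => (⟨p.1, p.2⟩ : GaussianInt))).filter (fun z => z.norm ≤ ⌊X⌋)

theorem mem_gaussianDisc {X : ℝ} {z : GaussianInt} :
    z ∈ gaussianDisc X ↔ ‖(z : ℂ)‖ ^ 2 ≤ X := by
  have hn : ‖(z : ℂ)‖ ^ 2 = ((z.norm : ℤ) : ℝ) := by
    rw [← Complex.normSq_eq_norm_sq, GaussianInt.intCast_real_norm]
  rw [hn, ← Int.le_floor]
  unfold gaussianDisc
  simp only [Finset.mem_filter, Finset.mem_image, Finset.mem_product, Finset.mem_Icc,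
    Prod.exists, and_iff_right_iff_imp]
  intro h
  have e : z.norm = z.re * z.re + z.im * z.im := by
    rw [Zsqrtd.norm_def]; ring
  rw [e] at h
  refine ⟨z.re, z.im, ⟨⟨?_, ?_⟩, ⟨?_, ?_⟩⟩, rfl⟩ <;>
    first
    | nlinarith [mul_self_nonneg z.re, mul_self_nonneg z.im, Int.le_self_sq z.re,
        Int.le_self_sq z.im, Int.le_self_sq (-z.re), Int.le_self_sq (-z.im)]

/-- The determinant sum `S_q(X)` modulo `q`: the sum of `c(z₁) * conj c(z₂)` over the pairs
`z₁ = u₁ + i v₁`, `z₂ = u₂ + i v₂` in the disc `|z| ^ 2 ≤ X` with `u₁ v₂ ≡ u₂ v₁ (mod q)`. -/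
noncomputable def detSum (c : GaussianInt → ℂ) (X : ℝ) (q : ℕ) : ℂ :=
  ∑ z₁ ∈ gaussianDisc X, ∑ z₂ ∈ gaussianDisc X,
    if z₁.re * z₂.im ≡ z₂.re * z₁.im [ZMOD (q : ℤ)] then c z₁ * conj (c z₂) else 0

/-- The sum `S(Q, X)` of the determinant sums over the moduli `1 ≤ q ≤ Q`. -/
noncomputable def totalDetSum (c : GaussianInt → ℂ) (Q X : ℝ) : ℂ :=
  ∑ q ∈ Finset.Icc 1 ⌊Q⌋₊, detSum c X q

open Classical in
/-- The sum of `c(z) (z̄ / z) ^ k |z| ^ (i t)` over `z ≡ α (mod ℓ)`, `|z| ^ 2 ≤ X`. -/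
noncomputable def twistedSum (c : GaussianInt → ℂ) (X : ℝ) (k ℓ : ℕ) (α : GaussianInt)
    (t : ℝ) : ℂ :=
  ∑ z ∈ gaussianDisc X with (ℓ : GaussianInt) ∣ z - α,
    c z * (conj (z : ℂ) / (z : ℂ)) ^ k * (‖(z : ℂ)‖ : ℂ) ^ (Complex.I * (t : ℂ))

/-- The Siegel-Walfisz condition at `X`, where `K B` is the implied constant for the
exponent `B`. -/
def SiegelWalfisz (K : ℝ → ℝ) (X : ℝ) (c : GaussianInt → ℂ) : Prop :=
  ∀ B : ℝ, 0 < B → ∀ k ℓ : ℕ, 1 ≤ ℓ → ∀ (α : GaussianInt) (t : ℝ),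
    ‖twistedSum c X k ℓ α t‖ ≤
      K B * ((ℓ : ℝ) ^ 2 * ((k : ℝ) ^ 2 + 1) * (t ^ 2 + 1) * X * Real.log X ^ (-B))

end DetSums

/-!
Write `z × w = u₁ v₂ - u₂ v₁` for the determinant of two vectors and `L = log X`. For primitive
vectors, `q ∣ z × w` says that `z` and `w` give the same point of the projective line over `ℤ/q`.
The determinant sum modulo `q` is therefore a sum of squares `∑ |∑ c(z)| ^ 2` over projective
classes (`detCorr_eq_classSum`), in particular nonnegative, and by Cauchy's inequality it grows at
most by the factor `p + 1` when `q` is replaced by `q p` with a prime `p`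
(`classSum_le_classSum_mul_prime`). Averaging over the primes `p` in `(P / q, 4 P / q]` moves all
moduli `q ≤ Q` to the single range `(P, 4 P]` with `P = X / L ^ D`, at the cost of two logarithms
(`sum_classSum_le_of_raise`). The point is that `P` is now close to the size `X` of the
determinants.

The number of divisors of `n = z × w ≠ 0` in `(P, 4 P]` is the number of complementary divisors
`r = |n| / q`, which are at most a power of `L`. Detecting `r ∣ n` by additive characters and
sorting the fractions by their reduced denominators `d` gives an expansion into Ramanujan sums
`c_d(n)`, with weights that depend on the size of `n` only (`card_dvd_Ioc_eq_sum_ramanujanSum`).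

* For `d ≤ G`, a power of `L`, the weight is `log 4` up to a small error unless `n` is small, which
  is rare. As `c_d(z × w)` has period `d` in `z`, the Siegel-Walfisz condition without the twists
  (`k = 0` and `t = 0`) bounds this part (`norm_sum_small_sub_le`, `norm_sum_ramanujan_le`).
* For `d > G`, the first variable is extended to all lattice points by Cauchy's inequality and these
  are cut into boxes of side `H`, on which the weights are constant up to rare exceptions. In the
  mean square over a box only equal frequencies `a w / d` modulo one interact. Such vectors `w` are
  proportional modulo `d`, which leaves one in `d` of them and saves a power of `G`
  (`sum_sq_norm_ramanujan_le`, `norm_sum_large_le`). Only `|c| ≤ 1` is used here.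

Pairs with `n = 0` are few, since a primitive vector is proportional only to itself and its
negative. Together these bounds save any power of `L` in the range `Q ≤ X / L ^ (D + 1)`
(`norm_totalDetSum_le_of_le`). For larger `Q`, and for `X` in a bounded range, the trivial bound
`Q X + X ^ 2 L` suffices (`norm_totalDetSum_le_trivial`).
-/

namespace DetSums

/-! ### Determinants of pairs of Gaussian integers -/

/-- The determinant `u₁ v₂ - u₂ v₁` of the pair `z₁ = u₁ + i v₁`, `z₂ = u₂ + i v₂`. -/
def det (z w : GaussianInt) : ℤ := z.re * w.im - w.re * z.im

theorem det_self (z : GaussianInt) : det z z = 0 := by simp [det]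

theorem det_swap (z w : GaussianInt) : det w z = -det z w := by simp [det]

/-- Two coprime vectors that are proportional modulo `q` have the same determinants modulo `q`
against every third vector, in the sense of divisibility. -/
theorem dvd_det_of_dvd_det {q : ℤ} {z z' w : GaussianInt} (hz : IsCoprime z.re z.im)
    (h : q ∣ det z z') (hw : q ∣ det z w) : q ∣ det z' w := by
  obtain ⟨a, b, hab⟩ := hz
  -- the Plücker relation between the three vectors, contracted with a Bézout relation for `z`
  have key : det z' w = (a * z'.re + b * z'.im) * det z w - (a * w.re + b * w.im) * det z z' := by
    simp only [det]
    linear_combination (-(z'.re * w.im - w.re * z'.im)) * hab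
  rw [key]
  exact dvd_sub (Dvd.dvd.mul_left hw _) (Dvd.dvd.mul_left h _)

/-- The vectors that are proportional to `z` modulo `q`. For primitive `z` this set determines
the point of the projective line over `ℤ/q` given by `z`. -/
def projClass (q : ℕ) (z : GaussianInt) : Set GaussianInt := {w | (q : ℤ) ∣ det z w}

theorem projClass_eq_iff {q : ℕ} {z w : GaussianInt} (hz : IsCoprime z.re z.im)
    (hw : IsCoprime w.re w.im) : projClass q z = projClass q w ↔ (q : ℤ) ∣ det z w := by
  constructor
  · intro h
    have : w ∈ projClass q w := by simp [projClass, det_self]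
    rw [← h] at this
    exact this
  · intro h
    ext x
    simp only [projClass, Set.mem_ofPred_eq]
    have h' : (q : ℤ) ∣ det w z := by rw [det_swap]; exact (dvd_neg).2 h
    exact ⟨fun hx => dvd_det_of_dvd_det hz h hx, fun hx => dvd_det_of_dvd_det hw h' hx⟩

open Classical in
/-- The determinant sum modulo `q` over an arbitrary finite set of vectors. -/
noncomputable def detCorr (s : Finset GaussianInt) (c : GaussianInt → ℂ) (q : ℕ) : ℂ :=
  ∑ z ∈ s, ∑ w ∈ s, if (q : ℤ) ∣ det z w then c z * conj (c w) else 0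

open Classical in
/-- The sum of `‖∑ c‖ ^ 2` over the projective classes modulo `q`. -/
noncomputable def classSum (s : Finset GaussianInt) (c : GaussianInt → ℂ) (q : ℕ) : ℝ :=
  ∑ P ∈ s.image (projClass q), ‖∑ z ∈ s with projClass q z = P, c z‖ ^ 2

theorem classSum_nonneg (s : Finset GaussianInt) (c : GaussianInt → ℂ) (q : ℕ) :
    0 ≤ classSum s c q := Finset.sum_nonneg fun _ _ => by positivity

theorem detCorr_eq_classSum {s : Finset GaussianInt} (hs : ∀ z ∈ s, IsCoprime z.re z.im)
    (c : GaussianInt → ℂ) (q : ℕ) : detCorr s c q = (classSum s c q : ℂ) := by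
  classical
  unfold detCorr classSum
  push_cast
  rw [← Finset.sum_fiberwise_of_maps_to (s := s) (t := s.image (projClass q))
    (g := projClass q) (fun z hz => Finset.mem_image_of_mem _ hz)]
  refine Finset.sum_congr rfl fun P _ => ?_
  rw [← Complex.mul_conj', map_sum, Finset.sum_mul]
  refine Finset.sum_congr rfl fun z hz => ?_
  rw [Finset.mem_filter] at hz
  rw [Finset.mul_sum, Finset.sum_filter]
  refine Finset.sum_congr rfl fun w hw => ?_
  have : (q : ℤ) ∣ det z w ↔ projClass q w = P := by
    rw [← projClass_eq_iff (hs z hz.1) (hs w hw), hz.2, eq_comm]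
  simp only [this]

/-! ### Raising the modulus by a prime factor -/

/-- A projective class modulo `q` splits into at most `p + 1` classes modulo `q * p`: after the
choice of a base vector, the classes are told apart by a point of the projective line over
`ℤ/p`. -/
theorem card_image_projClass_mul_prime_le {q p : ℕ} (hp : p.Prime)
    {t : Finset GaussianInt} (ht : ∀ z ∈ t, IsCoprime z.re z.im)
    (hq : ∀ z ∈ t, ∀ w ∈ t, (q : ℤ) ∣ det z w) [DecidableEq (Set GaussianInt)] :
    (t.image (projClass (q * p))).card ≤ p + 1 := by
  classical
  have : Fact p.Prime := ⟨hp⟩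
  rcases t.eq_empty_or_nonempty with rfl | ⟨z₀, hz₀⟩
  · simp
  obtain ⟨a, b, hab⟩ := ht z₀ hz₀
  -- coordinates with respect to the basis `z₀`, `-b + i a`
  let x : GaussianInt → ℤ := fun z => a * z.re + b * z.im
  let y : GaussianInt → ℤ := fun z => det z₀ z / q
  have hy : ∀ z ∈ t, det z₀ z = q * y z := fun z hz =>
    (Int.mul_ediv_cancel' (hq z₀ hz₀ z hz)).symm
  let lab : GaussianInt → Option (ZMod p) := fun z =>
    if (x z : ZMod p) = 0 then none else some ((y z : ZMod p) * (x z : ZMod p)⁻¹)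
  have hlab : ∀ z ∈ t, ∀ w ∈ t, lab z = lab w →
      projClass (q * p) z = projClass (q * p) w := by
    intro z hz w hw h
    rw [projClass_eq_iff (ht z hz) (ht w hw)]
    have e : det z w = q * (x z * y w - x w * y z) := by
      have h1 := hy z hz
      have h2 := hy w hw
      have : det z w = x z * det z₀ w - x w * det z₀ z := by
        simp only [det, x]
        linear_combination (-(z.re * w.im - w.re * z.im)) * hab
      rw [this, h1, h2]; ring
    rw [e]
    push_cast
    refine mul_dvd_mul_left _ ?_
    rw [← ZMod.intCast_zmod_eq_zero_iff_dvd]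
    push_cast
    simp only [lab] at h
    split_ifs at h with h1 h2 h2
    · simp [h1, h2]
    · rw [Option.some.injEq] at h
      field_simp at h
      linear_combination -h
  have : (t.image (projClass (q * p))).card ≤ (t.image lab).card := by
    choose! g hg using fun (P : Set GaussianInt) (hP : P ∈ t.image (projClass (q * p))) =>
      Finset.mem_image.1 hP
    refine Finset.card_le_card_of_injOn (fun P => lab (g P)) ?_ ?_
    · intro P hP
      exact Finset.mem_image_of_mem _ (hg P hP).1
    · intro P hP P' hP' h
      rw [← (hg P hP).2, ← (hg P' hP').2]
      exact hlab _ (hg P hP).1 _ (hg P' hP').1 h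
  refine this.trans ((Finset.card_le_univ _).trans ?_)
  simp [Fintype.card_option, ZMod.card]

/-- Raising the modulus by a prime `p` costs a factor of at most `p + 1`. -/
theorem classSum_le_classSum_mul_prime {s : Finset GaussianInt}
    (hs : ∀ z ∈ s, IsCoprime z.re z.im) (c : GaussianInt → ℂ) (q : ℕ) {p : ℕ} (hp : p.Prime) :
    classSum s c q ≤ (p + 1) * classSum s c (q * p) := by
  classical
  have hfine : ∀ z ∈ s, ∀ w ∈ s, projClass (q * p) z = projClass (q * p) w →
      projClass q z = projClass q w := by
    intro z hz w hw h
    rw [projClass_eq_iff (hs z hz) (hs w hw)] at h ⊢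
    push_cast at h
    exact (dvd_mul_right _ _).trans h
  have hr : classSum s c (q * p) = ∑ P ∈ s.image (projClass q),
      ∑ P' ∈ (s.filter (projClass q · = P)).image (projClass (q * p)),
        ‖∑ z ∈ s with projClass (q * p) z = P', c z‖ ^ 2 := by
    unfold classSum
    rw [← Finset.sum_biUnion]
    · congr 1
      ext P'
      simp only [Finset.mem_image, Finset.mem_biUnion, Finset.mem_filter]
      constructor
      · rintro ⟨z, hz, rfl⟩
        exact ⟨_, ⟨z, hz, rfl⟩, z, ⟨hz, rfl⟩, rfl⟩
      · rintro ⟨_, _, z, ⟨hz, _⟩, rfl⟩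
        exact ⟨z, hz, rfl⟩
    · intro P _ P₁ _ hne
      rw [Function.onFun, Finset.disjoint_left]
      intro P' h1 h2
      obtain ⟨z, hz, rfl⟩ := Finset.mem_image.1 h1
      obtain ⟨w, hw, h⟩ := Finset.mem_image.1 h2
      rw [Finset.mem_filter] at hz hw
      exact hne (by rw [← hz.2, ← hw.2]; exact (hfine w hw.1 z hz.1 h).symm)
  rw [hr, Finset.mul_sum]
  unfold classSum
  refine Finset.sum_le_sum fun P _ => ?_
  set t := s.filter (projClass q · = P) with ht
  have hsplit : ∑ z ∈ t, c z = ∑ P' ∈ t.image (projClass (q * p)),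
      ∑ z ∈ s with projClass (q * p) z = P', c z := by
    rw [← Finset.sum_fiberwise_of_maps_to (s := t) (t := t.image (projClass (q * p)))
      (g := projClass (q * p)) (fun z hz => Finset.mem_image_of_mem _ hz)]
    refine Finset.sum_congr rfl fun P' hP' => ?_
    obtain ⟨w, hw, rfl⟩ := Finset.mem_image.1 hP'
    rw [ht, Finset.mem_filter] at hw
    congr 1
    ext z
    simp only [ht, Finset.mem_filter]
    constructor
    · rintro ⟨⟨h1, _⟩, h3⟩
      exact ⟨h1, h3⟩
    · rintro ⟨h1, h3⟩
      exact ⟨⟨h1, (hfine z h1 w hw.1 h3).trans hw.2⟩, h3⟩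
  rw [hsplit]
  have hcard : ((t.image (projClass (q * p))).card : ℝ) ≤ p + 1 := by
    have : (t.image (projClass (q * p))).card ≤ p + 1 := by
      refine card_image_projClass_mul_prime_le hp (fun z hz => hs z (Finset.mem_filter.1 hz).1) ?_
      intro z hz w hw
      rw [Finset.mem_filter] at hz hw
      rw [← projClass_eq_iff (hs z hz.1) (hs w hw.1), hz.2, hw.2]
    exact_mod_cast this
  calc _ ≤ (∑ P' ∈ t.image (projClass (q * p)),
      ‖∑ z ∈ s with projClass (q * p) z = P', c z‖) ^ 2 := by
        gcongr
        exact norm_sum_le _ _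
    _ ≤ (t.image (projClass (q * p))).card * ∑ P' ∈ t.image (projClass (q * p)),
      ‖∑ z ∈ s with projClass (q * p) z = P', c z‖ ^ 2 := sq_sum_le_card_mul_sum_sq
    _ ≤ _ := by gcongr

/-! ### Raising all moduli to one range -/

/-- A Chebyshev lower bound for the number of primes in `(n, 4 n]`. -/
theorem exists_forall_le_card_primes_Ioc :
    ∃ n₀ : ℕ, ∀ n : ℕ, n₀ ≤ n →
      (n : ℝ) ≤ ((Finset.Ioc n (4 * n)).filter Nat.Prime).card * Real.log (4 * n) := by
  have hlim : ∀ᶠ n : ℕ in Filter.atTop,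
      Real.log (4 * n + 1) + 2 * √(4 * n) * Real.log (4 * n) ≤ (2 * Real.log 2 - 1) * n := by
    have h2 : (0 : ℝ) < 2 * Real.log 2 - 1 := by linarith [Real.log_two_gt_d9]
    have h4 : Filter.Tendsto (fun n : ℕ => (4 : ℝ) * n) Filter.atTop Filter.atTop :=
      tendsto_natCast_atTop_atTop.const_mul_atTop (by norm_num)
    have e1 : (fun x : ℝ => Real.log x) =o[Filter.atTop] fun x : ℝ => x ^ (1 / 4 : ℝ) :=
      isLittleO_log_rpow_atTop (by norm_num)
    have hc : (0 : ℝ) < (2 * Real.log 2 - 1) / 64 := by positivity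
    have e2 := h4.eventually (e1.bound hc)
    filter_upwards [e2, Filter.eventually_ge_atTop 1] with n hn hn1
    have hn1' : (1 : ℝ) ≤ n := by exact_mod_cast hn1
    rw [Real.norm_of_nonneg (Real.log_nonneg (by linarith)), Real.norm_of_nonneg (by positivity)]
      at hn
    set x : ℝ := 4 * n with hx
    have hx1 : 1 ≤ x := by linarith
    have hlog : Real.log (x + 1) ≤ 2 * Real.log x := by
      rw [← Real.log_rpow (by linarith) 2]
      refine Real.log_le_log (by linarith) ?_
      norm_num
      nlinarith
    have hs : √x = x ^ (1 / 2 : ℝ) := Real.sqrt_eq_rpow x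
    have hsx : √x * x ^ (1 / 4 : ℝ) ≤ x := by
      rw [hs, ← Real.rpow_add (by linarith)]
      calc x ^ (1 / 2 + 1 / 4 : ℝ) ≤ x ^ (1 : ℝ) :=
            Real.rpow_le_rpow_of_exponent_le hx1 (by norm_num)
        _ = x := Real.rpow_one x
    have hs1 : 1 ≤ √x := Real.one_le_sqrt.2 hx1
    have hl0 : 0 ≤ Real.log x := Real.log_nonneg hx1
    calc Real.log (x + 1) + 2 * √x * Real.log x ≤ 4 * √x * Real.log x := by nlinarith
      _ ≤ 4 * √x * ((2 * Real.log 2 - 1) / 64 * x ^ (1 / 4 : ℝ)) := by gcongr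
      _ = (2 * Real.log 2 - 1) / 16 * (√x * x ^ (1 / 4 : ℝ)) := by ring
      _ ≤ (2 * Real.log 2 - 1) / 16 * x := by gcongr
      _ ≤ (2 * Real.log 2 - 1) * n := by rw [hx]; nlinarith
  obtain ⟨n₀, hn₀⟩ := Filter.eventually_atTop.1 hlim
  refine ⟨max n₀ 1, fun n hn => ?_⟩
  have h1 := hn₀ n (le_trans (le_max_left _ _) hn)
  have hn1 : (1 : ℝ) ≤ n := by exact_mod_cast le_trans (le_max_right _ _) hn
  have hpsi := Chebyshev.psi_ge (4 * n)
  have hdiff := Chebyshev.psi_sub_theta_le (x := 4 * n) (by linarith)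
  have hth := Chebyshev.theta_le_log4_mul_x (x := (n : ℝ)) (by positivity)
  have hsum : Chebyshev.theta (4 * n) - Chebyshev.theta n
      ≤ ((Finset.Ioc n (4 * n)).filter Nat.Prime).card * Real.log (4 * n) := by
    have e4 : (4 * (n : ℝ)) = ((4 * n : ℕ) : ℝ) := by push_cast; ring
    rw [e4, Chebyshev.theta, Chebyshev.theta, Nat.floor_natCast, Nat.floor_natCast,
      sub_le_iff_le_add', ← nsmul_eq_mul, ← Finset.sum_const]
    have hu : (Finset.Ioc 0 (4 * n)).filter Nat.Prime
        = (Finset.Ioc 0 n).filter Nat.Prime ∪ (Finset.Ioc n (4 * n)).filter Nat.Prime := by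
      rw [← Finset.filter_union, Finset.Ioc_union_Ioc_eq_Ioc (by omega) (by omega)]
    rw [hu, Finset.sum_union]
    · gcongr with p hp
      · rw [Finset.mem_filter, Finset.mem_Ioc] at hp
        exact_mod_cast hp.2.pos
      · rw [Finset.mem_filter, Finset.mem_Ioc] at hp
        exact hp.1.2
    · refine Finset.disjoint_filter_filter ?_
      rw [Finset.disjoint_left]
      intro a ha hb
      rw [Finset.mem_Ioc] at ha hb
      omega
  have l4 : Real.log 4 = 2 * Real.log 2 := by
    rw [show (4 : ℝ) = 2 ^ 2 by norm_num, Real.log_pow]; norm_num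
  push_cast at hpsi
  rw [l4] at hth
  nlinarith

theorem card_primes_dvd_le_two_mul_log {n m : ℕ} (hn : n ≠ 0) (T : Finset ℕ)
    (hT : ∀ p ∈ T, p.Prime ∧ p ∣ n) (hm : n ≤ m) : (T.card : ℝ) ≤ 2 * Real.log m := by
  have h1 : 2 ^ T.card ≤ n := by
    calc 2 ^ T.card = ∏ _p ∈ T, 2 := by simp
      _ ≤ ∏ p ∈ T, p := Finset.prod_le_prod' fun p hp => (hT p hp).1.two_le
      _ ≤ n := Nat.le_of_dvd (Nat.pos_of_ne_zero hn)
        (Finset.prod_primes_dvd n (fun p hp => (hT p hp).1.prime) fun p hp => (hT p hp).2)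
  have h2 : (2 : ℝ) ^ T.card ≤ m := by exact_mod_cast h1.trans hm
  have h3 := Real.log_le_log (by positivity) h2
  rw [Real.log_pow] at h3
  have := Real.log_two_gt_d9
  nlinarith [(Nat.cast_nonneg T.card : (0 : ℝ) ≤ T.card)]

/-- The sum of the determinant sums over small moduli is at most a power of the logarithm times
the sum over a single range `(P, 4 P]` of much larger moduli. -/
theorem sum_classSum_le_of_raise {s : Finset GaussianInt}
    (hs : ∀ z ∈ s, IsCoprime z.re z.im) (c : GaussianInt → ℂ) {n₀ : ℕ}
    (hn₀ : ∀ n : ℕ, n₀ ≤ n →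
      (n : ℝ) ≤ ((Finset.Ioc n (4 * n)).filter Nat.Prime).card * Real.log (4 * n))
    {P M : ℕ} (hM : M * (n₀ + 1) ≤ P) :
    ∑ q ∈ Finset.Icc 1 M, classSum s c q
      ≤ 10 * Real.log (4 * P) ^ 2 * ∑ n ∈ Finset.Ioc P (4 * P), classSum s c n := by
  classical
  rcases Nat.eq_zero_or_pos P with rfl | hP
  · have : M = 0 := by
      by_contra h
      have : 0 < M * (n₀ + 1) := by positivity
      omega
    subst this
    simp
  have hP1 : (1 : ℝ) ≤ P := by exact_mod_cast hP
  have hl0 : 0 ≤ Real.log (4 * P) := Real.log_nonneg (by linarith)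
  -- the multiples by primes in the window attached to `q`
  let W : ℕ → Finset ℕ := fun q => (Finset.Ioc (P / q) (4 * (P / q))).filter Nat.Prime
  have step : ∀ q ∈ Finset.Icc 1 M,
      classSum s c q ≤ 5 * Real.log (4 * P) * ∑ p ∈ W q, classSum s c (q * p) := by
    intro q hq
    rw [Finset.mem_Icc] at hq
    set n := P / q with hn
    have hnn : n₀ + 1 ≤ n := by
      rw [hn, Nat.le_div_iff_mul_le (by omega)]
      calc (n₀ + 1) * q ≤ (n₀ + 1) * M := Nat.mul_le_mul_left _ hq.2
        _ = M * (n₀ + 1) := mul_comm _ _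
        _ ≤ P := hM
    have hn1 : (1 : ℝ) ≤ n := by exact_mod_cast (by omega : 1 ≤ n)
    have hc := hn₀ n (by omega)
    have hlog : Real.log (4 * n) ≤ Real.log (4 * P) := by
      refine Real.log_le_log (by linarith) ?_
      have : (n : ℝ) ≤ P := by exact_mod_cast Nat.div_le_self P q
      linarith
    have h1 : (W q).card * classSum s c q ≤ 5 * n * ∑ p ∈ W q, classSum s c (q * p) := by
      rw [← nsmul_eq_mul, ← Finset.sum_const, Finset.mul_sum]
      refine Finset.sum_le_sum fun p hp => ?_
      simp only [W, Finset.mem_filter, Finset.mem_Ioc] at hp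
      refine (classSum_le_classSum_mul_prime hs c q hp.2).trans ?_
      refine mul_le_mul_of_nonneg_right ?_ (classSum_nonneg _ _ _)
      have : (p : ℝ) ≤ 4 * n := by exact_mod_cast hp.1.2
      linarith
    have h2 : n * classSum s c q ≤
        n * (5 * Real.log (4 * P) * ∑ p ∈ W q, classSum s c (q * p)) := by
      calc n * classSum s c q ≤ ((W q).card * Real.log (4 * P)) * classSum s c q := by
            refine mul_le_mul_of_nonneg_right (hc.trans ?_) (classSum_nonneg _ _ _)
            gcongr
        _ = Real.log (4 * P) * ((W q).card * classSum s c q) := by ring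
        _ ≤ Real.log (4 * P) * (5 * n * ∑ p ∈ W q, classSum s c (q * p)) := by gcongr
        _ = _ := by ring
    exact le_of_mul_le_mul_left h2 (by linarith)
  refine (Finset.sum_le_sum step).trans ?_
  rw [← Finset.mul_sum]
  have hdouble : ∑ q ∈ Finset.Icc 1 M, ∑ p ∈ W q, classSum s c (q * p)
      ≤ ∑ n ∈ Finset.Ioc P (4 * P), 2 * Real.log (4 * P) * classSum s c n := by
    rw [Finset.sum_sigma']
    rw [← Finset.sum_fiberwise_of_maps_to (t := Finset.Ioc P (4 * P))
      (g := fun x : (_ : ℕ) × ℕ => x.1 * x.2)]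
    · refine Finset.sum_le_sum fun n hn => ?_
      rw [Finset.mem_Ioc] at hn
      rw [Finset.sum_congr rfl (g := fun _ => classSum s c n)
        (fun x hx => by rw [(Finset.mem_filter.1 hx).2]), Finset.sum_const, nsmul_eq_mul]
      refine mul_le_mul_of_nonneg_right ?_ (classSum_nonneg _ _ _)
      set F := ((Finset.Icc 1 M).sigma W).filter fun x : (_ : ℕ) × ℕ => x.1 * x.2 = n with hF
      have hmem : ∀ x ∈ F, x.2.Prime ∧ x.1 * x.2 = n := by
        intro x hx
        simp only [hF, W, Finset.mem_filter, Finset.mem_sigma] at hx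
        exact ⟨hx.1.2.2, hx.2⟩
      have hinj : Set.InjOn (fun x : (_ : ℕ) × ℕ => x.2) F := by
        rintro ⟨a, b⟩ h1 ⟨a', b'⟩ h2 h
        simp only at h
        subst h
        obtain ⟨hp, e1⟩ := hmem _ h1
        obtain ⟨-, e2⟩ := hmem _ h2
        simp only at e1 e2 hp
        have : a = a' := Nat.eq_of_mul_eq_mul_right hp.pos (e1.trans e2.symm)
        rw [this]
      rw [← Finset.card_image_of_injOn hinj]
      have := card_primes_dvd_le_two_mul_log (n := n) (m := 4 * P) (by omega)
        (F.image fun x => x.2) ?_ hn.2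
      · push_cast at this
        exact this
      · intro p hp
        obtain ⟨x, hx, rfl⟩ := Finset.mem_image.1 hp
        exact ⟨(hmem x hx).1, (hmem x hx).2 ▸ dvd_mul_left _ _⟩
    · rintro ⟨q, p⟩ hx
      simp only [W, Finset.mem_filter, Finset.mem_sigma, Finset.mem_Ioc, Finset.mem_Icc] at hx ⊢
      obtain ⟨⟨hq1, hq2⟩, ⟨hp1, hp2⟩, hp⟩ := hx
      constructor
      · rw [Nat.div_lt_iff_lt_mul (by omega)] at hp1
        rw [mul_comm]; exact hp1
      · calc q * p ≤ q * (4 * (P / q)) := Nat.mul_le_mul_left _ hp2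
          _ = 4 * (q * (P / q)) := by ring
          _ ≤ 4 * P := Nat.mul_le_mul_left _ (Nat.mul_div_le P q)
  calc _ ≤ 5 * Real.log (4 * P) *
        ∑ n ∈ Finset.Ioc P (4 * P), 2 * Real.log (4 * P) * classSum s c n := by gcongr
    _ = _ := by rw [← Finset.mul_sum]; ring

/-! ### Exponentials and Ramanujan sums -/

/-- The additive character `x ↦ e^{2πix}`. -/
noncomputable def unitExp (x : ℝ) : ℂ := Complex.exp (2 * Real.pi * Complex.I * x)

theorem unitExp_add (x y : ℝ) : unitExp (x + y) = unitExp x * unitExp y := by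
  simp only [unitExp]
  rw [← Complex.exp_add]
  congr 1
  push_cast
  ring

theorem unitExp_eq_one_iff {x : ℝ} : unitExp x = 1 ↔ ∃ n : ℤ, x = n := by
  rw [unitExp, Complex.exp_eq_one_iff]
  refine exists_congr fun n => ?_
  have h : (2 * Real.pi * Complex.I : ℂ) ≠ 0 := Complex.two_pi_I_ne_zero
  constructor
  · intro hx
    have : (x : ℂ) = n := mul_left_cancel₀ h (by linear_combination hx)
    exact_mod_cast this
  · rintro rfl
    push_cast
    ring

@[simp] theorem unitExp_intCast (n : ℤ) : unitExp n = 1 := unitExp_eq_one_iff.2 ⟨n, rfl⟩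

theorem unitExp_natCast_mul (n : ℕ) (x : ℝ) : unitExp (n * x) = unitExp x ^ n := by
  rw [unitExp, unitExp, ← Complex.exp_nat_mul]
  congr 1
  push_cast
  ring

@[simp] theorem norm_unitExp (x : ℝ) : ‖unitExp x‖ = 1 := by
  rw [unitExp, show (2 * Real.pi * Complex.I * x : ℂ) = ((2 * Real.pi * x : ℝ) : ℂ) * Complex.I by
    push_cast; ring]
  exact Complex.norm_exp_ofReal_mul_I _

theorem conj_unitExp (x : ℝ) : conj (unitExp x) = unitExp (-x) := by
  rw [unitExp, unitExp, ← Complex.exp_conj]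
  congr 1
  simp [show conj (2 : ℂ) = 2 from map_ofNat _ 2]

/-- A geometric sum with a nontrivial root of unity of order dividing `D` as ratio is bounded
by `D`, whatever its length. -/
theorem norm_sum_unitExp_le {D : ℕ} (hD : 0 < D) {x : ℝ} (hx : ∃ n : ℤ, D * x = n)
    (hx' : ¬ ∃ n : ℤ, x = n) (H : ℕ) :
    ‖∑ s ∈ Finset.range H, unitExp (s * x)‖ ≤ D := by
  simp only [unitExp_natCast_mul]
  have hD1 : unitExp x ^ D = 1 := by
    rw [← unitExp_natCast_mul, unitExp_eq_one_iff]; exact hx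
  have hne : unitExp x - 1 ≠ 0 := by
    rw [sub_ne_zero, Ne, unitExp_eq_one_iff]; exact hx'
  have hmod : ∑ s ∈ Finset.range H, unitExp x ^ s = ∑ s ∈ Finset.range (H % D), unitExp x ^ s := by
    refine mul_right_cancel₀ hne ?_
    rw [geom_sum_mul, geom_sum_mul]
    conv_lhs => rw [← Nat.div_add_mod H D, pow_add, pow_mul, hD1, one_pow, one_mul]
  rw [hmod]
  refine (norm_sum_le _ _).trans ?_
  simp only [norm_pow, norm_unitExp, one_pow, Finset.sum_const, Finset.card_range, nsmul_eq_mul,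
    mul_one]
  exact_mod_cast (Nat.mod_lt _ hD).le

theorem sum_unitExp_div {r : ℕ} (hr : 0 < r) (n : ℤ) :
    ∑ h ∈ Finset.range r, unitExp (h * (n / r)) = if (r : ℤ) ∣ n then (r : ℂ) else 0 := by
  have hr' : (r : ℝ) ≠ 0 := by positivity
  simp only [unitExp_natCast_mul]
  have hiff : unitExp (n / r) = 1 ↔ (r : ℤ) ∣ n := by
    rw [unitExp_eq_one_iff]
    refine exists_congr fun k => ?_
    rw [div_eq_iff hr', mul_comm]
    exact_mod_cast Iff.rfl
  split_ifs with h
  · rw [hiff.2 h]; simp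
  · have hne : unitExp (n / r) - 1 ≠ 0 := by rw [sub_ne_zero, Ne, hiff]; exact h
    refine mul_right_cancel₀ hne ?_
    rw [geom_sum_mul, zero_mul, ← unitExp_natCast_mul, mul_div_cancel₀ _ hr', unitExp_intCast,
      sub_self]

/-- The Ramanujan sum: the sum of `e(a n / d)` over the reduced residues `a` modulo `d`. -/
noncomputable def ramanujanSum (d : ℕ) (n : ℤ) : ℂ :=
  ∑ a ∈ Finset.range d with Nat.Coprime a d, unitExp (a * (n / d))

theorem norm_ramanujanSum_le (d : ℕ) (n : ℤ) : ‖ramanujanSum d n‖ ≤ d := by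
  refine (norm_sum_le _ _).trans ?_
  simp only [norm_unitExp, Finset.sum_const, nsmul_eq_mul, mul_one]
  exact_mod_cast (Finset.card_filter_le _ _).trans (by simp)

/-- Sorting the fractions `h / r` by their denominators in lowest terms. -/
theorem sum_divisors_ramanujanSum {r : ℕ} (hr : 0 < r) (n : ℤ) :
    ∑ d ∈ r.divisors, ramanujanSum d n = if (r : ℤ) ∣ n then (r : ℂ) else 0 := by
  rw [← sum_unitExp_div hr, ← Finset.sum_fiberwise_of_maps_to (s := Finset.range r)
    (t := r.divisors) (g := fun h => r / Nat.gcd h r)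
    (fun h _ => Nat.mem_divisors.2 ⟨Nat.div_dvd_of_dvd (Nat.gcd_dvd_right h r), hr.ne'⟩)]
  refine Finset.sum_congr rfl fun d hd => ?_
  obtain ⟨k, rfl⟩ := (Nat.mem_divisors.1 hd).1
  have hd0 : 0 < d := Nat.pos_of_mul_pos_right hr
  have hk0 : 0 < k := Nat.pos_of_mul_pos_left hr
  unfold ramanujanSum
  refine Finset.sum_bij (fun a _ => a * k) ?_ ?_ ?_ ?_
  · intro a ha
    rw [Finset.mem_filter, Finset.mem_range] at ha ⊢
    refine ⟨Nat.mul_lt_mul_of_pos_right ha.1 hk0, ?_⟩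
    rw [Nat.gcd_mul_right, ha.2, one_mul, Nat.mul_div_cancel _ hk0]
  · intro a _ b _ h
    exact Nat.eq_of_mul_eq_mul_right hk0 h
  · intro h hh
    rw [Finset.mem_filter, Finset.mem_range] at hh
    have hg : Nat.gcd h (d * k) = k := by
      have h1 := Nat.div_mul_cancel (Nat.gcd_dvd_right h (d * k))
      rw [hh.2] at h1
      exact Nat.eq_of_mul_eq_mul_left hd0 h1
    obtain ⟨a, rfl⟩ : k ∣ h := hg ▸ Nat.gcd_dvd_left h (d * k)
    refine ⟨a, ?_, mul_comm _ _⟩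
    rw [Finset.mem_filter, Finset.mem_range]
    refine ⟨lt_of_mul_lt_mul_left (by linarith [hh.1, mul_comm d k]) hk0.le, ?_⟩
    rw [mul_comm k a, Nat.gcd_mul_right] at hg
    exact Nat.eq_of_mul_eq_mul_right hk0 (by rw [hg, one_mul])
  · intro a _
    congr 1
    push_cast
    field_simp

/-! ### Switching to the complementary divisor -/

/-- The bijection `q ↦ |n| / q` between the divisors of `n` in `(P, 4 P]` and those in
`[|n| / (4 P), |n| / P)`; the bound `R` only serves to make the second range explicit. -/
theorem card_dvd_Ioc_eq_complementary {n : ℤ} (hn : n ≠ 0) {P R : ℕ} (hR : n.natAbs ≤ R * P) :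
    ((Finset.Ioc P (4 * P)).filter fun q : ℕ => (q : ℤ) ∣ n).card
      = ((Finset.Icc 1 R).filter fun r : ℕ => (r * P < n.natAbs ∧ n.natAbs ≤ 4 * (r * P)) ∧
          (r : ℤ) ∣ n).card := by
  have hn0 : 0 < n.natAbs := Int.natAbs_pos.2 hn
  refine Finset.card_bij' (fun q _ => n.natAbs / q) (fun r _ => n.natAbs / r) ?_ ?_ ?_ ?_
  · intro q hq
    simp only [Finset.mem_filter, Finset.mem_Ioc, Finset.mem_Icc, Int.natCast_dvd] at hq ⊢
    obtain ⟨⟨h1, h2⟩, k, hk⟩ := hq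
    have hq0 : 0 < q := by omega
    have hk0 : 0 < k := by
      rcases Nat.eq_zero_or_pos k with rfl | h
      · omega
      · exact h
    rw [hk, Nat.mul_div_cancel_left _ hq0]
    have e1 : k * P < q * k := by rw [mul_comm]; exact Nat.mul_lt_mul_of_pos_right h1 hk0
    refine ⟨⟨hk0, ?_⟩, ⟨e1, ?_⟩, dvd_mul_left _ _⟩
    · rw [hk] at hR
      exact le_of_lt (lt_of_mul_lt_mul_right (e1.trans_le hR) (Nat.zero_le P))
    · calc q * k ≤ 4 * P * k := Nat.mul_le_mul_right _ h2
        _ = 4 * (k * P) := by ring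
  · intro r hr
    simp only [Finset.mem_filter, Finset.mem_Ioc, Finset.mem_Icc, Int.natCast_dvd] at hr ⊢
    obtain ⟨⟨h1, h2⟩, ⟨h3, h4⟩, k, hk⟩ := hr
    rw [hk, Nat.mul_div_cancel_left _ h1]
    rw [hk] at h3 h4
    refine ⟨⟨lt_of_mul_lt_mul_left h3 (Nat.zero_le r), ?_⟩, dvd_mul_left _ _⟩
    exact le_of_mul_le_mul_left (by linarith [h4] : r * k ≤ r * (4 * P)) h1
  · intro q hq
    simp only [Finset.mem_filter, Int.natCast_dvd] at hq
    exact Nat.div_div_self hq.2 hn0.ne'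
  · intro r hr
    simp only [Finset.mem_filter, Int.natCast_dvd] at hr
    exact Nat.div_div_self hr.2.2 hn0.ne'

/-- The archimedean weight of the Ramanujan sum modulo `d` in the count of the divisors of `n` in
`(P, 4 P]`: the sum of `1 / m` over `|n| / (4 d P) ≤ m < |n| / (d P)`, which is about `log 4`
if `|n|` is much larger than `d P`. -/
noncomputable def divisorWeight (P R d : ℕ) (n : ℤ) : ℝ :=
  ∑ m ∈ Finset.Icc 1 (R / d),
    if d * m * P < n.natAbs ∧ n.natAbs ≤ 4 * (d * m * P) then (1 / m : ℝ) else 0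

/-- Summation over the pairs with `r = d m`. -/
theorem sum_Icc_sum_divisors {M : Type*} [AddCommMonoid M] (R : ℕ) (f : ℕ → ℕ → M) :
    ∑ r ∈ Finset.Icc 1 R, ∑ d ∈ r.divisors, f d (r / d)
      = ∑ d ∈ Finset.Icc 1 R, ∑ m ∈ Finset.Icc 1 (R / d), f d m := by
  rw [Finset.sum_sigma', Finset.sum_sigma']
  refine Finset.sum_bij' (fun x _ => ⟨x.2, x.1 / x.2⟩) (fun x _ => ⟨x.1 * x.2, x.1⟩) ?_ ?_ ?_ ?_ ?_
  · rintro ⟨r, d⟩ h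
    simp only [Finset.mem_sigma, Finset.mem_Icc, Nat.mem_divisors] at h ⊢
    have hd : 0 < d := Nat.pos_of_dvd_of_pos h.2.1 (by omega)
    have hle := Nat.le_of_dvd (by omega) h.2.1
    exact ⟨⟨hd, hle.trans h.1.2⟩, Nat.div_pos hle hd, Nat.div_le_div_right h.1.2⟩
  · rintro ⟨d, m⟩ h
    simp only [Finset.mem_sigma, Finset.mem_Icc, Nat.mem_divisors] at h ⊢
    have h2 := h.2.2
    rw [Nat.le_div_iff_mul_le (by omega)] at h2
    have h0 : 0 < d * m := Nat.mul_pos h.1.1 h.2.1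
    exact ⟨⟨h0, by rw [mul_comm]; exact h2⟩, dvd_mul_right _ _, h0.ne'⟩
  · rintro ⟨r, d⟩ h
    simp only [Finset.mem_sigma, Finset.mem_Icc, Nat.mem_divisors] at h ⊢
    rw [Nat.mul_div_cancel' h.2.1]
  · rintro ⟨d, m⟩ h
    simp only [Finset.mem_sigma, Finset.mem_Icc] at h ⊢
    rw [Nat.mul_div_cancel_left _ (by omega)]
  · rintro ⟨r, d⟩ _
    rfl

/-- The number of divisors of `n` in `(P, 4 P]`, expanded into Ramanujan sums of the
complementary divisors. -/
theorem card_dvd_Ioc_eq_sum_ramanujanSum {n : ℤ} (hn : n ≠ 0) {P R : ℕ}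
    (hR : n.natAbs ≤ R * P) :
    (((Finset.Ioc P (4 * P)).filter fun q : ℕ => (q : ℤ) ∣ n).card : ℂ)
      = ∑ d ∈ Finset.Icc 1 R, ramanujanSum d n / d * divisorWeight P R d n := by
  obtain ⟨F, hF⟩ : ∃ F : ℕ → ℕ → ℂ, ∀ d m, F d m =
      if d * m * P < n.natAbs ∧ n.natAbs ≤ 4 * (d * m * P) then
        ramanujanSum d n / (d * m) else 0 := ⟨_, fun _ _ => rfl⟩
  have h1 : ∀ r ∈ Finset.Icc 1 R,
      (((if (r * P < n.natAbs ∧ n.natAbs ≤ 4 * (r * P)) ∧ (r : ℤ) ∣ n then 1 else 0 : ℕ)) : ℂ)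
      = ∑ d ∈ r.divisors, F d (r / d) := by
    intro r hr
    have hr0 : 0 < r := (Finset.mem_Icc.1 hr).1
    have hrc : (r : ℂ) ≠ 0 := by exact_mod_cast hr0.ne'
    have h2 : ∀ d ∈ r.divisors, F d (r / d)
        = if r * P < n.natAbs ∧ n.natAbs ≤ 4 * (r * P) then ramanujanSum d n / r else 0 := by
      intro d hd
      have e := Nat.mul_div_cancel' (Nat.mem_divisors.1 hd).1
      have e' : (d : ℂ) * ((r / d : ℕ) : ℂ) = r := by exact_mod_cast e
      rw [hF, e, e']
    rw [Finset.sum_congr rfl h2]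
    by_cases hc : r * P < n.natAbs ∧ n.natAbs ≤ 4 * (r * P)
    · simp only [hc, and_self, true_and, if_true]
      rw [← Finset.sum_div, sum_divisors_ramanujanSum hr0]
      split_ifs
      · rw [div_self hrc, Nat.cast_one]
      · simp
    · simp [hc]
  rw [card_dvd_Ioc_eq_complementary hn hR, Finset.card_filter, Nat.cast_sum,
    Finset.sum_congr rfl h1, sum_Icc_sum_divisors]
  refine Finset.sum_congr rfl fun d _ => ?_
  rw [divisorWeight, Complex.ofReal_sum, Finset.mul_sum]
  refine Finset.sum_congr rfl fun m _ => ?_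
  rw [hF]
  split_ifs
  · push_cast
    rw [div_mul_div_comm, mul_one]
  · simp

theorem divisorWeight_zero (P R d : ℕ) : divisorWeight P R d 0 = 0 := by
  simp [divisorWeight]

theorem sum_Ico_one_div_bounds {a b : ℕ} (ha : 0 < a) (hab : a ≤ b) :
    Real.log (b / a) ≤ ∑ m ∈ Finset.Ico a b, (1 / m : ℝ) ∧
      ∑ m ∈ Finset.Ico a b, (1 / m : ℝ) ≤ Real.log (b / a) + 1 / a - 1 / b := by
  induction b, hab using Nat.le_induction with
  | base =>
    have : (a : ℝ) ≠ 0 := by positivity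
    simp [this]
  | succ b hb ih =>
    have ha' : (0 : ℝ) < a := by positivity
    have hb' : (0 : ℝ) < b := by exact_mod_cast ha.trans_le hb
    have hlog : Real.log ((b + 1 : ℕ) / a) = Real.log (b / a) + Real.log ((b + 1) / b) := by
      rw [← Real.log_mul (by positivity) (by positivity)]
      congr 1
      push_cast
      field_simp
    have h1 : Real.log ((b + 1) / b) ≤ 1 / b := by
      have := Real.log_le_sub_one_of_pos (x := ((b : ℝ) + 1) / b) (by positivity)
      refine this.trans (le_of_eq ?_)
      field_simp
      ring
    have h2 : 1 / ((b : ℝ) + 1) ≤ Real.log ((b + 1) / b) := by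
      have := Real.one_sub_inv_le_log_of_pos (x := ((b : ℝ) + 1) / b) (by positivity)
      refine le_trans (le_of_eq ?_) this
      field_simp
      ring
    rw [Finset.sum_Ico_succ_top hb, hlog]
    push_cast at *
    constructor <;> linarith [ih.1, ih.2]

theorem divisorWeight_eq_sum_Ico {P R d : ℕ} (hP : 0 < P) (hd : 0 < d) {n : ℤ} (hn : n ≠ 0)
    (hR : n.natAbs ≤ R * P) :
    divisorWeight P R d n = ∑ m ∈ Finset.Ico ⌈(n.natAbs / (4 * d * P) : ℝ)⌉₊
      ⌈4 * (n.natAbs / (4 * d * P) : ℝ)⌉₊, (1 / m : ℝ) := by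
  have hn0 : 0 < n.natAbs := Int.natAbs_pos.2 hn
  unfold divisorWeight
  rw [← Finset.sum_filter]
  congr 1
  ext m
  simp only [Finset.mem_filter, Finset.mem_Icc, Finset.mem_Ico, Nat.ceil_le, Nat.lt_ceil]
  have e1 : (n.natAbs / (4 * d * P) : ℝ) ≤ m ↔ n.natAbs ≤ 4 * (d * m * P) := by
    rw [div_le_iff₀ (by positivity), ← Nat.cast_le (α := ℝ)]
    push_cast
    rw [show (m : ℝ) * (4 * d * P) = 4 * (d * m * P) by ring]
  have e2 : (m : ℝ) < 4 * (n.natAbs / (4 * d * P) : ℝ) ↔ d * m * P < n.natAbs := by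
    rw [show 4 * (n.natAbs / (4 * d * P) : ℝ) = n.natAbs / (d * P) by field_simp,
      lt_div_iff₀ (by positivity), ← Nat.cast_lt (α := ℝ)]
    push_cast
    rw [show (m : ℝ) * (d * P) = d * m * P by ring]
  rw [e1, e2]
  constructor
  · rintro ⟨_, h1, h2⟩
    exact ⟨h2, h1⟩
  · rintro ⟨h2, h1⟩
    refine ⟨⟨?_, ?_⟩, h1, h2⟩
    · rcases Nat.eq_zero_or_pos m with rfl | h
      · simp at h2; omega
      · exact h
    · rw [Nat.le_div_iff_mul_le hd, mul_comm]
      exact le_of_lt (lt_of_mul_lt_mul_right (h1.trans_le hR) (Nat.zero_le P))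

theorem divisorWeight_nonneg (P R d : ℕ) (n : ℤ) : 0 ≤ divisorWeight P R d n :=
  Finset.sum_nonneg fun _ _ => by split_ifs <;> positivity

theorem abs_divisorWeight_sub_log_four_le {P R d : ℕ} (hP : 0 < P) (hd : 0 < d) {n : ℤ}
    (hn : n ≠ 0) (hR : n.natAbs ≤ R * P) :
    |divisorWeight P R d n - Real.log 4| ≤ 4 * d * P / n.natAbs := by
  have hn0 : 0 < n.natAbs := Int.natAbs_pos.2 hn
  have hn1 : (0 : ℝ) < n.natAbs := by exact_mod_cast hn0
  rw [divisorWeight_eq_sum_Ico hP hd hn hR]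
  set x : ℝ := n.natAbs / (4 * d * P) with hx
  have hx0 : 0 < x := by positivity
  have hxinv : 4 * d * P / n.natAbs = 1 / x := by rw [hx, one_div_div]
  rw [hxinv]
  set a := ⌈x⌉₊
  set b := ⌈4 * x⌉₊
  have ha0 : 0 < a := Nat.ceil_pos.2 hx0
  have ha1 : (0 : ℝ) < a := by exact_mod_cast ha0
  have hxa : x ≤ a := Nat.le_ceil x
  have hax : (a : ℝ) < x + 1 := Nat.ceil_lt_add_one hx0.le
  have hxb : 4 * x ≤ b := Nat.le_ceil _
  have hba : b ≤ 4 * a := Nat.ceil_le.2 (by push_cast; linarith)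
  have hba' : (b : ℝ) ≤ 4 * a := by exact_mod_cast hba
  have hb1 : (0 : ℝ) < b := by linarith
  have hab : a ≤ b := Nat.ceil_mono (by linarith)
  obtain ⟨h1, h2⟩ := sum_Ico_one_div_bounds ha0 hab
  have h3 : Real.log (b / a) ≤ Real.log 4 :=
    Real.log_le_log (by positivity) (by rw [div_le_iff₀ ha1]; exact hba')
  have h4 : Real.log 4 - 1 / x ≤ Real.log (b / a) := by
    have e : Real.log (b / a) = Real.log 4 + Real.log (b / (4 * a)) := by
      rw [← Real.log_mul (by norm_num) (by positivity)]
      congr 1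
      field_simp
    have e2 := Real.one_sub_inv_le_log_of_pos (x := (b : ℝ) / (4 * a)) (by positivity)
    have e3 : ((b : ℝ) / (4 * a))⁻¹ ≤ 1 + 1 / x := by
      rw [inv_div, div_le_iff₀ hb1]
      calc (4 : ℝ) * a ≤ 4 * (x + 1) := by linarith
        _ = (1 + 1 / x) * (4 * x) := by field_simp
        _ ≤ (1 + 1 / x) * b := by gcongr
    linarith
  have h5 : 1 / (a : ℝ) ≤ 1 / x := one_div_le_one_div_of_le hx0 hxa
  have h6 : 0 < 1 / (b : ℝ) := by positivity
  rw [abs_le]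
  constructor <;> linarith

theorem divisorWeight_le_three {P R d : ℕ} (hP : 0 < P) (hd : 0 < d) {n : ℤ}
    (hR : n.natAbs ≤ R * P) : divisorWeight P R d n ≤ 3 := by
  rcases eq_or_ne n 0 with rfl | hn
  · rw [divisorWeight_zero]; norm_num
  have hn0 : 0 < n.natAbs := Int.natAbs_pos.2 hn
  have hn1 : (0 : ℝ) < n.natAbs := by exact_mod_cast hn0
  rw [divisorWeight_eq_sum_Ico hP hd hn hR]
  set x : ℝ := n.natAbs / (4 * d * P) with hx
  have hx0 : 0 < x := by positivity
  set a := ⌈x⌉₊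
  set b := ⌈4 * x⌉₊
  have ha0 : 0 < a := Nat.ceil_pos.2 hx0
  have ha1 : (1 : ℝ) ≤ a := by exact_mod_cast ha0
  have hxa : x ≤ a := Nat.le_ceil x
  have hba : b ≤ 4 * a := Nat.ceil_le.2 (by push_cast; linarith)
  have hba' : (b : ℝ) ≤ 4 * a := by exact_mod_cast hba
  have hab : a ≤ b := Nat.ceil_mono (by linarith)
  have hb1 : (0 : ℝ) < b := by exact_mod_cast ha0.trans_le hab
  obtain ⟨h1, h2⟩ := sum_Ico_one_div_bounds ha0 hab
  have h3 : Real.log (b / a) ≤ Real.log 4 :=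
    Real.log_le_log (by positivity) (by rw [div_le_iff₀ (by linarith)]; exact hba')
  have l4 : Real.log 4 ≤ 2 := by
    rw [show (4 : ℝ) = 2 ^ 2 by norm_num, Real.log_pow]
    have := Real.log_two_lt_d9
    push_cast
    linarith
  have h5 : 1 / (a : ℝ) ≤ 1 := by rw [div_le_one (by linarith)]; exact ha1
  have h6 : 0 < 1 / (b : ℝ) := by positivity
  linarith

/-! ### Counting vectors by their determinants -/

theorem card_le_card_mul_of_fibers {α β : Type*} [DecidableEq β] {s : Finset α} {t : Finset β}
    {f : α → β} (hf : ∀ x ∈ s, f x ∈ t) {B : ℝ}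
    (hB : ∀ b ∈ t, ((s.filter fun x => f x = b).card : ℝ) ≤ B) : (s.card : ℝ) ≤ t.card * B := by
  rw [Finset.card_eq_sum_card_fiberwise (f := f) (t := t) hf, ← nsmul_eq_mul, ← Finset.sum_const]
  push_cast
  exact Finset.sum_le_sum hB

theorem card_int_le_of_sub_le {T : Finset ℤ} {D : ℝ} (hD : 0 ≤ D)
    (h : ∀ x ∈ T, ∀ y ∈ T, ((x - y : ℤ) : ℝ) ≤ D) : (T.card : ℝ) ≤ D + 1 := by
  rcases T.eq_empty_or_nonempty with rfl | hT
  · simp only [Finset.card_empty, Nat.cast_zero]; linarith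
  have hsub : T ⊆ Finset.Icc (T.min' hT) (T.max' hT) := fun x hx =>
    Finset.mem_Icc.2 ⟨T.min'_le x hx, T.le_max' x hx⟩
  have h1 := Finset.card_le_card hsub
  have h2 := h _ (T.max'_mem hT) _ (T.min'_mem hT)
  rw [Int.card_Icc] at h1
  have h3 : T.min' hT ≤ T.max' hT := T.min'_le _ (T.max'_mem hT)
  have h4 : (T.card : ℤ) ≤ T.max' hT - T.min' hT + 1 := by omega
  have h5 : (T.card : ℝ) ≤ ((T.max' hT - T.min' hT : ℤ) : ℝ) + 1 := by exact_mod_cast h4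
  linarith

theorem card_int_modEq_le {T : Finset ℤ} {N d : ℕ} (hd : 0 < d) (hT : ∀ x ∈ T, |x| ≤ N)
    (h : ∀ x ∈ T, ∀ y ∈ T, (d : ℤ) ∣ x - y) : (T.card : ℝ) ≤ 2 * N / d + 1 := by
  classical
  rcases T.eq_empty_or_nonempty with rfl | ⟨x₀, hx₀⟩
  · simp only [Finset.card_empty, Nat.cast_zero]; positivity
  have hinj : Set.InjOn (fun x => (x - x₀) / (d : ℤ)) T := by
    intro x hx y hy hxy
    have e1 := Int.mul_ediv_cancel' (h x hx x₀ hx₀)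
    have e2 := Int.mul_ediv_cancel' (h y hy x₀ hx₀)
    simp only at hxy
    rw [hxy] at e1
    linarith
  rw [← Finset.card_image_of_injOn hinj]
  refine card_int_le_of_sub_le (by positivity) ?_
  intro a ha b hb
  obtain ⟨x, hx, rfl⟩ := Finset.mem_image.1 ha
  obtain ⟨y, hy, rfl⟩ := Finset.mem_image.1 hb
  rw [le_div_iff₀ (by positivity)]
  have e1 := Int.mul_ediv_cancel' (h x hx x₀ hx₀)
  have e2 := Int.mul_ediv_cancel' (h y hy x₀ hx₀)
  have e3 : ((x - x₀) / (d : ℤ) - (y - x₀) / (d : ℤ)) * d = x - y := by linarith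
  have e4 : x - y ≤ 2 * N := by
    have h1 := abs_le.1 (hT x hx)
    have h2 := abs_le.1 (hT y hy)
    linarith
  have := e3.trans_le e4
  exact_mod_cast this

/-- The vectors of a finite set lie in the box `[-N, N] ^ 2`. -/
def InBox (N : ℕ) (s : Finset GaussianInt) : Prop := ∀ z ∈ s, |z.re| ≤ N ∧ |z.im| ≤ N

theorem card_le_card_re_mul_card_im (s : Finset GaussianInt) :
    s.card ≤ (s.image fun z => z.re).card * (s.image fun z => z.im).card := by
  rw [← Finset.card_product]
  refine Finset.card_le_card_of_injOn (fun z => (z.re, z.im)) ?_ ?_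
  · intro z hz
    exact Finset.mem_product.2 ⟨Finset.mem_image_of_mem _ hz, Finset.mem_image_of_mem _ hz⟩
  · intro z _ w _ h
    exact Zsqrtd.ext (congrArg Prod.fst h) (congrArg Prod.snd h)

theorem InBox.mono {N : ℕ} {s t : Finset GaussianInt} (h : InBox N s) (hst : t ⊆ s) :
    InBox N t := fun z hz => h z (hst hz)

theorem InBox.card_le {N : ℕ} {s : Finset GaussianInt} (h : InBox N s) :
    (s.card : ℝ) ≤ (2 * N + 1) ^ 2 := by
  have h1 : ∀ f : GaussianInt → ℤ, (∀ z ∈ s, |f z| ≤ N) →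
      ((s.image f).card : ℝ) ≤ 2 * N + 1 := by
    intro f hf
    refine card_int_le_of_sub_le (by positivity) ?_
    intro a ha b hb
    obtain ⟨x, hx, rfl⟩ := Finset.mem_image.1 ha
    obtain ⟨y, hy, rfl⟩ := Finset.mem_image.1 hb
    have h1 := abs_le.1 (hf x hx)
    have h2 := abs_le.1 (hf y hy)
    have : f x - f y ≤ 2 * N := by linarith
    exact_mod_cast this
  have h2 : (s.card : ℝ) ≤ (s.image fun z => z.re).card * (s.image fun z => z.im).card := by
    exact_mod_cast card_le_card_re_mul_card_im s
  calc (s.card : ℝ) ≤ _ := h2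
    _ ≤ (2 * N + 1) * (2 * N + 1) := by
        gcongr
        · exact h1 _ fun z hz => (h z hz).1
        · exact h1 _ fun z hz => (h z hz).2
    _ = _ := by ring

theorem card_det_near_le {N : ℕ} {s : Finset GaussianInt} (hs : InBox N s) {w : GaussianInt}
    (hw : w.im ≠ 0) (t : ℤ) (Y : ℕ) :
    ((s.filter fun z => |det z w - t| ≤ Y).card : ℝ) ≤ (2 * N + 1) * (2 * Y / |w.im| + 1) := by
  classical
  have hw' : (0 : ℝ) < |(w.im : ℝ)| := abs_pos.2 (by exact_mod_cast hw)
  have hcard : ((Finset.Icc (-(N : ℤ)) N).card : ℝ) = 2 * N + 1 := by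
    rw [Int.card_Icc]
    have : ((N : ℤ) + 1 - -N).toNat = 2 * N + 1 := by omega
    rw [this]
    push_cast
    ring
  rw [← hcard]
  push_cast
  refine card_le_card_mul_of_fibers (f := fun z => z.im) ?_ ?_
  · intro z hz
    have := (hs z (Finset.mem_filter.1 hz).1).2
    rw [abs_le] at this
    exact Finset.mem_Icc.2 this
  · intro v _
    rw [← Finset.card_image_of_injOn (f := fun z : GaussianInt => z.re)]
    · refine card_int_le_of_sub_le (by positivity) ?_
      intro a ha b hb
      obtain ⟨x, hx, rfl⟩ := Finset.mem_image.1 ha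
      obtain ⟨y, hy, rfl⟩ := Finset.mem_image.1 hb
      simp only [Finset.mem_filter] at hx hy
      rw [le_div_iff₀ hw']
      have e : (x.re - y.re) * w.im = (det x w - t) - (det y w - t) := by
        simp only [det]
        rw [hx.2, hy.2]
        ring
      have h1 : |(x.re - y.re) * w.im| ≤ 2 * Y := by
        rw [e]
        exact (abs_sub _ _).trans (by linarith [hx.1.2, hy.1.2])
      have h2 : (x.re - y.re) * |w.im| ≤ 2 * Y := by
        refine le_trans ?_ h1
        rw [abs_mul]
        exact mul_le_mul_of_nonneg_right (le_abs_self _) (abs_nonneg _)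
      exact_mod_cast h2
    · intro x hx y hy h
      simp only [Finset.coe_filter, Set.mem_ofPred_eq] at hx hy
      exact Zsqrtd.ext h (hx.2.trans hy.2.symm)

theorem sum_int_inv_abs_le (N : ℕ) :
    ∑ k ∈ (Finset.Icc (-(N : ℤ)) N).filter (· ≠ 0), (1 / |(k : ℝ)|) ≤ 2 * (1 + Real.log N) := by
  have hH : ∑ k ∈ Finset.Icc 1 N, (1 / (k : ℝ)) ≤ 1 + Real.log N := by
    refine le_trans (le_of_eq ?_) (harmonic_le_one_add_log N)
    rw [harmonic_eq_sum_Icc]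
    push_cast
    exact Finset.sum_congr rfl fun k _ => one_div _
  have hsub : (Finset.Icc (-(N : ℤ)) N).filter (· ≠ 0) ⊆
      (Finset.Icc 1 N).image (fun k : ℕ => (k : ℤ)) ∪
        (Finset.Icc 1 N).image (fun k : ℕ => -(k : ℤ)) := by
    intro k hk
    simp only [Finset.mem_filter, Finset.mem_Icc, Finset.mem_union, Finset.mem_image] at hk ⊢
    rcases lt_or_gt_of_ne hk.2 with h | h
    · exact Or.inr ⟨k.natAbs, by omega, by omega⟩
    · exact Or.inl ⟨k.natAbs, by omega, by omega⟩
  refine (Finset.sum_le_sum_of_subset_of_nonneg hsub fun _ _ _ => by positivity).trans ?_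
  have hui := Finset.sum_union_inter (s₁ := (Finset.Icc 1 N).image (fun k : ℕ => (k : ℤ)))
    (s₂ := (Finset.Icc 1 N).image (fun k : ℕ => -(k : ℤ))) (f := fun k : ℤ => 1 / |(k : ℝ)|)
  refine (le_add_of_nonneg_right (Finset.sum_nonneg fun _ _ => by positivity)).trans
    (hui.le.trans ?_)
  rw [Finset.sum_image (by intro a _ b _ h; simpa using h),
    Finset.sum_image (by intro a _ b _ h; simpa using h)]
  simp only [Int.cast_neg, Int.cast_natCast, abs_neg, Nat.abs_cast]
  linarith

/-- The number of pairs whose determinant lies in a window of length `2 Y`. -/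
theorem sum_card_det_near_le {N M : ℕ} {s t : Finset GaussianInt} (hs : InBox N s)
    (ht : InBox M t) (ht0 : ∀ w ∈ t, w.im ≠ 0) (e : ℤ) (Y : ℕ) :
    ∑ w ∈ t, ((s.filter fun z => |det z w - e| ≤ Y).card : ℝ)
      ≤ (2 * N + 1) * (2 * M + 1) * (4 * Y * (1 + Real.log M) + (2 * M + 1)) := by
  classical
  set I := Finset.Icc (-(M : ℤ)) M with hI
  have hcard : (I.card : ℝ) = 2 * M + 1 := by
    rw [hI, Int.card_Icc]
    have : ((M : ℤ) + 1 - -M).toNat = 2 * M + 1 := by omega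
    rw [this]
    push_cast
    ring
  have h1 : ∑ w ∈ t, ((s.filter fun z => |det z w - e| ≤ Y).card : ℝ)
      ≤ ∑ w ∈ t, (2 * N + 1) * (2 * Y / |(w.im : ℝ)| + 1) := by
    refine Finset.sum_le_sum fun w hw => ?_
    have := card_det_near_le hs (ht0 w hw) e Y
    push_cast at this
    exact this
  refine h1.trans ?_
  rw [← Finset.mul_sum, mul_assoc]
  refine mul_le_mul_of_nonneg_left ?_ (by positivity)
  have h2 : ∑ w ∈ t, (2 * Y / |(w.im : ℝ)| + 1)
      ≤ ∑ x ∈ I ×ˢ I.filter (· ≠ 0), (2 * Y / |(x.2 : ℝ)| + 1) := by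
    have hinj : Set.InjOn (fun w : GaussianInt => (w.re, w.im)) t := by
      intro z _ w _ h
      exact Zsqrtd.ext (congrArg Prod.fst h) (congrArg Prod.snd h)
    rw [← Finset.sum_image (g := fun w : GaussianInt => (w.re, w.im))
      (f := fun x : ℤ × ℤ => (2 * Y / |(x.2 : ℝ)| + 1)) hinj]
    refine Finset.sum_le_sum_of_subset_of_nonneg ?_ fun _ _ _ => by positivity
    intro x hx
    obtain ⟨w, hw, rfl⟩ := Finset.mem_image.1 hx
    have := ht w hw
    simp only [abs_le] at this
    simp only [hI, Finset.mem_product, Finset.mem_filter, Finset.mem_Icc]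
    exact ⟨this.1, this.2, ht0 w hw⟩
  refine h2.trans ?_
  rw [Finset.sum_product]
  simp only
  rw [Finset.sum_const, nsmul_eq_mul, hcard, Finset.sum_add_distrib]
  refine mul_le_mul_of_nonneg_left ?_ (by positivity)
  have h3 := sum_int_inv_abs_le M
  have h4 : ∑ k ∈ I.filter (· ≠ 0), 2 * (Y : ℝ) / |(k : ℝ)|
      = 2 * Y * ∑ k ∈ I.filter (· ≠ 0), 1 / |(k : ℝ)| := by
    rw [Finset.mul_sum]
    exact Finset.sum_congr rfl fun k _ => by ring
  have h5 : ∑ k ∈ I.filter (· ≠ 0), (1 : ℝ) ≤ 2 * M + 1 := by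
    rw [← hcard, Finset.sum_const, nsmul_eq_mul, mul_one]
    exact_mod_cast Finset.card_filter_le _ _
  rw [h4]
  have : 2 * (Y : ℝ) * ∑ k ∈ I.filter (· ≠ 0), 1 / |(k : ℝ)|
      ≤ 2 * Y * (2 * (1 + Real.log M)) := by gcongr
  linarith

/-- The number of vectors in a box that are proportional to a primitive vector modulo `d`. -/
theorem card_dvd_det_le {N d : ℕ} (hd : 0 < d) (hdN : d ≤ 2 * N) {s : Finset GaussianInt}
    (hs : InBox N s) {w : GaussianInt} (hw : IsCoprime w.re w.im) :
    ((s.filter fun z => (d : ℤ) ∣ det z w).card : ℝ) ≤ 16 * N ^ 2 / d := by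
  classical
  obtain ⟨a, b, hab⟩ := hw
  have hd' : (0 : ℝ) < d := by exact_mod_cast hd
  have hdN' : (d : ℝ) ≤ 2 * N := by exact_mod_cast hdN
  have hone : 2 * (N : ℝ) / d + 1 ≤ 4 * N / d := by
    rw [div_add_one hd'.ne', div_le_div_iff_of_pos_right hd']
    linarith
  have key : ((s.filter fun z => (d : ℤ) ∣ det z w).card : ℝ)
      ≤ (Finset.Ico (0 : ℤ) d).card * (4 * N / d * (4 * N / d)) := by
    -- modulo `d`, such a vector is the multiple of `w` by `a * re + b * im`
    refine card_le_card_mul_of_fibers (f := fun z => (a * z.re + b * z.im) % (d : ℤ)) ?_ ?_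
    · intro z _
      exact Finset.mem_Ico.2 ⟨Int.emod_nonneg _ (by omega), Int.emod_lt_of_pos _ (by omega)⟩
    · intro l _
      set F := (s.filter fun z => (d : ℤ) ∣ det z w).filter
        fun z => (a * z.re + b * z.im) % (d : ℤ) = l with hF
      have hFs : InBox N F := hs.mono ((Finset.filter_subset _ _).trans (Finset.filter_subset _ _))
      have hmem : ∀ x ∈ F, ∀ y ∈ F, (d : ℤ) ∣ x.re - y.re ∧ (d : ℤ) ∣ x.im - y.im := by
        intro x hx y hy
        simp only [hF, Finset.mem_filter] at hx hy
        have h1 : (d : ℤ) ∣ (a * x.re + b * x.im) - (a * y.re + b * y.im) :=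
          Int.ModEq.dvd (hy.2.trans hx.2.symm)
        have h2 := dvd_sub hx.1.2 hy.1.2
        constructor
        · have e : x.re - y.re = ((a * x.re + b * x.im) - (a * y.re + b * y.im)) * w.re
              + (det x w - det y w) * b := by
            simp only [det]
            linear_combination (-(x.re - y.re)) * hab
          rw [e]
          exact dvd_add (Dvd.dvd.mul_right h1 _) (Dvd.dvd.mul_right h2 _)
        · have e : x.im - y.im = ((a * x.re + b * x.im) - (a * y.re + b * y.im)) * w.im
              - (det x w - det y w) * a := by
            simp only [det]
            linear_combination (-(x.im - y.im)) * hab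
          rw [e]
          exact dvd_sub (Dvd.dvd.mul_right h1 _) (Dvd.dvd.mul_right h2 _)
      have h2 : (F.card : ℝ) ≤ (F.image fun z => z.re).card * (F.image fun z => z.im).card := by
        exact_mod_cast card_le_card_re_mul_card_im F
      refine h2.trans ?_
      gcongr
      · refine (card_int_modEq_le (N := N) hd ?_ ?_).trans hone
        · intro x hx
          obtain ⟨z, hz, rfl⟩ := Finset.mem_image.1 hx
          exact (hFs z hz).1
        · intro x hx y hy
          obtain ⟨z, hz, rfl⟩ := Finset.mem_image.1 hx
          obtain ⟨z', hz', rfl⟩ := Finset.mem_image.1 hy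
          exact (hmem z hz z' hz').1
      · refine (card_int_modEq_le (N := N) hd ?_ ?_).trans hone
        · intro x hx
          obtain ⟨z, hz, rfl⟩ := Finset.mem_image.1 hx
          exact (hFs z hz).2
        · intro x hx y hy
          obtain ⟨z, hz, rfl⟩ := Finset.mem_image.1 hx
          obtain ⟨z', hz', rfl⟩ := Finset.mem_image.1 hy
          exact (hmem z hz z' hz').2
  refine key.trans (le_of_eq ?_)
  rw [Int.card_Ico, sub_zero, Int.toNat_natCast]
  field_simp
  ring

theorem card_det_eq_zero_le {s : Finset GaussianInt} (hs : ∀ z ∈ s, IsCoprime z.re z.im)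
    {w : GaussianInt} (hw : IsCoprime w.re w.im) :
    (s.filter fun z => det z w = 0).card ≤ 2 := by
  classical
  have hsub : (s.filter fun z => det z w = 0) ⊆ {w, -w} := by
    intro z hz
    rw [Finset.mem_filter] at hz
    have h0 : z.re * w.im = w.re * z.im := by
      have := hz.2
      simp only [det] at this
      linarith
    have hzc := hs z hz.1
    obtain ⟨a, b, hab⟩ := hzc
    obtain ⟨a', b', hab'⟩ := hw
    -- `z = μ w` and `w = ν z` with integers `μ`, `ν`
    set μ := a' * z.re + b' * z.im with hμ
    set ν := a * w.re + b * w.im with hν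
    have e1 : z.re = μ * w.re := by linear_combination (-z.re) * hab' + b' * h0
    have e2 : z.im = μ * w.im := by linear_combination (-z.im) * hab' - a' * h0
    have e3 : ν * μ = 1 := by
      rw [hν]
      linear_combination hab - a * e1 - b * e2
    rw [Finset.mem_insert, Finset.mem_singleton]
    rcases Int.eq_one_or_neg_one_of_mul_eq_one' e3 with ⟨_, h⟩ | ⟨_, h⟩
    · left
      apply Zsqrtd.ext <;> simp [e1, e2, h]
    · right
      apply Zsqrtd.ext <;> simp [e1, e2, h]
  exact (Finset.card_le_card hsub).trans (Finset.card_le_two)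

/-! ### Orthogonality in short boxes -/

theorem norm_sum_range_unitExp_le (H : ℕ) (x : ℝ) :
    ‖∑ s ∈ Finset.range H, unitExp (s * x)‖ ≤ H := by
  refine (norm_sum_le _ _).trans ?_
  simp

open Classical in
/-- The mean square over a box of a combination of characters `(s, t) ↦ e(s x + t y)` with
rational frequencies: up to boundary terms, only equal frequencies interact. -/
theorem sum_sq_norm_exp_le {ι : Type*} (J : Finset ι) (γ : ι → ℂ) (x y : ι → ℝ) (H D : ℕ)
    (hD : ∀ j ∈ J, ∀ k ∈ J, ∃ D₀ : ℕ, 0 < D₀ ∧ D₀ ≤ D ∧ (∃ n : ℤ, D₀ * (x j - x k) = n) ∧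
      ∃ n : ℤ, D₀ * (y j - y k) = n) :
    ∑ s ∈ Finset.range H, ∑ t ∈ Finset.range H, ‖∑ j ∈ J, γ j * unitExp (s * x j + t * y j)‖ ^ 2
      ≤ ∑ j ∈ J, ∑ k ∈ J, ‖γ j‖ * ‖γ k‖ *
        ((if (∃ n : ℤ, x j - x k = n) ∧ ∃ n : ℤ, y j - y k = n then (H : ℝ) ^ 2 else 0)
          + H * D) := by
  have key : ((∑ s ∈ Finset.range H, ∑ t ∈ Finset.range H,
      ‖∑ j ∈ J, γ j * unitExp (s * x j + t * y j)‖ ^ 2 : ℝ) : ℂ)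
      = ∑ j ∈ J, ∑ k ∈ J, γ j * conj (γ k) *
        ((∑ s ∈ Finset.range H, unitExp (s * (x j - x k)))
          * ∑ t ∈ Finset.range H, unitExp (t * (y j - y k))) := by
    push_cast
    have h1 : ∀ s t : ℕ, ((‖∑ j ∈ J, γ j * unitExp (s * x j + t * y j)‖ : ℂ)) ^ 2
        = ∑ j ∈ J, ∑ k ∈ J, γ j * conj (γ k) *
          (unitExp (s * (x j - x k)) * unitExp (t * (y j - y k))) := by
      intro s t
      rw [← Complex.mul_conj', map_sum, Finset.sum_mul_sum]
      refine Finset.sum_congr rfl fun j _ => Finset.sum_congr rfl fun k _ => ?_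
      have e : unitExp (s * x j + t * y j) * unitExp (-(s * x k + t * y k))
          = unitExp (s * (x j - x k)) * unitExp (t * (y j - y k)) := by
        rw [← unitExp_add, ← unitExp_add]
        congr 1
        ring
      rw [map_mul, conj_unitExp]
      linear_combination γ j * conj (γ k) * e
    simp only [h1]
    calc _ = ∑ s ∈ Finset.range H, ∑ j ∈ J, ∑ t ∈ Finset.range H, ∑ k ∈ J, γ j * conj (γ k) *
          (unitExp (s * (x j - x k)) * unitExp (t * (y j - y k))) :=
          Finset.sum_congr rfl fun s _ => Finset.sum_comm
      _ = ∑ j ∈ J, ∑ s ∈ Finset.range H, ∑ t ∈ Finset.range H, ∑ k ∈ J, γ j * conj (γ k) *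
          (unitExp (s * (x j - x k)) * unitExp (t * (y j - y k))) := Finset.sum_comm
      _ = ∑ j ∈ J, ∑ s ∈ Finset.range H, ∑ k ∈ J, ∑ t ∈ Finset.range H, γ j * conj (γ k) *
          (unitExp (s * (x j - x k)) * unitExp (t * (y j - y k))) :=
          Finset.sum_congr rfl fun j _ => Finset.sum_congr rfl fun s _ => Finset.sum_comm
      _ = ∑ j ∈ J, ∑ k ∈ J, ∑ s ∈ Finset.range H, ∑ t ∈ Finset.range H, γ j * conj (γ k) *
          (unitExp (s * (x j - x k)) * unitExp (t * (y j - y k))) :=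
          Finset.sum_congr rfl fun j _ => Finset.sum_comm
      _ = _ := by
          refine Finset.sum_congr rfl fun j _ => Finset.sum_congr rfl fun k _ => ?_
          rw [Finset.sum_mul_sum, Finset.mul_sum]
          exact Finset.sum_congr rfl fun s _ => (Finset.mul_sum _ _ _).symm
  have hnn : 0 ≤ ∑ s ∈ Finset.range H, ∑ t ∈ Finset.range H,
      ‖∑ j ∈ J, γ j * unitExp (s * x j + t * y j)‖ ^ 2 :=
    Finset.sum_nonneg fun _ _ => Finset.sum_nonneg fun _ _ => by positivity
  rw [← Real.norm_of_nonneg hnn, ← Complex.norm_real, key]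
  refine (norm_sum_le _ _).trans (Finset.sum_le_sum fun j hj => ?_)
  refine (norm_sum_le _ _).trans (Finset.sum_le_sum fun k hk => ?_)
  rw [norm_mul, norm_mul, RCLike.norm_conj, norm_mul]
  refine mul_le_mul_of_nonneg_left ?_ (by positivity)
  obtain ⟨D₀, hD0, hDD, hx, hy⟩ := hD j hj k hk
  have hDD' : (D₀ : ℝ) ≤ D := by exact_mod_cast hDD
  split_ifs with h
  · calc _ ≤ (H : ℝ) * H := by
          gcongr <;> exact norm_sum_range_unitExp_le _ _
      _ ≤ (H : ℝ) ^ 2 + H * D := by nlinarith [(by positivity : (0 : ℝ) ≤ H * D)]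
  · rw [not_and_or] at h
    rw [zero_add]
    rcases h with h | h
    · calc _ ≤ (D : ℝ) * H := by
            gcongr
            · exact (norm_sum_unitExp_le hD0 hx h H).trans hDD'
            · exact norm_sum_range_unitExp_le _ _
        _ = _ := mul_comm _ _
    · gcongr
      · exact norm_sum_range_unitExp_le _ _
      · exact (norm_sum_unitExp_le hD0 hy h H).trans hDD'

theorem dvd_of_isCoprime_of_dvd_mul {d m : ℤ} {w : GaussianInt} (hw : IsCoprime w.re w.im)
    (h1 : d ∣ m * w.re) (h2 : d ∣ m * w.im) : d ∣ m := by
  obtain ⟨a, b, hab⟩ := hw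
  have e : m = a * (m * w.re) + b * (m * w.im) := by linear_combination (-m) * hab
  rw [e]
  exact dvd_add (Dvd.dvd.mul_left h1 _) (Dvd.dvd.mul_left h2 _)

/-- The vectors `a z / d` are in lowest terms, so that their denominators can be read off. -/
theorem denominator_dvd {d d' a a' : ℕ} (hd' : 0 < d') (hd : 0 < d) (ha : Nat.Coprime a d)
    {z z' : GaussianInt} (hz : IsCoprime z.re z.im)
    (h1 : ∃ n : ℤ, (a * z.im / d : ℝ) - a' * z'.im / d' = n)
    (h2 : ∃ n : ℤ, -(a * z.re / d : ℝ) - -(a' * z'.re / d') = n) : d ∣ d' := by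
  obtain ⟨n, hn⟩ := h1
  obtain ⟨m, hm⟩ := h2
  have hd1 : (d : ℝ) ≠ 0 := by positivity
  have hd2 : (d' : ℝ) ≠ 0 := by positivity
  have e1 : (a : ℤ) * d' * z.im = d * (n * d' + a' * z'.im) := by
    field_simp at hn
    have : (a : ℝ) * d' * z.im = d * (n * d' + a' * z'.im) := by linarith
    exact_mod_cast this
  have e2 : (a : ℤ) * d' * z.re = d * (-m * d' + a' * z'.re) := by
    field_simp at hm
    have : (a : ℝ) * d' * z.re = d * (-m * d' + a' * z'.re) := by linarith
    exact_mod_cast this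
  have h3 : (d : ℤ) ∣ a * d' := dvd_of_isCoprime_of_dvd_mul hz ⟨_, e2⟩ ⟨_, e1⟩
  exact ha.symm.dvd_of_dvd_mul_left (by exact_mod_cast h3)

/-- The frequencies `a z / d` and `a' z' / d'` (turned by a right angle) agree modulo one only if
the denominators agree, `d` divides the determinant of `z` and `z'`, and `a'` is determined
modulo `d`. -/
theorem eq_of_frequency_eq {d d' a a' : ℕ} (hd : 0 < d) (hd' : 0 < d') (ha : Nat.Coprime a d)
    (ha' : Nat.Coprime a' d') {z z' : GaussianInt} (hz : IsCoprime z.re z.im)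
    (hz' : IsCoprime z'.re z'.im) (h1 : ∃ n : ℤ, (a * z.im / d : ℝ) - a' * z'.im / d' = n)
    (h2 : ∃ n : ℤ, -(a * z.re / d : ℝ) - -(a' * z'.re / d') = n) :
    d = d' ∧ ((d : ℤ) ∣ a * z.re - a' * z'.re ∧ (d : ℤ) ∣ a * z.im - a' * z'.im) ∧
      (d : ℤ) ∣ det z' z := by
  have hdd : d = d' := by
    refine Nat.dvd_antisymm (denominator_dvd hd' hd ha hz h1 h2)
      (denominator_dvd (a := a') (a' := a) (z := z') (z' := z) hd hd' ha' hz' ?_ ?_)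
    · obtain ⟨n, hn⟩ := h1
      exact ⟨-n, by push_cast; linarith⟩
    · obtain ⟨n, hn⟩ := h2
      exact ⟨-n, by push_cast; linarith⟩
  subst hdd
  obtain ⟨n, hn⟩ := h1
  obtain ⟨m, hm⟩ := h2
  have hd1 : (d : ℝ) ≠ 0 := by positivity
  have e1 : (a : ℤ) * z.im - a' * z'.im = d * n := by
    field_simp at hn
    have : (a : ℝ) * z.im - a' * z'.im = d * n := by linarith
    exact_mod_cast this
  have e2 : (a : ℤ) * z.re - a' * z'.re = d * -m := by
    field_simp at hm
    have : (a : ℝ) * z.re - a' * z'.re = d * -m := by linarith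
    exact_mod_cast this
  refine ⟨rfl, ⟨⟨_, e2⟩, ⟨_, e1⟩⟩, ?_⟩
  have h3 : (d : ℤ) ∣ a * det z' z := by
    refine ⟨z'.re * n + m * z'.im, ?_⟩
    simp only [det]
    linear_combination z'.re * e1 - z'.im * e2
  have hcop : IsCoprime (d : ℤ) a := (Nat.isCoprime_iff_coprime.2 ha).symm
  exact hcop.dvd_of_dvd_mul_left h3

/-- The mean square over a box with corner `w` of a combination of Ramanujan sums modulo
`G < d ≤ R`. The terms with the same frequency give the first part, which is smaller than the
trivial bound by the factor `G`. -/
theorem sum_sq_norm_ramanujan_le {N R G H : ℕ} (hG : 0 < G) (hRN : R ≤ 2 * N)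
    {Z : Finset GaussianInt} (hZ : InBox N Z) (hZc : ∀ z ∈ Z, IsCoprime z.re z.im)
    {c : GaussianInt → ℂ} (hc : ∀ z, ‖c z‖ ≤ 1) (φ : ℕ → GaussianInt → ℝ)
    (hφ : ∀ d ∈ Finset.Ioc G R, ∀ z ∈ Z, |φ d z| ≤ 3) (w : GaussianInt) :
    ∑ s ∈ Finset.range H, ∑ t ∈ Finset.range H,
      ‖∑ z ∈ Z, c z * ∑ d ∈ Finset.Ioc G R,
        ramanujanSum d (det (w + ⟨s, t⟩) z) / d * φ d z‖ ^ 2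
      ≤ Z.card * (144 * N ^ 2 * H ^ 2 / G) + 9 * Z.card ^ 2 * R ^ 4 * H := by
  classical
  set J : Finset (GaussianInt × ℕ × ℕ) := (Z ×ˢ (Finset.Ioc G R ×ˢ Finset.range R)).filter
    fun j => j.2.2 < j.2.1 ∧ Nat.Coprime j.2.2 j.2.1 with hJ
  set γ : GaussianInt × ℕ × ℕ → ℂ := fun j =>
    c j.1 * (φ j.2.1 j.1 / j.2.1) * unitExp (j.2.2 * (det w j.1 / j.2.1)) with hγ
  set x : GaussianInt × ℕ × ℕ → ℝ := fun j => j.2.2 * j.1.im / j.2.1 with hx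
  set y : GaussianInt × ℕ × ℕ → ℝ := fun j => -(j.2.2 * j.1.re / j.2.1) with hy
  have hmem : ∀ j ∈ J, j.1 ∈ Z ∧ (G < j.2.1 ∧ j.2.1 ≤ R) ∧ j.2.2 < j.2.1 ∧
      Nat.Coprime j.2.2 j.2.1 := by
    intro j hj
    simp only [hJ, Finset.mem_filter, Finset.mem_product, Finset.mem_Ioc] at hj
    exact ⟨hj.1.1, hj.1.2.1, hj.2⟩
  have hpos : ∀ j ∈ J, 0 < j.2.1 := fun j hj => by
    have := (hmem j hj).2.1.1
    omega
  -- sums over `J` of terms that do not depend on the numerator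
  have hJsum : ∀ f : ℕ → ℝ, (∀ d, 0 ≤ f d) →
      ∑ j ∈ J, f j.2.1 ≤ Z.card * ∑ d ∈ Finset.Ioc G R, d * f d := by
    intro f hf
    rw [hJ, Finset.sum_filter, Finset.sum_product, ← nsmul_eq_mul, ← Finset.sum_const]
    refine Finset.sum_le_sum fun z _ => ?_
    rw [Finset.sum_product]
    refine Finset.sum_le_sum fun d _ => ?_
    simp only
    rw [← Finset.sum_filter, Finset.sum_const, nsmul_eq_mul]
    refine mul_le_mul_of_nonneg_right ?_ (hf d)
    have : ((Finset.range R).filter fun a => a < d ∧ Nat.Coprime a d) ⊆ Finset.range d := by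
      intro a ha
      exact Finset.mem_range.2 (Finset.mem_filter.1 ha).2.1
    have := Finset.card_le_card this
    rw [Finset.card_range] at this
    exact_mod_cast this
  have hexp : ∀ s t : ℕ, ∑ z ∈ Z, c z * ∑ d ∈ Finset.Ioc G R,
        ramanujanSum d (det (w + ⟨s, t⟩) z) / d * φ d z
      = ∑ j ∈ J, γ j * unitExp (s * x j + t * y j) := by
    intro s t
    rw [hJ, Finset.sum_filter, Finset.sum_product]
    refine Finset.sum_congr rfl fun z _ => ?_
    rw [Finset.sum_product, Finset.mul_sum]
    refine Finset.sum_congr rfl fun d hd => ?_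
    rw [Finset.mem_Ioc] at hd
    simp only
    rw [← Finset.sum_filter]
    have hset : ((Finset.range R).filter fun a => a < d ∧ Nat.Coprime a d)
        = (Finset.range d).filter fun a => Nat.Coprime a d := by
      ext a
      simp only [Finset.mem_filter, Finset.mem_range]
      constructor
      · rintro ⟨_, h⟩
        exact h
      · rintro ⟨h1, h2⟩
        exact ⟨by omega, h1, h2⟩
    rw [hset, ramanujanSum, Finset.sum_div, Finset.sum_mul, Finset.mul_sum]
    refine Finset.sum_congr rfl fun a _ => ?_
    have hd0 : (d : ℝ) ≠ 0 := by
      have : 0 < d := by omega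
      positivity
    have e : (a * ((det (w + ⟨s, t⟩) z : ℤ) / d : ℝ) : ℝ)
        = a * (det w z / d) + (s * x (z, d, a) + t * y (z, d, a)) := by
      simp only [hx, hy, det, Zsqrtd.re_add, Zsqrtd.im_add]
      push_cast
      field_simp
      ring
    rw [e, unitExp_add]
    simp only [hγ]
    ring
  simp only [hexp]
  have hγn : ∀ j ∈ J, ‖γ j‖ ≤ 3 / j.2.1 := by
    intro j hj
    obtain ⟨h1, h2, -⟩ := hmem j hj
    simp only [hγ]
    rw [norm_mul, norm_unitExp, mul_one, norm_mul, norm_div, Complex.norm_real, Real.norm_eq_abs,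
      Complex.norm_natCast]
    calc ‖c j.1‖ * (|φ j.2.1 j.1| / j.2.1) ≤ 1 * (3 / j.2.1) := by
          gcongr
          · exact hc _
          · exact hφ _ (Finset.mem_Ioc.2 h2) _ h1
      _ = _ := one_mul _
  refine (sum_sq_norm_exp_le J γ x y H (R ^ 2) ?_).trans ?_
  · intro j hj k hk
    refine ⟨j.2.1 * k.2.1, Nat.mul_pos (hpos j hj) (hpos k hk), ?_, ?_, ?_⟩
    · rw [sq]
      exact Nat.mul_le_mul (hmem j hj).2.1.2 (hmem k hk).2.1.2
    · have h1 : (j.2.1 : ℝ) ≠ 0 := by have := hpos j hj; positivity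
      have h2 : (k.2.1 : ℝ) ≠ 0 := by have := hpos k hk; positivity
      refine ⟨j.2.2 * j.1.im * k.2.1 - k.2.2 * k.1.im * j.2.1, ?_⟩
      simp only [hx]
      push_cast
      field_simp
    · have h1 : (j.2.1 : ℝ) ≠ 0 := by have := hpos j hj; positivity
      have h2 : (k.2.1 : ℝ) ≠ 0 := by have := hpos k hk; positivity
      refine ⟨-(j.2.2 * j.1.re * k.2.1) + k.2.2 * k.1.re * j.2.1, ?_⟩
      simp only [hy]
      push_cast
      field_simp
      ring
  simp only [mul_add, Finset.sum_add_distrib]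
  refine add_le_add ?_ ?_
  · -- equal frequencies
    have hrow : ∀ j ∈ J, ∑ k ∈ J, ‖γ j‖ * ‖γ k‖ *
        (if (∃ n : ℤ, x j - x k = n) ∧ ∃ n : ℤ, y j - y k = n then (H : ℝ) ^ 2 else 0)
        ≤ 144 * N ^ 2 * H ^ 2 / (j.2.1 : ℝ) ^ 3 := by
      intro j hj
      obtain ⟨hj1, hj2, hj3, hj4⟩ := hmem j hj
      have hj0 := hpos j hj
      have hjr : (0 : ℝ) < j.2.1 := by exact_mod_cast hj0
      set F := J.filter fun k => (∃ n : ℤ, x j - x k = n) ∧ ∃ n : ℤ, y j - y k = n with hF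
      have hFmem : ∀ k ∈ F, k ∈ J ∧ j.2.1 = k.2.1 ∧
          ((j.2.1 : ℤ) ∣ j.2.2 * j.1.re - k.2.2 * k.1.re ∧
            (j.2.1 : ℤ) ∣ j.2.2 * j.1.im - k.2.2 * k.1.im) ∧ (j.2.1 : ℤ) ∣ det k.1 j.1 := by
        intro k hk
        rw [hF, Finset.mem_filter] at hk
        obtain ⟨hk0, h1, h2⟩ := hk
        obtain ⟨hk1, hk2, hk3, hk4⟩ := hmem k hk0
        exact ⟨hk0, eq_of_frequency_eq hj0 (hpos k hk0) hj4 hk4 (hZc _ hj1) (hZc _ hk1) h1 h2⟩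
      have hcard : (F.card : ℝ) ≤ 16 * N ^ 2 / j.2.1 := by
        refine le_trans ?_ (card_dvd_det_le hj0 (hj2.2.trans hRN) hZ (hZc _ hj1))
        have : F.card ≤ (Z.filter fun z => (j.2.1 : ℤ) ∣ det z j.1).card := by
          refine Finset.card_le_card_of_injOn (fun k => k.1) ?_ ?_
          · intro k hk
            exact Finset.mem_filter.2 ⟨(hmem k (hFmem k hk).1).1, (hFmem k hk).2.2.2⟩
          · intro k hk l hl hkl
            obtain ⟨hk0, hk1, ⟨hk2, hk3⟩, -⟩ := hFmem k hk
            obtain ⟨hl0, hl1, ⟨hl2, hl3⟩, -⟩ := hFmem l hl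
            simp only at hkl
            have hkc := hZc _ (hmem k hk0).1
            rw [← hkl] at hl2 hl3
            have h3 : (j.2.1 : ℤ) ∣ (l.2.2 : ℤ) - k.2.2 := by
              refine dvd_of_isCoprime_of_dvd_mul hkc ?_ ?_
              · have := dvd_sub hk2 hl2
                ring_nf at this ⊢
                exact this
              · have := dvd_sub hk3 hl3
                ring_nf at this ⊢
                exact this
            have h4 : k.2.2 = l.2.2 := by
              have hk5 := (hmem k hk0).2.2.1
              have hl5 := (hmem l hl0).2.2.1
              rw [← hk1] at hk5
              rw [← hl1] at hl5
              have h6 : (l.2.2 : ℤ) - k.2.2 = 0 :=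
                Int.eq_zero_of_abs_lt_dvd h3 (by rw [abs_lt]; omega)
              omega
            exact Prod.ext hkl (Prod.ext (hk1.symm.trans hl1) h4)
        exact_mod_cast this
      have hsum : ∑ k ∈ J, ‖γ j‖ * ‖γ k‖ *
          (if (∃ n : ℤ, x j - x k = n) ∧ ∃ n : ℤ, y j - y k = n then (H : ℝ) ^ 2 else 0)
          = ∑ k ∈ F, ‖γ j‖ * ‖γ k‖ * (H : ℝ) ^ 2 := by
        simp only [mul_ite, mul_zero]
        exact (Finset.sum_filter _ _).symm
      rw [hsum]
      have hterm : ∀ k ∈ F,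
          ‖γ j‖ * ‖γ k‖ * (H : ℝ) ^ 2 ≤ 3 / j.2.1 * (3 / j.2.1) * (H : ℝ) ^ 2 := by
        intro k hk
        have hk1 := hγn k (hFmem k hk).1
        rw [← (hFmem k hk).2.1] at hk1
        have hj1 := hγn j hj
        gcongr
      refine (Finset.sum_le_sum hterm).trans ?_
      rw [Finset.sum_const, nsmul_eq_mul]
      calc (F.card : ℝ) * (3 / j.2.1 * (3 / j.2.1) * (H : ℝ) ^ 2)
          ≤ 16 * N ^ 2 / j.2.1 * (3 / j.2.1 * (3 / j.2.1) * (H : ℝ) ^ 2) := by gcongr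
        _ = _ := by
            field_simp
            ring
    refine (Finset.sum_le_sum hrow).trans ?_
    refine (hJsum (fun d => 144 * N ^ 2 * H ^ 2 / (d : ℝ) ^ 3) fun d => by positivity).trans ?_
    refine mul_le_mul_of_nonneg_left ?_ (by positivity)
    have hsq : ∑ d ∈ Finset.Ioc G R, ((d : ℝ) ^ 2)⁻¹ ≤ (G : ℝ)⁻¹ := by
      rcases le_total G R with h | h
      · exact (sum_Ioc_inv_sq_le_sub hG.ne' h).trans (sub_le_self _ (by positivity))
      · rw [Finset.Ioc_eq_empty_of_le h, Finset.sum_empty]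
        positivity
    calc ∑ d ∈ Finset.Ioc G R, (d : ℝ) * (144 * N ^ 2 * H ^ 2 / (d : ℝ) ^ 3)
        = 144 * N ^ 2 * H ^ 2 * ∑ d ∈ Finset.Ioc G R, ((d : ℝ) ^ 2)⁻¹ := by
          rw [Finset.mul_sum]
          refine Finset.sum_congr rfl fun d hd => ?_
          have : (d : ℝ) ≠ 0 := by
            have : 0 < d := by rw [Finset.mem_Ioc] at hd; omega
            positivity
          field_simp
      _ ≤ 144 * N ^ 2 * H ^ 2 * (G : ℝ)⁻¹ := by gcongr
      _ = _ := by ring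
  · -- boundary terms
    have h1 : ∑ j ∈ J, ‖γ j‖ ≤ Z.card * (R * 3) := by
      refine (Finset.sum_le_sum hγn).trans ?_
      refine (hJsum (fun d => 3 / (d : ℝ)) fun d => by positivity).trans ?_
      refine mul_le_mul_of_nonneg_left ?_ (by positivity)
      have : ∀ d ∈ Finset.Ioc G R, (d : ℝ) * (3 / d) = 3 := by
        intro d hd
        have : (d : ℝ) ≠ 0 := by
          have : 0 < d := by rw [Finset.mem_Ioc] at hd; omega
          positivity
        field_simp
      rw [Finset.sum_congr rfl this, Finset.sum_const, nsmul_eq_mul, Nat.card_Ioc]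
      gcongr
      exact Nat.sub_le _ _
    have h2 : ∑ j ∈ J, ∑ k ∈ J, ‖γ j‖ * ‖γ k‖ * ((H : ℝ) * ((R ^ 2 : ℕ) : ℝ))
        = (∑ j ∈ J, ‖γ j‖) ^ 2 * (H * R ^ 2) := by
      rw [sq (∑ j ∈ J, ‖γ j‖), Finset.sum_mul_sum, Finset.sum_mul]
      refine Finset.sum_congr rfl fun j _ => ?_
      rw [Finset.sum_mul]
      push_cast
      rfl
    rw [h2]
    have h0 : 0 ≤ ∑ j ∈ J, ‖γ j‖ := Finset.sum_nonneg fun _ _ => norm_nonneg _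
    calc (∑ j ∈ J, ‖γ j‖) ^ 2 * ((H : ℝ) * R ^ 2)
        ≤ (Z.card * (R * 3)) ^ 2 * (H * R ^ 2) := by gcongr
      _ = _ := by ring

/-! ### Large complementary divisors -/

theorem abs_det_le {N M : ℕ} {z w : GaussianInt} (hz : |z.re| ≤ N ∧ |z.im| ≤ N)
    (hw : |w.re| ≤ M ∧ |w.im| ≤ M) : |det z w| ≤ 2 * N * M := by
  have h1 : |z.re * w.im| ≤ N * M := by
    rw [abs_mul]; exact mul_le_mul hz.1 hw.2 (abs_nonneg _) (by positivity)
  have h2 : |w.re * z.im| ≤ M * N := by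
    rw [abs_mul]; exact mul_le_mul hw.1 hz.2 (abs_nonneg _) (by positivity)
  have := abs_sub (z.re * w.im) (w.re * z.im)
  simp only [det]
  linarith

/-- The weight changes between `n` and `n'` only if a multiple of `P` lies between their
absolute values. -/
theorem divisorWeight_eq_of_forall_far {P R d : ℕ} {n n' : ℤ} {Y : ℕ} (hd : 0 < d)
    (hnn : |n - n'| ≤ Y)
    (h : ∀ r ∈ Finset.Icc 1 (4 * R), ¬ |n - r * P| ≤ Y ∧ ¬ |n - -(r * P)| ≤ Y) :
    divisorWeight P R d n = divisorWeight P R d n' := by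
  unfold divisorWeight
  refine Finset.sum_congr rfl fun m hm => ?_
  rw [Finset.mem_Icc, Nat.le_div_iff_mul_le hd] at hm
  have hdm : m * d = d * m := mul_comm _ _
  have hdm0 : 0 < d * m := Nat.mul_pos hd hm.1
  have far : ∀ r : ℕ, 0 < r → r ≤ 4 * R → (r * P < n.natAbs ↔ r * P < n'.natAbs) := by
    intro r hr hr4
    obtain ⟨h1, h2⟩ := h r (Finset.mem_Icc.2 ⟨hr, hr4⟩)
    have e : ((r * P : ℕ) : ℤ) = r * P := by push_cast; rfl
    rw [← e] at h1 h2
    generalize r * P = x at h1 h2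
    rw [abs_le] at h1 h2 hnn
    omega
  have f1 := far (d * m) hdm0 (by omega)
  have f2 := far (4 * (d * m)) (by omega) (by omega)
  rw [show 4 * (d * m) * P = 4 * (d * m * P) by ring] at f2
  have f3 : n.natAbs ≤ 4 * (d * m * P) ↔ n'.natAbs ≤ 4 * (d * m * P) := by
    rw [← not_lt, ← not_lt, f2]
  simp only [f1, f3]

/-- The points of a box as `corner + offset`, with corners in the lattice `H ℤ[i]`. -/
def cellPoint (H : ℕ) (x : (ℤ × ℤ) × (ℕ × ℕ)) : GaussianInt :=
  ⟨x.1.1 * H, x.1.2 * H⟩ + ⟨x.2.1, x.2.2⟩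

/-- The labels (corner and offset) of the points of `[-I H, I H) ^ 2`. -/
noncomputable def cellIndex (I H : ℕ) : Finset ((ℤ × ℤ) × (ℕ × ℕ)) :=
  (Finset.Ico (-(I : ℤ)) I ×ˢ Finset.Ico (-(I : ℤ)) I) ×ˢ (Finset.range H ×ˢ Finset.range H)

theorem cellPoint_injOn (I H : ℕ) : Set.InjOn (cellPoint H) (cellIndex I H) := by
  rintro ⟨⟨i, j⟩, s, t⟩ h1 ⟨⟨i', j'⟩, s', t'⟩ h2 h
  simp only [cellIndex, Finset.coe_product, Set.mem_prod, Finset.mem_coe, Finset.mem_range] at h1 h2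
  have hre := congrArg Zsqrtd.re h
  have him := congrArg Zsqrtd.im h
  simp only [cellPoint, Zsqrtd.re_add, Zsqrtd.im_add] at hre him
  have aux : ∀ {i i' : ℤ} {s s' : ℕ}, s < H → s' < H → i * H + s = i' * H + s' →
      i = i' ∧ s = s' := by
    intro i i' s s' hs hs' he
    have e1 : (i * H + s) / (H : ℤ) = i := by
      rw [add_comm, Int.add_mul_ediv_right _ _ (by omega),
        Int.ediv_eq_zero_of_lt (by omega) (by omega), zero_add]
    have e2 : (i' * H + s') / (H : ℤ) = i' := by
      rw [add_comm, Int.add_mul_ediv_right _ _ (by omega),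
        Int.ediv_eq_zero_of_lt (by omega) (by omega), zero_add]
    have : i = i' := by rw [← e1, ← e2, he]
    subst this
    exact ⟨rfl, by omega⟩
  obtain ⟨rfl, rfl⟩ := aux h1.2.1 h2.2.1 hre
  obtain ⟨rfl, rfl⟩ := aux h1.2.2 h2.2.2 him
  rfl

theorem sum_le_sum_cellPoint {N H I : ℕ} (hH : 0 < H) (hI : N < I * H) {Z : Finset GaussianInt}
    (hZ : InBox N Z) (g : GaussianInt → ℝ) (hg : ∀ z, 0 ≤ g z) :
    ∑ z ∈ Z, g z ≤ ∑ x ∈ cellIndex I H, g (cellPoint H x) := by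
  classical
  rw [← Finset.sum_image (f := g) (cellPoint_injOn I H)]
  refine Finset.sum_le_sum_of_subset_of_nonneg ?_ fun _ _ _ => hg _
  intro z hz
  have hHZ : (0 : ℤ) < H := by exact_mod_cast hH
  have hIH : (N : ℤ) < I * H := by exact_mod_cast hI
  have aux : ∀ u : ℤ, |u| ≤ N → u / (H : ℤ) ∈ Finset.Ico (-(I : ℤ)) I ∧
      (u % (H : ℤ)).toNat ∈ Finset.range H ∧
      u / (H : ℤ) * H + ((u % (H : ℤ)).toNat : ℤ) = u := by
    intro u hu
    rw [abs_le] at hu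
    have h0 := Int.emod_nonneg u hHZ.ne'
    have h1 := Int.emod_lt_of_pos u hHZ
    refine ⟨?_, ?_, ?_⟩
    · rw [Finset.mem_Ico]
      constructor
      · rw [Int.le_ediv_iff_mul_le hHZ]
        linarith
      · rw [Int.ediv_lt_iff_lt_mul hHZ]
        linarith
    · rw [Finset.mem_range]
      omega
    · rw [Int.toNat_of_nonneg h0]
      exact Int.ediv_mul_add_emod u H
  obtain ⟨a1, a2, a3⟩ := aux z.re (hZ z hz).1
  obtain ⟨b1, b2, b3⟩ := aux z.im (hZ z hz).2
  refine Finset.mem_image.2 ⟨((z.re / H, z.im / H), ((z.re % H).toNat, (z.im % H).toNat)), ?_, ?_⟩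
  · simp only [cellIndex, Finset.mem_product]
    exact ⟨⟨a1, b1⟩, a2, b2⟩
  · refine Zsqrtd.ext ?_ ?_
    · simpa [cellPoint] using a3
    · simpa [cellPoint] using b3

/-- The part of the divisor count that comes from complementary divisors with a component
`d > G`: the contribution is smaller than the trivial bound by the factor `G ^ (1 / 2)`. The first
variable is extended to all lattice points, which are grouped into boxes of side `H`; on such a
box the archimedean weights are constant, up to few exceptional pairs. -/
theorem norm_sum_large_le {N P R G H : ℕ} (hN : 0 < N) (hP : 0 < P) (hG : 0 < G) (hRN : R ≤ 2 * N)
    (hH : 0 < H) (hHN : H ≤ N) (hRP : 4 * N ^ 2 ≤ R * P) {Z : Finset GaussianInt}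
    (hZ : InBox N Z) (hZc : ∀ z ∈ Z, IsCoprime z.re z.im) (hZ0 : ∀ z ∈ Z, z.im ≠ 0)
    {c : GaussianInt → ℂ} (hc : ∀ z, ‖c z‖ ≤ 1) :
    ‖∑ z ∈ Z, ∑ w ∈ Z, c z * conj (c w) *
        ∑ d ∈ Finset.Ioc G R, ramanujanSum d (det z w) / d * divisorWeight P R d (det z w)‖
      ≤ 16 * N ^ 4 * √(1296 / G + 729 * R ^ 4 / H)
        + 3960 * R ^ 2 * H * N ^ 3 * (1 + Real.log N) := by
  classical
  set I := N / H + 1 with hI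
  have hIH1 : N < I * H := by
    rw [hI, mul_comm]
    exact Nat.lt_mul_div_succ N hH
  have hIH2 : I * H ≤ 2 * N := by
    rw [hI, add_mul, one_mul]
    have := Nat.div_mul_le_self N H
    omega
  set T := cellIndex I H with hT
  have hN1 : (1 : ℝ) ≤ N := by exact_mod_cast hN
  have hH1 : (1 : ℝ) ≤ H := by exact_mod_cast hH
  have hl : 0 ≤ Real.log N := Real.log_nonneg hN1
  have hZcard : (Z.card : ℝ) ≤ 9 * N ^ 2 := hZ.card_le.trans (by nlinarith)
  let crn : (ℤ × ℤ) × (ℕ × ℕ) → GaussianInt := fun x => ⟨x.1.1 * H, x.1.2 * H⟩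
  -- the corners and the points of the boxes lie in a box of side `2 N`
  have hmemT : ∀ x ∈ T, ((-(I : ℤ) ≤ x.1.1 ∧ x.1.1 < I) ∧ (-(I : ℤ) ≤ x.1.2 ∧ x.1.2 < I)) ∧
      x.2.1 < H ∧ x.2.2 < H := by
    intro x hx
    simpa only [hT, cellIndex, Finset.mem_product, Finset.mem_Ico, Finset.mem_range] using hx
  have hIH2' : (I : ℤ) * H ≤ 2 * N := by exact_mod_cast hIH2
  have hHZ : (0 : ℤ) < H := by exact_mod_cast hH
  have hb1 : ∀ i : ℤ, -(I : ℤ) ≤ i → i < I → ∀ s : ℕ, s < H → |i * H + s| ≤ (2 * N : ℕ) := by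
    intro i h1 h2 s hs
    have hs' : (s : ℤ) < H := by exact_mod_cast hs
    have e1 : -(I : ℤ) * H ≤ i * H := mul_le_mul_of_nonneg_right h1 hHZ.le
    have e2 : i * H ≤ ((I : ℤ) - 1) * H := mul_le_mul_of_nonneg_right (by omega) hHZ.le
    rw [abs_le]
    push_cast
    constructor
    · linarith
    · linarith
  have hcrn : ∀ x ∈ T, |(crn x).re| ≤ (2 * N : ℕ) ∧ |(crn x).im| ≤ (2 * N : ℕ) := by
    intro x hx
    obtain ⟨⟨h1, h2⟩, -⟩ := hmemT x hx
    have e1 := hb1 _ h1.1 h1.2 0 hH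
    have e2 := hb1 _ h2.1 h2.2 0 hH
    rw [Nat.cast_zero, add_zero] at e1 e2
    exact ⟨e1, e2⟩
  have hpt : ∀ x ∈ T, |(cellPoint H x).re| ≤ (2 * N : ℕ) ∧ |(cellPoint H x).im| ≤ (2 * N : ℕ) := by
    intro x hx
    obtain ⟨⟨h1, h2⟩, h3, h4⟩ := hmemT x hx
    exact ⟨hb1 _ h1.1 h1.2 _ h3, hb1 _ h2.1 h2.2 _ h4⟩
  have hdetRP : ∀ z : GaussianInt, |z.re| ≤ (2 * N : ℕ) ∧ |z.im| ≤ (2 * N : ℕ) → ∀ w ∈ Z,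
      (det z w).natAbs ≤ R * P := by
    intro z hz w hw
    have := abs_det_le hz (hZ w hw)
    push_cast at this
    have e : ((R * P : ℕ) : ℤ) ≥ 4 * N ^ 2 := by exact_mod_cast hRP
    zify
    push_cast at e
    calc |det z w| ≤ 2 * (2 * N) * N := this
      _ = 4 * N ^ 2 := by ring
      _ ≤ _ := e
  let b : GaussianInt → GaussianInt → ℂ := fun z w =>
    ∑ d ∈ Finset.Ioc G R, ramanujanSum d (det z w) / d * divisorWeight P R d (det z w)
  let b' : (ℤ × ℤ) × (ℕ × ℕ) → GaussianInt → ℂ := fun x w =>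
    ∑ d ∈ Finset.Ioc G R,
      ramanujanSum d (det (cellPoint H x) w) / d * divisorWeight P R d (det (crn x) w)
  -- passage to all lattice points
  have s1 : ‖∑ z ∈ Z, ∑ w ∈ Z, c z * conj (c w) * b z w‖
      ≤ ∑ x ∈ T, ‖∑ w ∈ Z, conj (c w) * b (cellPoint H x) w‖ := by
    calc _ ≤ ∑ z ∈ Z, ‖∑ w ∈ Z, conj (c w) * b z w‖ := by
          refine (norm_sum_le _ _).trans (Finset.sum_le_sum fun z _ => ?_)
          simp only [mul_assoc]
          rw [← Finset.mul_sum, norm_mul]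
          exact mul_le_of_le_one_left (norm_nonneg _) (hc z)
      _ ≤ _ := sum_le_sum_cellPoint hH hIH1 hZ (fun z => ‖∑ w ∈ Z, conj (c w) * b z w‖)
          fun z => norm_nonneg _
  have s2 : ∑ x ∈ T, ‖∑ w ∈ Z, conj (c w) * b (cellPoint H x) w‖
      ≤ ∑ x ∈ T, ‖∑ w ∈ Z, conj (c w) * b' x w‖
        + ∑ x ∈ T, ∑ w ∈ Z, ‖b (cellPoint H x) w - b' x w‖ := by
    rw [← Finset.sum_add_distrib]
    refine Finset.sum_le_sum fun x _ => ?_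
    have e : ∑ w ∈ Z, conj (c w) * b (cellPoint H x) w
        = ∑ w ∈ Z, conj (c w) * b' x w
          + ∑ w ∈ Z, conj (c w) * (b (cellPoint H x) w - b' x w) := by
      rw [← Finset.sum_add_distrib]
      exact Finset.sum_congr rfl fun w _ => by ring
    rw [e]
    refine (norm_add_le _ _).trans (add_le_add le_rfl ?_)
    refine (norm_sum_le _ _).trans (Finset.sum_le_sum fun w _ => ?_)
    rw [norm_mul, RCLike.norm_conj]
    exact mul_le_of_le_one_left (norm_nonneg _) (hc w)
  -- the mean square over the boxes
  have hIHr : (2 * I : ℝ) * H ≤ 4 * N := by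
    have : (I : ℝ) * H ≤ 2 * N := by exact_mod_cast hIH2
    linarith
  have hsq : ∑ x ∈ T, ‖∑ w ∈ Z, conj (c w) * b' x w‖ ^ 2
      ≤ 16 * N ^ 6 * (1296 / G + 729 * R ^ 4 / H) := by
    rw [hT, cellIndex, Finset.sum_product]
    have hcell : ∀ y ∈ Finset.Ico (-(I : ℤ)) I ×ˢ Finset.Ico (-(I : ℤ)) I,
        ∑ st ∈ Finset.range H ×ˢ Finset.range H, ‖∑ w ∈ Z, conj (c w) * b' (y, st) w‖ ^ 2
        ≤ H ^ 2 * (N ^ 4 * (1296 / G + 729 * R ^ 4 / H)) := by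
      intro y hy
      rw [Finset.sum_product]
      have := sum_sq_norm_ramanujan_le (H := H) hG hRN hZ hZc (c := fun w => conj (c w))
        (fun z => by rw [RCLike.norm_conj]; exact hc z)
        (fun d w => divisorWeight P R d (det ⟨y.1 * H, y.2 * H⟩ w)) ?_ ⟨y.1 * H, y.2 * H⟩
      · refine this.trans ?_
        calc (Z.card : ℝ) * (144 * N ^ 2 * H ^ 2 / G) + 9 * Z.card ^ 2 * R ^ 4 * H
            ≤ 9 * (N : ℝ) ^ 2 * (144 * (N : ℝ) ^ 2 * (H : ℝ) ^ 2 / G)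
              + 9 * (9 * (N : ℝ) ^ 2) ^ 2 * (R : ℝ) ^ 4 * H := by
              gcongr
          _ = (H : ℝ) ^ 2 * ((N : ℝ) ^ 4 * (1296 / (G : ℝ) + 729 * (R : ℝ) ^ 4 / (H : ℝ))) := by
              field_simp
              ring
      · intro d hd w hw
        rw [abs_of_nonneg (divisorWeight_nonneg _ _ _ _)]
        refine divisorWeight_le_three hP ?_ ?_
        · rw [Finset.mem_Ioc] at hd
          omega
        · refine hdetRP _ (hcrn (y, (0, 0)) ?_) w hw
          rw [hT, cellIndex, Finset.mem_product]
          exact ⟨hy, Finset.mem_product.2 ⟨Finset.mem_range.2 hH, Finset.mem_range.2 hH⟩⟩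
    refine (Finset.sum_le_sum hcell).trans ?_
    rw [Finset.sum_const, nsmul_eq_mul, Finset.card_product, Int.card_Ico]
    have e : ((I : ℤ) - -I).toNat = 2 * I := by omega
    rw [e]
    push_cast
    calc (2 * (I : ℝ)) * (2 * I) * ((H : ℝ) ^ 2 *
          ((N : ℝ) ^ 4 * (1296 / (G : ℝ) + 729 * (R : ℝ) ^ 4 / (H : ℝ))))
        = (2 * I * H) ^ 2 * ((N : ℝ) ^ 4 * (1296 / (G : ℝ) + 729 * (R : ℝ) ^ 4 / (H : ℝ))) := by
          ring
      _ ≤ (4 * N) ^ 2 * ((N : ℝ) ^ 4 * (1296 / (G : ℝ) + 729 * (R : ℝ) ^ 4 / (H : ℝ))) := by gcongr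
      _ = _ := by ring
  have hTcard : (T.card : ℝ) ≤ 16 * N ^ 2 := by
    rw [hT, cellIndex, Finset.card_product, Finset.card_product, Finset.card_product,
      Int.card_Ico, Finset.card_range]
    have e : ((I : ℤ) - -I).toNat = 2 * I := by omega
    rw [e]
    push_cast
    calc (2 * (I : ℝ)) * (2 * I) * (H * H) = (2 * I * H) ^ 2 := by ring
      _ ≤ (4 * N) ^ 2 := by gcongr
      _ = _ := by ring
  have s3 : ∑ x ∈ T, ‖∑ w ∈ Z, conj (c w) * b' x w‖
      ≤ 16 * N ^ 4 * √(1296 / G + 729 * R ^ 4 / H) := by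
    have h1 : (∑ x ∈ T, ‖∑ w ∈ Z, conj (c w) * b' x w‖) ^ 2
        ≤ (16 * N ^ 4) ^ 2 * (1296 / G + 729 * R ^ 4 / H) := by
      calc _ ≤ (T.card : ℝ) * ∑ x ∈ T, ‖∑ w ∈ Z, conj (c w) * b' x w‖ ^ 2 :=
            sq_sum_le_card_mul_sum_sq
        _ ≤ 16 * N ^ 2 * (16 * N ^ 6 * (1296 / G + 729 * R ^ 4 / H)) := by gcongr
        _ = _ := by ring
    have h2 := Real.le_sqrt_of_sq_le h1
    rw [Real.sqrt_mul (by positivity), Real.sqrt_sq (by positivity)] at h2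
    exact h2
  -- the exceptional pairs
  set Y := 2 * H * N with hY
  let rare : ℤ → GaussianInt → GaussianInt → Prop := fun e z w => |det z w - e| ≤ Y
  have hdiff : ∀ x ∈ T, ∀ w ∈ Z, ‖b (cellPoint H x) w - b' x w‖
      ≤ 3 * R * ∑ r ∈ Finset.Icc 1 (4 * R),
        ((if rare (r * P) (cellPoint H x) w then 1 else 0 : ℝ)
          + if rare (-(r * P)) (cellPoint H x) w then 1 else 0) := by
    intro x hx w hw
    have hnn : |det (cellPoint H x) w - det (crn x) w| ≤ Y := by
      have e : det (cellPoint H x) w - det (crn x) w = det ⟨x.2.1, x.2.2⟩ w := by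
        simp only [det, cellPoint, crn, Zsqrtd.re_add, Zsqrtd.im_add]
        ring
      rw [e]
      obtain ⟨-, h3, h4⟩ := hmemT x hx
      have := abs_det_le (N := H) (z := ⟨x.2.1, x.2.2⟩) ?_ (hZ w hw)
      · rw [hY]
        push_cast
        exact this
      · simp only [Nat.abs_cast]
        omega
    have hbb : b (cellPoint H x) w - b' x w = ∑ d ∈ Finset.Ioc G R,
        ramanujanSum d (det (cellPoint H x) w) / d *
          ((divisorWeight P R d (det (cellPoint H x) w)
            - divisorWeight P R d (det (crn x) w) : ℝ) : ℂ) := by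
      simp only [b, b']
      rw [← Finset.sum_sub_distrib]
      refine Finset.sum_congr rfl fun d _ => ?_
      push_cast
      ring
    have hnonneg : ∀ r ∈ Finset.Icc 1 (4 * R),
        (0 : ℝ) ≤ (if rare (r * P) (cellPoint H x) w then 1 else 0 : ℝ)
          + if rare (-(r * P)) (cellPoint H x) w then 1 else 0 := by
      intro r _
      positivity
    by_cases hfar : ∀ r ∈ Finset.Icc 1 (4 * R), ¬ rare (r * P) (cellPoint H x) w ∧
        ¬ rare (-(r * P)) (cellPoint H x) w
    · rw [hbb, Finset.sum_eq_zero, norm_zero]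
      · exact mul_nonneg (by positivity) (Finset.sum_nonneg hnonneg)
      · intro d hd
        have hd0 : 0 < d := by rw [Finset.mem_Ioc] at hd; omega
        rw [divisorWeight_eq_of_forall_far hd0 hnn hfar, sub_self]
        simp
    · have hone : (1 : ℝ) ≤ ∑ r ∈ Finset.Icc 1 (4 * R),
          ((if rare (r * P) (cellPoint H x) w then 1 else 0 : ℝ)
          + if rare (-(r * P)) (cellPoint H x) w then 1 else 0) := by
        push Not at hfar
        obtain ⟨r, hr, hr'⟩ := hfar
        refine le_trans ?_ (Finset.single_le_sum hnonneg hr)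
        by_cases h1 : rare (r * P) (cellPoint H x) w
        · rw [if_pos h1]
          have : (0 : ℝ) ≤ if rare (-(r * P)) (cellPoint H x) w then 1 else 0 := by positivity
          linarith
        · rw [if_pos (hr' h1), if_neg h1, zero_add]
      have hbound : ‖b (cellPoint H x) w - b' x w‖ ≤ 3 * R := by
        rw [hbb]
        have hterm : ∀ d ∈ Finset.Ioc G R, ‖ramanujanSum d (det (cellPoint H x) w) / d *
            ((divisorWeight P R d (det (cellPoint H x) w)
            - divisorWeight P R d (det (crn x) w) : ℝ) : ℂ)‖ ≤ 3 := by
          intro d hd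
          have hd0 : 0 < d := by rw [Finset.mem_Ioc] at hd; omega
          have hdr : (0 : ℝ) < d := by exact_mod_cast hd0
          rw [norm_mul, norm_div, Complex.norm_natCast, Complex.norm_real, Real.norm_eq_abs]
          have e1 : ‖ramanujanSum d (det (cellPoint H x) w)‖ / d ≤ 1 := by
            rw [div_le_one hdr]
            exact norm_ramanujanSum_le _ _
          have e2 := divisorWeight_nonneg P R d (det (cellPoint H x) w)
          have e3 := divisorWeight_nonneg P R d (det (crn x) w)
          have e4 := divisorWeight_le_three hP hd0 (hdetRP _ (hpt x hx) w hw)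
          have e5 := divisorWeight_le_three hP hd0 (hdetRP _ (hcrn x hx) w hw)
          have e6 : |divisorWeight P R d (det (cellPoint H x) w)
              - divisorWeight P R d (det (crn x) w)| ≤ 3 := by
            rw [abs_le]
            constructor <;> linarith
          calc _ ≤ (1 : ℝ) * 3 := mul_le_mul e1 e6 (abs_nonneg _) zero_le_one
            _ = 3 := one_mul 3
        refine (norm_sum_le _ _).trans ((Finset.sum_le_sum hterm).trans ?_)
        rw [Finset.sum_const, nsmul_eq_mul, Nat.card_Ioc]
        have : ((R - G : ℕ) : ℝ) ≤ R := by exact_mod_cast Nat.sub_le R G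
        linarith
      exact hbound.trans (le_mul_of_one_le_right (by positivity) hone)
  have hTbox : InBox (2 * N) (T.image (cellPoint H)) := by
    intro z hz
    obtain ⟨x, hx, rfl⟩ := Finset.mem_image.1 hz
    exact hpt x hx
  have hcount : ∀ e : ℤ, ∑ x ∈ T, ∑ w ∈ Z, (if rare e (cellPoint H x) w then 1 else 0 : ℝ)
      ≤ 165 * H * N ^ 3 * (1 + Real.log N) := by
    intro e
    have h1 := sum_card_det_near_le hTbox hZ hZ0 e Y
    rw [Finset.sum_comm]
    have h2 : ∀ w ∈ Z, ∑ x ∈ T, (if rare e (cellPoint H x) w then 1 else 0 : ℝ)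
        = (((T.image (cellPoint H)).filter fun z => |det z w - e| ≤ Y).card : ℝ) := by
      intro w _
      rw [Finset.card_filter, Finset.sum_image (cellPoint_injOn I H)]
      push_cast
      rfl
    rw [Finset.sum_congr rfl h2]
    refine h1.trans ?_
    rw [hY]
    push_cast
    calc (2 * (2 * (N : ℝ)) + 1) * (2 * N + 1) * (4 * (2 * H * N) * (1 + Real.log N) + (2 * N + 1))
        ≤ (5 * N) * (3 * N) * (4 * (2 * H * N) * (1 + Real.log N) + 3 * N) := by
          gcongr <;> linarith
      _ ≤ (5 * N) * (3 * N) * (4 * (2 * H * N) * (1 + Real.log N)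
            + 3 * (H * N * (1 + Real.log N))) := by
          gcongr
          calc (N : ℝ) = 1 * N * 1 := by ring
            _ ≤ H * N * (1 + Real.log N) := by
                gcongr
                linarith
      _ = _ := by ring
  have s4 : ∑ x ∈ T, ∑ w ∈ Z, ‖b (cellPoint H x) w - b' x w‖
      ≤ 3960 * R ^ 2 * H * N ^ 3 * (1 + Real.log N) := by
    calc _ ≤ ∑ x ∈ T, ∑ w ∈ Z, 3 * R * ∑ r ∈ Finset.Icc 1 (4 * R),
        ((if rare (r * P) (cellPoint H x) w then 1 else 0 : ℝ)
          + if rare (-(r * P)) (cellPoint H x) w then 1 else 0) :=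
          Finset.sum_le_sum fun x hx => Finset.sum_le_sum fun w hw => hdiff x hx w hw
      _ = 3 * R * ∑ r ∈ Finset.Icc 1 (4 * R),
          ((∑ x ∈ T, ∑ w ∈ Z, (if rare (r * P) (cellPoint H x) w then 1 else 0 : ℝ))
            + ∑ x ∈ T, ∑ w ∈ Z, if rare (-(r * P)) (cellPoint H x) w then 1 else 0) := by
          simp only [← Finset.mul_sum]
          congr 1
          rw [Finset.sum_congr rfl fun x _ => Finset.sum_comm, Finset.sum_comm]
          refine Finset.sum_congr rfl fun r _ => ?_
          rw [← Finset.sum_add_distrib]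
          exact Finset.sum_congr rfl fun x _ => Finset.sum_add_distrib
      _ ≤ 3 * R * ∑ r ∈ Finset.Icc 1 (4 * R), (165 * H * N ^ 3 * (1 + Real.log N)
          + 165 * H * N ^ 3 * (1 + Real.log N)) := by
          gcongr with r _
          · exact hcount _
          · exact hcount _
      _ = _ := by
          rw [Finset.sum_const, nsmul_eq_mul, Nat.card_Icc]
          rw [Nat.add_sub_cancel]
          push_cast
          ring
  calc _ ≤ _ := s1.trans s2
    _ ≤ _ := add_le_add s3 s4

/-! ### Small complementary divisors and the full range `(P, 4 P]` -/

theorem ramanujanSum_congr {d : ℕ} (hd : 0 < d) {n n' : ℤ} (h : (d : ℤ) ∣ n - n') :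
    ramanujanSum d n = ramanujanSum d n' := by
  obtain ⟨k, hk⟩ := h
  refine Finset.sum_congr rfl fun a _ => ?_
  have hd0 : (d : ℝ) ≠ 0 := by positivity
  have e : (a : ℝ) * (n / d) = a * (n' / d) + ((a * k : ℤ) : ℝ) := by
    have : (n : ℝ) = n' + d * k := by
      have : n = n' + d * k := by linarith
      exact_mod_cast this
    rw [this]
    push_cast
    field_simp
  rw [e, unitExp_add, unitExp_intCast, mul_one]

theorem natCast_dvd_iff {d : ℕ} {z : GaussianInt} :
    (d : GaussianInt) ∣ z ↔ (d : ℤ) ∣ z.re ∧ (d : ℤ) ∣ z.im := by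
  rw [← Zsqrtd.intCast_dvd]
  simp

open Classical in
/-- A bound for the sums of `c` over the residue classes modulo `d` bounds the sum of `c` against
every function of period `d`. -/
theorem norm_sum_mul_periodic_le {d : ℕ} (hd : 0 < d) {Z : Finset GaussianInt}
    {c F : GaussianInt → ℂ} {E M : ℝ} (hF : ∀ z, ‖F z‖ ≤ M)
    (hper : ∀ z w, (d : GaussianInt) ∣ z - w → F z = F w)
    (hE : ∀ α : GaussianInt, ‖∑ z ∈ Z with (d : GaussianInt) ∣ z - α, c z‖ ≤ E) :
    ‖∑ z ∈ Z, c z * F z‖ ≤ d ^ 2 * (E * M) := by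
  have hdZ : (0 : ℤ) < d := by exact_mod_cast hd
  set I := Finset.Ico (0 : ℤ) d ×ˢ Finset.Ico (0 : ℤ) d with hI
  have hmap : ∀ z ∈ Z, (z.re % (d : ℤ), z.im % (d : ℤ)) ∈ I := fun z _ =>
    Finset.mem_product.2 ⟨Finset.mem_Ico.2 ⟨Int.emod_nonneg _ hdZ.ne', Int.emod_lt_of_pos _ hdZ⟩,
      Finset.mem_Ico.2 ⟨Int.emod_nonneg _ hdZ.ne', Int.emod_lt_of_pos _ hdZ⟩⟩
  rw [← Finset.sum_fiberwise_of_maps_to hmap]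
  have hfib : ∀ p ∈ I, ‖∑ z ∈ Z with (z.re % (d : ℤ), z.im % (d : ℤ)) = p, c z * F z‖ ≤ E * M := by
    rintro ⟨a, b⟩ hp
    simp only [hI, Finset.mem_product, Finset.mem_Ico] at hp
    have hiff : ∀ z : GaussianInt, (z.re % (d : ℤ), z.im % (d : ℤ)) = (a, b) ↔
        (d : GaussianInt) ∣ z - ⟨a, b⟩ := by
      intro z
      have aux : ∀ {u v : ℤ}, 0 ≤ v → v < d → (u % (d : ℤ) = v ↔ (d : ℤ) ∣ u - v) := by
        intro u v h0 h1
        rw [← Int.modEq_iff_dvd, Int.modEq_comm, Int.ModEq, Int.emod_eq_of_lt h0 h1]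
      rw [natCast_dvd_iff, Prod.mk.injEq, Zsqrtd.re_sub, Zsqrtd.im_sub, aux hp.1.1 hp.1.2,
        aux hp.2.1 hp.2.2]
    rw [Finset.sum_congr (Finset.filter_congr fun z _ => hiff z) fun _ _ => rfl]
    have hconst : ∑ z ∈ Z with (d : GaussianInt) ∣ z - ⟨a, b⟩, c z * F z
        = (∑ z ∈ Z with (d : GaussianInt) ∣ z - ⟨a, b⟩, c z) * F ⟨a, b⟩ := by
      rw [Finset.sum_mul]
      exact Finset.sum_congr rfl fun z hz => by rw [hper z _ (Finset.mem_filter.1 hz).2]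
    rw [hconst, norm_mul]
    exact mul_le_mul (hE _) (hF _) (norm_nonneg _) ((norm_nonneg _).trans (hE 0))
  refine (norm_sum_le _ _).trans ((Finset.sum_le_sum hfib).trans (le_of_eq ?_))
  rw [Finset.sum_const, hI, Finset.card_product, Int.card_Ico, nsmul_eq_mul, sub_zero,
    Int.toNat_natCast]
  push_cast
  ring

open Classical in
/-- The part of the denominators `d ≤ G`, with constant weight: `ramanujanSum d (det z w)` has
period `d` in `z`, so that only the sums of `c` over residue classes enter. -/
theorem norm_sum_ramanujan_le {N G : ℕ} (hN : 0 < N) {Z : Finset GaussianInt} (hZ : InBox N Z)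
    {c : GaussianInt → ℂ} (hc : ∀ z, ‖c z‖ ≤ 1) {E : ℝ}
    (hE : ∀ d ∈ Finset.Icc 1 G, ∀ α : GaussianInt,
      ‖∑ z ∈ Z with (d : GaussianInt) ∣ z - α, c z‖ ≤ E) :
    ‖∑ z ∈ Z, ∑ w ∈ Z, c z * conj (c w) *
      ∑ d ∈ Finset.Icc 1 G, ramanujanSum d (det z w) / d * (Real.log 4 : ℂ)‖
      ≤ 18 * N ^ 2 * G ^ 3 * E := by
  rcases Nat.eq_zero_or_pos G with rfl | hG
  · simp
  have hE0 : 0 ≤ E := (norm_nonneg _).trans (hE 1 (Finset.mem_Icc.2 ⟨le_rfl, hG⟩) 0)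
  have hN1 : (1 : ℝ) ≤ N := by exact_mod_cast hN
  have hZcard : (Z.card : ℝ) ≤ 9 * N ^ 2 := hZ.card_le.trans (by nlinarith)
  have l4 : Real.log 4 ≤ 2 := by
    rw [show (4 : ℝ) = 2 ^ 2 by norm_num, Real.log_pow]
    have := Real.log_two_lt_d9
    push_cast
    linarith
  have l40 : 0 ≤ Real.log 4 := Real.log_nonneg (by norm_num)
  have e : ∑ z ∈ Z, ∑ w ∈ Z, c z * conj (c w) *
      ∑ d ∈ Finset.Icc 1 G, ramanujanSum d (det z w) / d * (Real.log 4 : ℂ)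
      = ∑ w ∈ Z, ∑ d ∈ Finset.Icc 1 G, conj (c w) * (Real.log 4 / d : ℂ) *
        ∑ z ∈ Z, c z * ramanujanSum d (det z w) := by
    rw [Finset.sum_comm]
    refine Finset.sum_congr rfl fun w _ => ?_
    simp only [Finset.mul_sum]
    rw [Finset.sum_comm]
    refine Finset.sum_congr rfl fun d _ => Finset.sum_congr rfl fun z _ => ?_
    ring
  rw [e]
  have hterm : ∀ w ∈ Z, ∀ d ∈ Finset.Icc 1 G, ‖conj (c w) * (Real.log 4 / d : ℂ) *
        ∑ z ∈ Z, c z * ramanujanSum d (det z w)‖ ≤ 2 * G ^ 2 * E := by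
    intro w _ d hd
    have hd' := Finset.mem_Icc.1 hd
    have hd0 : (0 : ℝ) < d := by exact_mod_cast hd'.1
    have hdG : (d : ℝ) ≤ G := by exact_mod_cast hd'.2
    have h1 : ‖∑ z ∈ Z, c z * ramanujanSum d (det z w)‖ ≤ d ^ 2 * (E * d) := by
      refine norm_sum_mul_periodic_le hd'.1 (fun z => norm_ramanujanSum_le d _) ?_ (hE d hd)
      intro z z' hzz
      refine ramanujanSum_congr hd'.1 ?_
      obtain ⟨h1, h2⟩ := natCast_dvd_iff.1 hzz
      rw [Zsqrtd.re_sub] at h1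
      rw [Zsqrtd.im_sub] at h2
      have : det z w - det z' w = (z.re - z'.re) * w.im - w.re * (z.im - z'.im) := by
        simp only [det]
        ring
      rw [this]
      exact dvd_sub (Dvd.dvd.mul_right h1 _) (Dvd.dvd.mul_left h2 _)
    rw [norm_mul, norm_mul, RCLike.norm_conj, norm_div, Complex.norm_real, Complex.norm_natCast,
      Real.norm_of_nonneg l40]
    calc ‖c w‖ * (Real.log 4 / d) * ‖∑ z ∈ Z, c z * ramanujanSum d (det z w)‖
        ≤ 1 * (2 / d) * (d ^ 2 * (E * d)) := by
          gcongr
          exact hc w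
      _ = 2 * d ^ 2 * E := by field_simp
      _ ≤ 2 * G ^ 2 * E := by gcongr
  refine (norm_sum_le _ _).trans ?_
  have hw : ∀ w ∈ Z, ‖∑ d ∈ Finset.Icc 1 G, conj (c w) * (Real.log 4 / d : ℂ) *
        ∑ z ∈ Z, c z * ramanujanSum d (det z w)‖ ≤ G * (2 * G ^ 2 * E) := by
    intro w hw
    refine (norm_sum_le _ _).trans ((Finset.sum_le_sum (hterm w hw)).trans (le_of_eq ?_))
    rw [Finset.sum_const, Nat.card_Icc, nsmul_eq_mul, Nat.add_sub_cancel]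
  refine (Finset.sum_le_sum hw).trans ?_
  rw [Finset.sum_const, nsmul_eq_mul]
  calc (Z.card : ℝ) * (G * (2 * G ^ 2 * E)) ≤ 9 * N ^ 2 * (G * (2 * G ^ 2 * E)) := by gcongr
    _ = _ := by ring

/-- For small `d` the archimedean weight may be replaced by the constant `log 4`, since pairs with
a small determinant are rare. -/
theorem norm_sum_small_sub_le {N P R G Y : ℕ} (hN : 0 < N) (hP : 0 < P) (hY : 0 < Y)
    (hRP : 2 * N ^ 2 ≤ R * P) {Z : Finset GaussianInt} (hZ : InBox N Z)
    (hZ0 : ∀ z ∈ Z, z.im ≠ 0) {c : GaussianInt → ℂ} (hc : ∀ z, ‖c z‖ ≤ 1) :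
    ‖∑ z ∈ Z, ∑ w ∈ Z, c z * conj (c w) * ∑ d ∈ Finset.Icc 1 G,
        ramanujanSum d (det z w) / d * divisorWeight P R d (det z w)
      - ∑ z ∈ Z, ∑ w ∈ Z, c z * conj (c w) *
        ∑ d ∈ Finset.Icc 1 G, ramanujanSum d (det z w) / d * (Real.log 4 : ℂ)‖
      ≤ G * (27 * N ^ 2 * (4 * Y * (1 + Real.log N) + 3 * N) + 324 * G * P * N ^ 4 / Y) := by
  classical
  have hN1 : (1 : ℝ) ≤ N := by exact_mod_cast hN
  have hYr : (0 : ℝ) < Y := by exact_mod_cast hY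
  have hl : 0 ≤ Real.log N := Real.log_nonneg hN1
  have hZcard : (Z.card : ℝ) ≤ 9 * N ^ 2 := hZ.card_le.trans (by nlinarith)
  have l4 : Real.log 4 ≤ 2 := by
    rw [show (4 : ℝ) = 2 ^ 2 by norm_num, Real.log_pow]
    have := Real.log_two_lt_d9
    push_cast
    linarith
  have l40 : 0 ≤ Real.log 4 := Real.log_nonneg (by norm_num)
  have hpair : ∀ z ∈ Z, ∀ w ∈ Z, ‖c z * conj (c w) * ∑ d ∈ Finset.Icc 1 G,
        ramanujanSum d (det z w) / d * divisorWeight P R d (det z w)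
      - c z * conj (c w) *
        ∑ d ∈ Finset.Icc 1 G, ramanujanSum d (det z w) / d * (Real.log 4 : ℂ)‖
      ≤ G * (3 * (if |det z w - 0| ≤ Y then 1 else 0) + 4 * G * P / Y) := by
    intro z hz w hw
    rw [← mul_sub, ← Finset.sum_sub_distrib, norm_mul, norm_mul, RCLike.norm_conj]
    have hRPn : (det z w).natAbs ≤ R * P := by
      have := abs_det_le (hZ z hz) (hZ w hw)
      have e : ((R * P : ℕ) : ℤ) ≥ 2 * N ^ 2 := by exact_mod_cast hRP
      zify
      push_cast at e
      calc |det z w| ≤ 2 * N * N := this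
        _ = 2 * N ^ 2 := by ring
        _ ≤ _ := e
    have hd : ∀ d ∈ Finset.Icc 1 G, ‖ramanujanSum d (det z w) / d * divisorWeight P R d (det z w)
        - ramanujanSum d (det z w) / d * (Real.log 4 : ℂ)‖
        ≤ 3 * (if |det z w - 0| ≤ Y then 1 else 0) + 4 * G * P / Y := by
      intro d hd
      obtain ⟨hd1, hdG⟩ := Finset.mem_Icc.1 hd
      have hd0 : (0 : ℝ) < d := by exact_mod_cast hd1
      have hdG' : (d : ℝ) ≤ G := by exact_mod_cast hdG
      have e1 : ‖ramanujanSum d (det z w) / (d : ℂ)‖ ≤ 1 := by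
        rw [norm_div, Complex.norm_natCast, div_le_one hd0]
        exact norm_ramanujanSum_le _ _
      rw [← mul_sub, norm_mul, ← Complex.ofReal_sub, Complex.norm_real, Real.norm_eq_abs]
      refine (mul_le_of_le_one_left (abs_nonneg _) e1).trans ?_
      have hpos : (0 : ℝ) ≤ 4 * G * P / Y := by positivity
      split_ifs with hnear
      · have e2 := divisorWeight_nonneg P R d (det z w)
        have e3 := divisorWeight_le_three hP hd1 hRPn
        rw [abs_le]
        constructor <;> linarith
      · rw [sub_zero, not_le] at hnear
        have hne : det z w ≠ 0 := by
          intro h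
          rw [h, abs_zero] at hnear
          omega
        refine (abs_divisorWeight_sub_log_four_le hP hd1 hne hRPn).trans ?_
        have : (Y : ℝ) ≤ (det z w).natAbs := by
          have h1 : Y ≤ (det z w).natAbs := by
            zify
            exact hnear.le
          exact_mod_cast h1
        rw [mul_zero, zero_add]
        gcongr
    have hcc : ‖c z‖ * ‖c w‖ ≤ 1 := mul_le_one₀ (hc z) (norm_nonneg _) (hc w)
    refine (mul_le_of_le_one_left (norm_nonneg _) hcc).trans ?_
    refine (norm_sum_le _ _).trans ((Finset.sum_le_sum hd).trans (le_of_eq ?_))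
    rw [Finset.sum_const, Nat.card_Icc, nsmul_eq_mul, Nat.add_sub_cancel]
  rw [← Finset.sum_sub_distrib]
  simp only [← Finset.sum_sub_distrib]
  have h1 : ‖∑ z ∈ Z, ∑ w ∈ Z, (c z * conj (c w) * ∑ d ∈ Finset.Icc 1 G,
        ramanujanSum d (det z w) / d * divisorWeight P R d (det z w)
      - c z * conj (c w) *
        ∑ d ∈ Finset.Icc 1 G, ramanujanSum d (det z w) / d * (Real.log 4 : ℂ))‖
      ≤ ∑ z ∈ Z, ∑ w ∈ Z, G * (3 * (if |det z w - 0| ≤ Y then 1 else 0) + 4 * G * P / Y : ℝ) :=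
    (norm_sum_le _ _).trans (Finset.sum_le_sum fun z hz =>
      (norm_sum_le _ _).trans (Finset.sum_le_sum fun w hw => hpair z hz w hw))
  refine h1.trans ?_
  have hcount := sum_card_det_near_le hZ hZ hZ0 0 Y
  have e : ∑ z ∈ Z, ∑ w ∈ Z, G * (3 * (if |det z w - 0| ≤ Y then 1 else 0) + 4 * G * P / Y : ℝ)
      = G * (3 * ∑ w ∈ Z, ((Z.filter fun z => |det z w - 0| ≤ Y).card : ℝ)
        + Z.card ^ 2 * (4 * G * P / Y)) := by
    simp only [← Finset.mul_sum, Finset.sum_add_distrib, Finset.sum_const, nsmul_eq_mul]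
    rw [Finset.sum_comm]
    congr 2
    · congr 1
      refine Finset.sum_congr rfl fun w _ => ?_
      rw [Finset.card_filter]
      push_cast
      rfl
    · ring
  rw [e]
  refine mul_le_mul_of_nonneg_left ?_ (by positivity)
  have hc2 : ∑ w ∈ Z, ((Z.filter fun z => |det z w - 0| ≤ Y).card : ℝ)
      ≤ 9 * N ^ 2 * (4 * Y * (1 + Real.log N) + 3 * N) := by
    refine hcount.trans ?_
    calc (2 * (N : ℝ) + 1) * (2 * N + 1) * (4 * Y * (1 + Real.log N) + (2 * N + 1))
        ≤ (3 * N) * (3 * N) * (4 * Y * (1 + Real.log N) + 3 * N) := by gcongr <;> linarith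
      _ = _ := by ring
  have hc3 : (Z.card : ℝ) ^ 2 * (4 * G * P / Y) ≤ 324 * G * P * N ^ 4 / Y := by
    calc (Z.card : ℝ) ^ 2 * (4 * G * P / Y) ≤ (9 * (N : ℝ) ^ 2) ^ 2 * (4 * G * P / Y) := by gcongr
      _ = _ := by ring
  linarith

theorem sum_card_det_eq_zero_le {N : ℕ} (hN : 0 < N) {Z : Finset GaussianInt} (hZ : InBox N Z)
    (hZc : ∀ z ∈ Z, IsCoprime z.re z.im) :
    ∑ z ∈ Z, ∑ w ∈ Z, (if det z w = 0 then (1 : ℝ) else 0) ≤ 18 * N ^ 2 := by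
  have hN1 : (1 : ℝ) ≤ N := by exact_mod_cast hN
  have hZcard : (Z.card : ℝ) ≤ 9 * N ^ 2 := hZ.card_le.trans (by nlinarith)
  rw [Finset.sum_comm]
  have h : ∀ w ∈ Z, ∑ z ∈ Z, (if det z w = 0 then (1 : ℝ) else 0) ≤ 2 := by
    intro w hw
    rw [← Finset.sum_filter, Finset.sum_const, nsmul_eq_mul, mul_one]
    exact_mod_cast card_det_eq_zero_le hZc (hZc w hw)
  refine (Finset.sum_le_sum h).trans ?_
  rw [Finset.sum_const, nsmul_eq_mul]
  linarith

theorem sum_detCorr_eq (T : Finset ℕ) (Z : Finset GaussianInt) (c : GaussianInt → ℂ) :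
    ∑ q ∈ T, detCorr Z c q = ∑ z ∈ Z, ∑ w ∈ Z, c z * conj (c w) *
      ((T.filter fun q : ℕ => (q : ℤ) ∣ det z w).card : ℂ) := by
  classical
  unfold detCorr
  rw [Finset.sum_comm]
  refine Finset.sum_congr rfl fun z _ => ?_
  rw [Finset.sum_comm]
  refine Finset.sum_congr rfl fun w _ => ?_
  rw [Finset.card_filter]
  push_cast
  rw [Finset.mul_sum]
  refine Finset.sum_congr rfl fun q _ => ?_
  split_ifs <;> simp

open Classical in
/-- The determinant sums over the moduli in `(P, 4 P]`, in terms of a bound `E` for the sums of `c`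
over residue classes to moduli up to `G`. -/
theorem sum_classSum_Ioc_le {N P R G H Y : ℕ} (hN : 0 < N) (hP : 0 < P) (hG : 0 < G) (hGR : G ≤ R)
    (hRN : R ≤ 2 * N) (hH : 0 < H) (hHN : H ≤ N) (hY : 0 < Y) (hRP : 4 * N ^ 2 ≤ R * P)
    {Z : Finset GaussianInt} (hZ : InBox N Z) (hZc : ∀ z ∈ Z, IsCoprime z.re z.im)
    (hZ0 : ∀ z ∈ Z, z.im ≠ 0) {c : GaussianInt → ℂ} (hc : ∀ z, ‖c z‖ ≤ 1) {E : ℝ}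
    (hE : ∀ d ∈ Finset.Icc 1 G, ∀ α : GaussianInt,
      ‖∑ z ∈ Z with (d : GaussianInt) ∣ z - α, c z‖ ≤ E) :
    ∑ q ∈ Finset.Ioc P (4 * P), classSum Z c q ≤
      54 * P * N ^ 2 + 18 * N ^ 2 * G ^ 3 * E
        + G * (27 * N ^ 2 * (4 * Y * (1 + Real.log N) + 3 * N) + 324 * G * P * N ^ 4 / Y)
        + (16 * N ^ 4 * √(1296 / G + 729 * R ^ 4 / H)
          + 3960 * R ^ 2 * H * N ^ 3 * (1 + Real.log N)) := by
  have hnn : 0 ≤ ∑ q ∈ Finset.Ioc P (4 * P), classSum Z c q :=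
    Finset.sum_nonneg fun _ _ => classSum_nonneg _ _ _
  have e0 : ((∑ q ∈ Finset.Ioc P (4 * P), classSum Z c q : ℝ) : ℂ)
      = ∑ q ∈ Finset.Ioc P (4 * P), detCorr Z c q := by
    push_cast
    exact Finset.sum_congr rfl fun q _ => (detCorr_eq_classSum hZc c q).symm
  rw [← Real.norm_of_nonneg hnn, ← Complex.norm_real, e0, sum_detCorr_eq]
  -- separate the pairs with vanishing determinant and expand the others
  have e1 : ∀ z ∈ Z, ∀ w ∈ Z, c z * conj (c w) *
      (((Finset.Ioc P (4 * P)).filter fun q : ℕ => (q : ℤ) ∣ det z w).card : ℂ)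
      = c z * conj (c w) * (if det z w = 0 then ((3 * P : ℕ) : ℂ) else 0)
        + (c z * conj (c w) * ∑ d ∈ Finset.Icc 1 G,
            ramanujanSum d (det z w) / d * divisorWeight P R d (det z w)
          + c z * conj (c w) * ∑ d ∈ Finset.Ioc G R,
            ramanujanSum d (det z w) / d * divisorWeight P R d (det z w)) := by
    intro z hz w hw
    have hsplit : ∑ d ∈ Finset.Icc 1 G,
            ramanujanSum d (det z w) / d * divisorWeight P R d (det z w)
          + ∑ d ∈ Finset.Ioc G R, ramanujanSum d (det z w) / d * divisorWeight P R d (det z w)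
        = ∑ d ∈ Finset.Icc 1 R,
            ramanujanSum d (det z w) / d * divisorWeight P R d (det z w) := by
      have hu : Finset.Icc 1 R = Finset.Icc 1 G ∪ Finset.Ioc G R := by
        ext d
        simp only [Finset.mem_union, Finset.mem_Icc, Finset.mem_Ioc]
        omega
      rw [hu, Finset.sum_union]
      rw [Finset.disjoint_left]
      intro a ha hb
      rw [Finset.mem_Icc] at ha
      rw [Finset.mem_Ioc] at hb
      omega
    rw [← mul_add, hsplit, ← mul_add]
    congr 1
    by_cases h : det z w = 0
    · rw [h]
      simp only [divisorWeight_zero, if_true, dvd_zero, Finset.filter_true, Nat.card_Ioc]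
      rw [show 4 * P - P = 3 * P by omega]
      simp
    · rw [if_neg h, zero_add]
      refine card_dvd_Ioc_eq_sum_ramanujanSum h ?_
      have := abs_det_le (hZ z hz) (hZ w hw)
      have e : ((R * P : ℕ) : ℤ) ≥ 4 * N ^ 2 := by exact_mod_cast hRP
      zify
      push_cast at e
      nlinarith [sq_nonneg (N : ℤ)]
  rw [Finset.sum_congr rfl fun z hz => Finset.sum_congr rfl fun w hw => e1 z hz w hw]
  simp only [Finset.sum_add_distrib]
  have b0 : ‖∑ z ∈ Z, ∑ w ∈ Z, c z * conj (c w) *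
      (if det z w = 0 then ((3 * P : ℕ) : ℂ) else 0)‖ ≤ 54 * P * N ^ 2 := by
    have h1 : ∀ z ∈ Z, ∀ w ∈ Z, ‖c z * conj (c w) *
        (if det z w = 0 then ((3 * P : ℕ) : ℂ) else 0)‖
        ≤ 3 * P * (if det z w = 0 then (1 : ℝ) else 0) := by
      intro z _ w _
      rw [norm_mul, norm_mul, RCLike.norm_conj]
      have hcc : ‖c z‖ * ‖c w‖ ≤ 1 := mul_le_one₀ (hc z) (norm_nonneg _) (hc w)
      refine (mul_le_of_le_one_left (norm_nonneg _) hcc).trans (le_of_eq ?_)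
      split_ifs
      · rw [Complex.norm_natCast]
        push_cast
        ring
      · simp
    refine (norm_sum_le _ _).trans ((Finset.sum_le_sum fun z hz => (norm_sum_le _ _).trans
      (Finset.sum_le_sum fun w hw => h1 z hz w hw)).trans ?_)
    simp only [← Finset.mul_sum]
    calc 3 * (P : ℝ) * ∑ z ∈ Z, ∑ w ∈ Z, (if det z w = 0 then (1 : ℝ) else 0)
        ≤ 3 * P * (18 * N ^ 2) := by
          gcongr
          exact sum_card_det_eq_zero_le hN hZ hZc
      _ = _ := by ring
  have b1 := norm_sum_small_sub_le (G := G) hN hP hY (by nlinarith : 2 * N ^ 2 ≤ R * P) hZ hZ0 hc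
  have b2 := norm_sum_ramanujan_le hN hZ hc hE
  have b3 := norm_sum_large_le hN hP hG hRN hH hHN hRP hZ hZc hZ0 hc
  have b12 := norm_le_norm_add_norm_sub
    (∑ z ∈ Z, ∑ w ∈ Z, c z * conj (c w) *
        ∑ d ∈ Finset.Icc 1 G, ramanujanSum d (det z w) / d * (Real.log 4 : ℂ))
    (∑ z ∈ Z, ∑ w ∈ Z, c z * conj (c w) * ∑ d ∈ Finset.Icc 1 G,
        ramanujanSum d (det z w) / d * divisorWeight P R d (det z w))
  rw [norm_sub_rev] at b12
  refine (norm_add_le _ _).trans ?_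
  have b4 := norm_add_le
    (∑ z ∈ Z, ∑ w ∈ Z, c z * conj (c w) * ∑ d ∈ Finset.Icc 1 G,
        ramanujanSum d (det z w) / d * divisorWeight P R d (det z w))
    (∑ z ∈ Z, ∑ w ∈ Z, c z * conj (c w) * ∑ d ∈ Finset.Ioc G R,
        ramanujanSum d (det z w) / d * divisorWeight P R d (det z w))
  linarith

/-! ### The bound without cancellation -/

/-- The bound for the determinant sums that uses only `‖c‖ ≤ 1`. -/
theorem sum_classSum_le_trivial {N M : ℕ} (hN : 0 < N) {Z : Finset GaussianInt} (hZ : InBox N Z)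
    (hZc : ∀ z ∈ Z, IsCoprime z.re z.im) {c : GaussianInt → ℂ} (hc : ∀ z, ‖c z‖ ≤ 1) :
    ∑ q ∈ Finset.Icc 1 M, classSum Z c q
      ≤ 18 * M * N ^ 2 + 288 * N ^ 4 * (1 + Real.log (2 * N)) := by
  classical
  have hN1 : (1 : ℝ) ≤ N := by exact_mod_cast hN
  have hZcard : (Z.card : ℝ) ≤ 9 * N ^ 2 := hZ.card_le.trans (by nlinarith)
  have hnn : 0 ≤ ∑ q ∈ Finset.Icc 1 M, classSum Z c q :=
    Finset.sum_nonneg fun _ _ => classSum_nonneg _ _ _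
  have e0 : ((∑ q ∈ Finset.Icc 1 M, classSum Z c q : ℝ) : ℂ)
      = ∑ q ∈ Finset.Icc 1 M, detCorr Z c q := by
    push_cast
    exact Finset.sum_congr rfl fun q _ => (detCorr_eq_classSum hZc c q).symm
  rw [← Real.norm_of_nonneg hnn, ← Complex.norm_real, e0, sum_detCorr_eq]
  -- a divisor or its complement is at most `2 N`, as the determinant is at most `2 N ^ 2`
  have hdiv : ∀ z ∈ Z, ∀ w ∈ Z,
      (((Finset.Icc 1 M).filter fun q : ℕ => (q : ℤ) ∣ det z w).card : ℝ)
      ≤ M * (if det z w = 0 then (1 : ℝ) else 0)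
        + 2 * ∑ d ∈ Finset.Icc 1 (2 * N), if (d : ℤ) ∣ det z w then (1 : ℝ) else 0 := by
    intro z hz w hw
    have hs0 : (0 : ℝ) ≤ ∑ d ∈ Finset.Icc 1 (2 * N), if (d : ℤ) ∣ det z w then (1 : ℝ) else 0 :=
      Finset.sum_nonneg fun _ _ => by positivity
    split_ifs with h
    · have : (((Finset.Icc 1 M).filter fun q : ℕ => (q : ℤ) ∣ det z w).card : ℝ) ≤ M := by
        have := Finset.card_filter_le (Finset.Icc 1 M) fun q : ℕ => (q : ℤ) ∣ det z w
        rw [Nat.card_Icc, Nat.add_sub_cancel] at this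
        exact_mod_cast this
      linarith
    · rw [mul_zero, zero_add, ← Finset.sum_filter, Finset.sum_const, nsmul_eq_mul, mul_one]
      set D := (Finset.Icc 1 (2 * N)).filter fun d : ℕ => (d : ℤ) ∣ det z w with hD
      have hn0 : 0 < (det z w).natAbs := Int.natAbs_pos.2 h
      have hn : (det z w).natAbs ≤ 2 * N ^ 2 := by
        have := abs_det_le (hZ z hz) (hZ w hw)
        zify
        calc |det z w| ≤ 2 * N * N := this
          _ = 2 * N ^ 2 := by ring
      have hsub : ((Finset.Icc 1 M).filter fun q : ℕ => (q : ℤ) ∣ det z w)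
          ⊆ D ∪ D.image fun d => (det z w).natAbs / d := by
        intro q hq
        simp only [Finset.mem_filter, Finset.mem_Icc, Int.natCast_dvd] at hq
        obtain ⟨⟨hq1, -⟩, k, hk⟩ := hq
        have hk0 : 0 < k := by
          rcases Nat.eq_zero_or_pos k with rfl | h
          · omega
          · exact h
        rw [Finset.mem_union, Finset.mem_image]
        rcases le_total q (2 * N) with h1 | h1
        · left
          rw [hD, Finset.mem_filter, Finset.mem_Icc, Int.natCast_dvd]
          exact ⟨⟨hq1, h1⟩, k, hk⟩
        · right
          refine ⟨k, ?_, ?_⟩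
          · rw [hD, Finset.mem_filter, Finset.mem_Icc, Int.natCast_dvd]
            refine ⟨⟨hk0, ?_⟩, hk ▸ dvd_mul_left _ _⟩
            rw [hk] at hn
            by_contra hlt
            rw [not_le] at hlt
            nlinarith
          · rw [hk, Nat.mul_div_cancel _ hk0]
      have h1 := (Finset.card_le_card hsub).trans (Finset.card_union_le _ _)
      have h2 : (D.image fun d => (det z w).natAbs / d).card ≤ D.card := Finset.card_image_le
      have h3 : ((Finset.Icc 1 M).filter fun q : ℕ => (q : ℤ) ∣ det z w).card ≤ 2 * D.card := by
        omega
      exact_mod_cast h3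
  have hmain : ‖∑ z ∈ Z, ∑ w ∈ Z, c z * conj (c w) *
      (((Finset.Icc 1 M).filter fun q : ℕ => (q : ℤ) ∣ det z w).card : ℂ)‖
      ≤ ∑ z ∈ Z, ∑ w ∈ Z, (M * (if det z w = 0 then (1 : ℝ) else 0)
        + 2 * ∑ d ∈ Finset.Icc 1 (2 * N), if (d : ℤ) ∣ det z w then (1 : ℝ) else 0) := by
    refine (norm_sum_le _ _).trans (Finset.sum_le_sum fun z hz => (norm_sum_le _ _).trans
      (Finset.sum_le_sum fun w hw => ?_))
    rw [norm_mul, norm_mul, RCLike.norm_conj, Complex.norm_natCast]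
    have hcc : ‖c z‖ * ‖c w‖ ≤ 1 := mul_le_one₀ (hc z) (norm_nonneg _) (hc w)
    exact (mul_le_of_le_one_left (Nat.cast_nonneg _) hcc).trans (hdiv z hz w hw)
  refine hmain.trans ?_
  simp only [Finset.sum_add_distrib, ← Finset.mul_sum]
  have h1 := sum_card_det_eq_zero_le hN hZ hZc
  have h2 : ∑ z ∈ Z, ∑ w ∈ Z, ∑ d ∈ Finset.Icc 1 (2 * N),
      (if (d : ℤ) ∣ det z w then (1 : ℝ) else 0)
      ≤ 144 * N ^ 4 * (1 + Real.log (2 * N)) := by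
    have hsw : ∑ z ∈ Z, ∑ w ∈ Z, ∑ d ∈ Finset.Icc 1 (2 * N),
        (if (d : ℤ) ∣ det z w then (1 : ℝ) else 0)
        = ∑ d ∈ Finset.Icc 1 (2 * N), ∑ w ∈ Z, ∑ z ∈ Z,
          (if (d : ℤ) ∣ det z w then (1 : ℝ) else 0) := by
      rw [Finset.sum_comm]
      rw [Finset.sum_congr rfl fun w _ => Finset.sum_comm, Finset.sum_comm]
    rw [hsw]
    have hd : ∀ d ∈ Finset.Icc 1 (2 * N), ∑ w ∈ Z, ∑ z ∈ Z,
        (if (d : ℤ) ∣ det z w then (1 : ℝ) else 0) ≤ 144 * N ^ 4 * (1 / d) := by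
      intro d hd
      obtain ⟨hd1, hd2⟩ := Finset.mem_Icc.1 hd
      have hw : ∀ w ∈ Z, ∑ z ∈ Z, (if (d : ℤ) ∣ det z w then (1 : ℝ) else 0)
          ≤ 16 * N ^ 2 / d := by
        intro w hw
        rw [← Finset.sum_filter, Finset.sum_const, nsmul_eq_mul, mul_one]
        exact card_dvd_det_le hd1 hd2 hZ (hZc w hw)
      refine (Finset.sum_le_sum hw).trans ?_
      rw [Finset.sum_const, nsmul_eq_mul]
      calc (Z.card : ℝ) * (16 * N ^ 2 / d) ≤ 9 * N ^ 2 * (16 * N ^ 2 / d) := by gcongr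
        _ = _ := by ring
    refine (Finset.sum_le_sum hd).trans ?_
    rw [← Finset.mul_sum]
    refine mul_le_mul_of_nonneg_left ?_ (by positivity)
    have := harmonic_le_one_add_log (2 * N)
    rw [harmonic_eq_sum_Icc] at this
    push_cast at this
    simp only [one_div]
    exact this
  have h3 : (M : ℝ) * ∑ z ∈ Z, ∑ w ∈ Z, (if det z w = 0 then (1 : ℝ) else 0)
      ≤ M * (18 * N ^ 2) := by gcongr
  linarith

/-! ### Choice of the parameters -/

theorem exists_forall_log_pow_le_sqrt (m : ℕ) (B : ℝ) :
    ∃ X₀ : ℝ, 2 ≤ X₀ ∧ ∀ X : ℝ, X₀ ≤ X → B ≤ Real.log X ∧ Real.log X ^ m ≤ √X := by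
  have h1 : ∀ᶠ X : ℝ in Filter.atTop, B ≤ Real.log X :=
    Real.tendsto_log_atTop.eventually_ge_atTop B
  have h2 := (Real.isLittleO_pow_log_id_atTop (n := 2 * m)).bound one_pos
  obtain ⟨X₀, hX₀⟩ := Filter.eventually_atTop.1
    ((h1.and h2).and (Filter.eventually_ge_atTop (2 : ℝ)))
  refine ⟨max X₀ 2, le_max_right _ _, fun X hX => ?_⟩
  obtain ⟨⟨hB, hl⟩, hX2⟩ := hX₀ X (le_trans (le_max_left _ _) hX)
  refine ⟨hB, ?_⟩
  have hl0 : 0 ≤ Real.log X := Real.log_nonneg (by linarith)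
  rw [id, one_mul, Real.norm_of_nonneg (by positivity), Real.norm_of_nonneg (by linarith)] at hl
  refine Real.le_sqrt_of_sq_le ?_
  rw [← pow_mul, mul_comm]
  exact hl

/-- The size of the support: `N = ⌊√X⌋` satisfies `N ^ 2 ≤ X ≤ 4 N ^ 2`. -/
theorem floor_sqrt_bounds {X : ℝ} (hX : 1 ≤ X) :
    0 < ⌊√X⌋₊ ∧ (⌊√X⌋₊ : ℝ) ≤ √X ∧ √X ≤ 2 * (⌊√X⌋₊ : ℝ) := by
  have h1 : 1 ≤ √X := Real.one_le_sqrt.2 hX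
  have h2 : 0 < ⌊√X⌋₊ := Nat.floor_pos.2 h1
  have h3 : (1 : ℝ) ≤ ⌊√X⌋₊ := by exact_mod_cast h2
  exact ⟨h2, Nat.floor_le (by positivity), by linarith [Nat.lt_floor_add_one (√X)]⟩

theorem half_le_floor {x : ℝ} (hx : 1 ≤ x) : x / 2 ≤ ⌊x⌋₊ := by
  have h2 : 0 < ⌊x⌋₊ := Nat.floor_pos.2 hx
  have h3 : (1 : ℝ) ≤ ⌊x⌋₊ := by exact_mod_cast h2
  linarith [Nat.lt_floor_add_one x]

open Classical in
/-- The determinant sums over the moduli in `(P, 4 P]` with `P = X / L ^ D`, `L = log X`, are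
smaller than the trivial bound by any given power of `L`. The exponent `b = 2 a + 4` is that of the
size of the small complementary divisors, `y = b + a + 3` that of the size `X / L ^ y` of small
determinants, and `D = 2 b + y + a + 2 = 8 a + 19`. -/
theorem sum_classSum_Ioc_le_log_pow {a m : ℕ} {X K₀ : ℝ} (hK₀ : 0 ≤ K₀)
    (hm : m = 6 * (8 * a + 17) + (2 * a + 4) + 1 + (a + 2)) (hX : 1 ≤ X)
    (hL : 9 ≤ Real.log X) (hLm : Real.log X ^ m ≤ √X) {Z : Finset GaussianInt}
    (hZ : InBox ⌊√X⌋₊ Z) (hZc : ∀ z ∈ Z, IsCoprime z.re z.im)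
    (hZ0 : ∀ z ∈ Z, z.im ≠ 0) {c : GaussianInt → ℂ} (hc : ∀ z, ‖c z‖ ≤ 1)
    (hSW : ∀ d : ℕ, 1 ≤ d → ∀ α : GaussianInt, ‖∑ z ∈ Z with (d : GaussianInt) ∣ z - α, c z‖
      ≤ K₀ * (d ^ 2 * X / Real.log X ^ (5 * (2 * a + 4) + (a + 2)))) :
    ∑ q ∈ Finset.Ioc ⌊X / Real.log X ^ (8 * a + 17)⌋₊ (4 * ⌊X / Real.log X ^ (8 * a + 17)⌋₊),
      classSum Z c q ≤ (18 * K₀ + 1400000) * (X ^ 2 / Real.log X ^ (a + 2)) := by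
  obtain ⟨hN, hNX, hXN⟩ := floor_sqrt_bounds hX
  set N := ⌊√X⌋₊ with hNdef
  set L := Real.log X with hLdef
  set b := 2 * a + 4 with hb
  set D := 8 * a + 17 with hD
  set y := b + a + 3 with hy
  have hDy : D = 2 * b + y + (a + 2) := by omega
  have hL1 : 1 ≤ L := by linarith
  have hL0 : 0 < L := by linarith
  have hX0 : 0 < X := by linarith
  have hs0 : 0 < √X := Real.sqrt_pos.2 hX0
  have hsq : √X * √X = X := Real.mul_self_sqrt hX0.le
  have hs1 : 1 ≤ √X := Real.one_le_sqrt.2 hX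
  have hmono : ∀ {i j : ℕ}, i ≤ j → L ^ i ≤ L ^ j := fun h => pow_le_pow_right₀ hL1 h
  have hsX : √X ≤ X := by nlinarith
  have hpowX : ∀ {i : ℕ}, i ≤ m → L ^ i ≤ √X := fun h => (hmono h).trans hLm
  -- `√X` is small compared with `X`
  have hsmall : ∀ {i : ℕ}, i ≤ m → √X ≤ X / L ^ i := by
    intro i hi
    rw [le_div_iff₀ (by positivity)]
    calc √X * L ^ i ≤ √X * √X := by gcongr; exact hpowX hi
      _ = X := hsq
  have hNr : (0 : ℝ) < N := by exact_mod_cast hN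
  have hN1 : (1 : ℝ) ≤ N := by exact_mod_cast hN
  have hN2 : (N : ℝ) ^ 2 ≤ X := by
    calc (N : ℝ) ^ 2 ≤ √X ^ 2 := by gcongr
      _ = X := Real.sq_sqrt hX0.le
  have hN3 : (N : ℝ) ^ 3 ≤ X * √X := by
    calc (N : ℝ) ^ 3 = N ^ 2 * N := by ring
      _ ≤ X * √X := by gcongr
  have hN4 : (N : ℝ) ^ 4 ≤ X ^ 2 := by
    calc (N : ℝ) ^ 4 = (N ^ 2) ^ 2 := by ring
      _ ≤ X ^ 2 := by gcongr
  have hlogN : 1 + Real.log N ≤ 2 * L := by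
    have : Real.log N ≤ L := Real.log_le_log hNr (hNX.trans hsX)
    linarith
  -- the parameters
  have hPX : 1 ≤ X / L ^ D := hs1.trans (hsmall (by omega))
  have hYX : 1 ≤ X / L ^ y := hs1.trans (hsmall (by omega))
  have hGL : 1 ≤ L ^ b := one_le_pow₀ hL1
  set P := ⌊X / L ^ D⌋₊ with hP
  set Y := ⌊X / L ^ y⌋₊ with hY
  set G := ⌊L ^ b⌋₊ with hG
  set R := ⌈8 * L ^ D⌉₊ with hR
  set H := ⌈L ^ (4 * D + b)⌉₊ with hH
  have hP0 : 0 < P := Nat.floor_pos.2 hPX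
  have hY0 : 0 < Y := Nat.floor_pos.2 hYX
  have hG0 : 0 < G := Nat.floor_pos.2 hGL
  have hP1 : (P : ℝ) ≤ X / L ^ D := Nat.floor_le (by positivity)
  have hP2 : X / L ^ D / 2 ≤ P := half_le_floor hPX
  have hY1 : (Y : ℝ) ≤ X / L ^ y := Nat.floor_le (by positivity)
  have hY2 : X / L ^ y / 2 ≤ Y := half_le_floor hYX
  have hG1 : (G : ℝ) ≤ L ^ b := Nat.floor_le (by positivity)
  have hG2 : L ^ b / 2 ≤ G := half_le_floor hGL
  have hLD : 1 ≤ L ^ D := one_le_pow₀ hL1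
  have hR1 : 8 * L ^ D ≤ R := Nat.le_ceil _
  have hR2 : (R : ℝ) ≤ 9 * L ^ D := by
    have := Nat.ceil_lt_add_one (a := 8 * L ^ D) (by positivity)
    linarith
  have hLH : 1 ≤ L ^ (4 * D + b) := one_le_pow₀ hL1
  have hH1 : L ^ (4 * D + b) ≤ H := Nat.le_ceil _
  have hH2 : (H : ℝ) ≤ 2 * L ^ (4 * D + b) := by
    have := Nat.ceil_lt_add_one (a := L ^ (4 * D + b)) (by positivity)
    linarith
  have hH0 : 0 < H := Nat.ceil_pos.2 (by positivity)
  have hGR : G ≤ R := by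
    have : (G : ℝ) ≤ R := by
      have : L ^ b ≤ L ^ D := hmono (by omega)
      linarith
    exact_mod_cast this
  have hRN : R ≤ 2 * N := by
    have : (R : ℝ) ≤ 2 * N := by
      calc (R : ℝ) ≤ 9 * L ^ D := hR2
        _ ≤ L * L ^ D := by gcongr
        _ = L ^ (D + 1) := by ring
        _ ≤ √X := hpowX (by omega)
        _ ≤ 2 * N := hXN
    exact_mod_cast this
  have hHN : H ≤ N := by
    have : 2 * (H : ℝ) ≤ 2 * N := by
      calc 2 * (H : ℝ) ≤ 4 * L ^ (4 * D + b) := by linarith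
        _ ≤ L * L ^ (4 * D + b) := by gcongr; linarith
        _ = L ^ (4 * D + b + 1) := by ring
        _ ≤ √X := hpowX (by omega)
        _ ≤ 2 * N := hXN
    have : (H : ℝ) ≤ N := by linarith
    exact_mod_cast this
  have hRP : 4 * N ^ 2 ≤ R * P := by
    have : 4 * (N : ℝ) ^ 2 ≤ R * P := by
      calc 4 * (N : ℝ) ^ 2 ≤ 4 * X := by gcongr
        _ = (8 * L ^ D) * (X / L ^ D / 2) := by field_simp; norm_num
        _ ≤ R * P := by gcongr
    exact_mod_cast this
  have hYr : (0 : ℝ) < Y := by exact_mod_cast hY0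
  have hGr : (0 : ℝ) < G := by exact_mod_cast hG0
  have hHr : (0 : ℝ) < H := by exact_mod_cast hH0
  set V := X ^ 2 / L ^ (a + 2) with hV
  have hE : ∀ d ∈ Finset.Icc 1 G, ∀ α : GaussianInt,
      ‖∑ z ∈ Z with (d : GaussianInt) ∣ z - α, c z‖
        ≤ K₀ * (L ^ (2 * b) * X / L ^ (5 * b + (a + 2))) := by
    intro d hd α
    rw [Finset.mem_Icc] at hd
    refine (hSW d hd.1 α).trans ?_
    have hdG : (d : ℝ) ≤ L ^ b := by
      have : (d : ℝ) ≤ G := by exact_mod_cast hd.2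
      exact this.trans hG1
    have : (d : ℝ) ^ 2 ≤ L ^ (2 * b) := by
      calc (d : ℝ) ^ 2 ≤ (L ^ b) ^ 2 := by gcongr
        _ = L ^ (2 * b) := by ring
    gcongr
  have main := sum_classSum_Ioc_le hN hP0 hG0 hGR hRN hH0 hHN hY0 hRP hZ hZc hZ0 hc hE
  have t1 : 54 * (P : ℝ) * N ^ 2 ≤ 54 * V := by
    have : X / L ^ D ≤ X / L ^ (a + 2) :=
      div_le_div_of_nonneg_left hX0.le (by positivity) (hmono (by omega))
    calc 54 * (P : ℝ) * N ^ 2 ≤ 54 * (X / L ^ (a + 2)) * X := by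
          gcongr
          exact hP1.trans this
      _ = 54 * V := by rw [hV]; ring
  have t2 : 18 * (N : ℝ) ^ 2 * G ^ 3 * (K₀ * (L ^ (2 * b) * X / L ^ (5 * b + (a + 2))))
      ≤ 18 * K₀ * V := by
    calc _ ≤ 18 * X * (L ^ b) ^ 3 * (K₀ * (L ^ (2 * b) * X / L ^ (5 * b + (a + 2)))) := by gcongr
      _ = 18 * K₀ * V := by
          rw [hV, pow_add L (5 * b), show 5 * b = b * 3 + 2 * b by ring, pow_add L (b * 3),
            ← pow_mul]
          field_simp
  have t3 : (G : ℝ) * (27 * N ^ 2 * (4 * Y * (1 + Real.log N))) ≤ 216 * V := by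
    calc _ ≤ L ^ b * (27 * X * (4 * (X / L ^ y) * (2 * L))) := by gcongr
      _ = 216 * V := by
          rw [hV, show y = b + 1 + (a + 2) by omega, pow_add L (b + 1), pow_succ L b]
          field_simp
          norm_num
  have t3' : (G : ℝ) * (27 * N ^ 2 * (3 * N)) ≤ 81 * V := by
    calc (G : ℝ) * (27 * N ^ 2 * (3 * N)) = 81 * (G * N ^ 3) := by ring
      _ ≤ 81 * (L ^ b * (X * √X)) := by gcongr
      _ ≤ 81 * (L ^ b * (X * (X / L ^ (b + (a + 2))))) := by
          gcongr
          exact hsmall (by omega)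
      _ = 81 * V := by
          rw [hV, pow_add L b]
          field_simp
  have t4 : (G : ℝ) * (324 * G * P * N ^ 4 / Y) ≤ 648 * V := by
    calc (G : ℝ) * (324 * G * P * N ^ 4 / Y)
        ≤ L ^ b * (324 * L ^ b * (X / L ^ D) * X ^ 2 / (X / L ^ y / 2)) := by gcongr
      _ = 648 * V := by
          rw [hV, hDy, pow_add L (2 * b + y), pow_add L (2 * b), mul_comm 2 b, pow_mul]
          field_simp
          norm_num
  have t5 : 16 * (N : ℝ) ^ 4 * √(1296 / G + 729 * R ^ 4 / H) ≤ 35008 * V := by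
    have h1 : 1296 / (G : ℝ) + 729 * R ^ 4 / H ≤ (2188 / L ^ (a + 2)) ^ 2 := by
      calc 1296 / (G : ℝ) + 729 * R ^ 4 / H
          ≤ 1296 / (L ^ b / 2) + 729 * (9 * L ^ D) ^ 4 / L ^ (4 * D + b) := by gcongr
        _ = 4785561 / L ^ b := by
            rw [pow_add L (4 * D), mul_pow, ← pow_mul L D, mul_comm D 4]
            field_simp
            norm_num
        _ ≤ 2188 ^ 2 / L ^ b := by gcongr; norm_num
        _ = _ := by
            rw [div_pow, ← pow_mul, hb, show (a + 2) * 2 = 2 * a + 4 by ring]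
    have h2 : √(1296 / (G : ℝ) + 729 * R ^ 4 / H) ≤ 2188 / L ^ (a + 2) :=
      Real.sqrt_le_iff.2 ⟨by positivity, h1⟩
    calc _ ≤ 16 * X ^ 2 * (2188 / L ^ (a + 2)) := by gcongr
      _ = _ := by rw [hV]; ring
  have t6 : 3960 * (R : ℝ) ^ 2 * H * N ^ 3 * (1 + Real.log N) ≤ 1283040 * V := by
    calc _ ≤ 3960 * (9 * L ^ D) ^ 2 * (2 * L ^ (4 * D + b)) * (X * √X) * (2 * L) := by gcongr
      _ = 1283040 * (L ^ (6 * D + b + 1) * (X * √X)) := by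
          rw [show 6 * D + b + 1 = D * 2 + (4 * D + b) + 1 by ring,
            pow_succ L (D * 2 + (4 * D + b)), pow_add L (D * 2), pow_mul L D 2]
          ring
      _ ≤ 1283040 * (L ^ (6 * D + b + 1) * (X * (X / L ^ m))) := by
          gcongr
          exact hsmall le_rfl
      _ = 1283040 * V := by
          rw [hV, hm, pow_add L (6 * D + b + 1)]
          field_simp
  have hsplit : (G : ℝ) * (27 * N ^ 2 * (4 * Y * (1 + Real.log N) + 3 * N)
        + 324 * G * P * N ^ 4 / Y)
      = G * (27 * N ^ 2 * (4 * Y * (1 + Real.log N))) + G * (27 * N ^ 2 * (3 * N))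
        + G * (324 * G * P * N ^ 4 / Y) := by ring
  have hV0 : 0 ≤ V := by positivity
  rw [hsplit] at main
  linarith

open Classical in
/-- The odd primitive vectors of the disc. -/
noncomputable def oddPrimitiveDisc (X : ℝ) : Finset GaussianInt :=
  (gaussianDisc X).filter IsOddPrimitive

theorem mem_oddPrimitiveDisc {X : ℝ} {z : GaussianInt} :
    z ∈ oddPrimitiveDisc X ↔ z ∈ gaussianDisc X ∧ IsOddPrimitive z := by
  simp [oddPrimitiveDisc]

theorem inBox_oddPrimitiveDisc (X : ℝ) : InBox ⌊√X⌋₊ (oddPrimitiveDisc X) := by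
  intro z hz
  have h := mem_gaussianDisc.1 (mem_oddPrimitiveDisc.1 hz).1
  have hn : ‖(z : ℂ)‖ ≤ √X := Real.le_sqrt_of_sq_le h
  have aux : ∀ u : ℤ, |(u : ℝ)| ≤ ‖(z : ℂ)‖ → |u| ≤ (⌊√X⌋₊ : ℤ) := by
    intro u hu
    have h1 : ((u.natAbs : ℕ) : ℝ) ≤ √X := by
      rw [Nat.cast_natAbs, Int.cast_abs]
      exact hu.trans hn
    have h2 := Nat.le_floor h1
    rw [Int.abs_eq_natAbs]
    exact_mod_cast h2
  constructor
  · refine aux _ ?_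
    have := Complex.abs_re_le_norm (z : ℂ)
    rwa [← GaussianInt.intCast_re] at this
  · refine aux _ ?_
    have := Complex.abs_im_le_norm (z : ℂ)
    rwa [← GaussianInt.intCast_im] at this

theorem detSum_eq_detCorr {X : ℝ} {c : GaussianInt → ℂ}
    (hc : ∀ z, c z ≠ 0 → IsOddPrimitive z) (q : ℕ) :
    detSum c X q = detCorr (oddPrimitiveDisc X) c q := by
  classical
  unfold detSum detCorr oddPrimitiveDisc
  rw [Finset.sum_filter]
  refine Finset.sum_congr rfl fun z _ => ?_
  have hiff : ∀ w : GaussianInt, z.re * w.im ≡ w.re * z.im [ZMOD (q : ℤ)] ↔ (q : ℤ) ∣ det z w := by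
    intro w
    rw [Int.modEq_comm, Int.modEq_iff_dvd, det]
  split_ifs with hz
  · rw [Finset.sum_filter]
    refine Finset.sum_congr rfl fun w _ => ?_
    by_cases hw : IsOddPrimitive w
    · simp only [hw, if_true, hiff]
    · have : c w = 0 := by
        by_contra h
        exact hw (hc w h)
      simp [hw, this]
  · have : c z = 0 := by
      by_contra h
      exact hz (hc z h)
    simp [this]

open Classical in
theorem sum_residue_eq_twistedSum {X : ℝ} {c : GaussianInt → ℂ}
    (hc : ∀ z, c z ≠ 0 → IsOddPrimitive z) (d : ℕ) (α : GaussianInt) :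
    ∑ z ∈ oddPrimitiveDisc X with (d : GaussianInt) ∣ z - α, c z = twistedSum c X 0 d α 0 := by
  unfold twistedSum oddPrimitiveDisc
  rw [Finset.filter_filter, Finset.sum_filter, Finset.sum_filter]
  refine Finset.sum_congr rfl fun z _ => ?_
  by_cases hz : IsOddPrimitive z
  · simp [hz]
  · have : c z = 0 := by
      by_contra h
      exact hz (hc z h)
    simp [this]

theorem norm_totalDetSum_le {X Q : ℝ} {c : GaussianInt → ℂ}
    (hc : ∀ z, c z ≠ 0 → IsOddPrimitive z) :
    ‖totalDetSum c Q X‖ ≤ ∑ q ∈ Finset.Icc 1 ⌊Q⌋₊, classSum (oddPrimitiveDisc X) c q := by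
  have hZc : ∀ z ∈ oddPrimitiveDisc X, IsCoprime z.re z.im := fun z hz =>
    (mem_oddPrimitiveDisc.1 hz).2.2.1
  have e : totalDetSum c Q X
      = ((∑ q ∈ Finset.Icc 1 ⌊Q⌋₊, classSum (oddPrimitiveDisc X) c q : ℝ) : ℂ) := by
    unfold totalDetSum
    push_cast
    exact Finset.sum_congr rfl fun q _ => by
      rw [detSum_eq_detCorr hc, detCorr_eq_classSum hZc]
  rw [e, Complex.norm_real, Real.norm_of_nonneg]
  exact Finset.sum_nonneg fun _ _ => classSum_nonneg _ _ _

theorem norm_totalDetSum_le_trivial {X Q : ℝ} (hX : 1 ≤ X) (hQ : 0 ≤ Q) {c : GaussianInt → ℂ}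
    (hc : ∀ z, c z ≠ 0 → IsOddPrimitive z) (hc1 : ∀ z, ‖c z‖ ≤ 1) :
    ‖totalDetSum c Q X‖ ≤ 18 * Q * X + 288 * X ^ 2 * (2 + Real.log X) := by
  obtain ⟨hN, hNX, -⟩ := floor_sqrt_bounds hX
  have hX0 : 0 < X := by linarith
  have hsq : √X * √X = X := Real.mul_self_sqrt hX0.le
  have hs1 : 1 ≤ √X := Real.one_le_sqrt.2 hX
  have hN1 : (1 : ℝ) ≤ ⌊√X⌋₊ := by exact_mod_cast hN
  refine (norm_totalDetSum_le hc).trans ((sum_classSum_le_trivial hN (inBox_oddPrimitiveDisc X)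
    (fun z hz => (mem_oddPrimitiveDisc.1 hz).2.2.1) hc1).trans ?_)
  have hN2 : (⌊√X⌋₊ : ℝ) ^ 2 ≤ X := by
    calc (⌊√X⌋₊ : ℝ) ^ 2 ≤ √X ^ 2 := by gcongr
      _ = X := Real.sq_sqrt hX0.le
  have hN4 : (⌊√X⌋₊ : ℝ) ^ 4 ≤ X ^ 2 := by
    calc (⌊√X⌋₊ : ℝ) ^ 4 = (⌊√X⌋₊ ^ 2) ^ 2 := by ring
      _ ≤ X ^ 2 := by gcongr
  have hlog : 1 + Real.log (2 * ⌊√X⌋₊) ≤ 2 + Real.log X := by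
    rw [Real.log_mul (by norm_num) (by linarith)]
    have h1 : Real.log ⌊√X⌋₊ ≤ Real.log X := Real.log_le_log (by linarith) (by nlinarith)
    have h2 := Real.log_two_lt_d9
    linarith
  have hl0 : 0 ≤ Real.log X := Real.log_nonneg hX
  have hl1 : 0 ≤ Real.log (2 * ⌊√X⌋₊) := Real.log_nonneg (by linarith)
  have hM : (⌊Q⌋₊ : ℝ) ≤ Q := Nat.floor_le hQ
  gcongr

/-! ### The final choice of the constant -/

/-- Savings of an arbitrary power `a` of the logarithm in the range `Q ≤ X / L ^ (8 a + 18)`: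
every modulus `q ≤ Q` is raised to moduli in `(P, 4 P]` with `P = X / L ^ (8 a + 17)`, where the
available savings `L ^ (a + 2)` absorb the factor `log (4 P) ^ 2` lost by the raising. -/
theorem norm_totalDetSum_le_of_le {a m n₀ : ℕ} {X Q K₀ : ℝ} (hK₀ : 0 ≤ K₀)
    (hn₀ : ∀ n : ℕ, n₀ ≤ n →
      (n : ℝ) ≤ ((Finset.Ioc n (4 * n)).filter Nat.Prime).card * Real.log (4 * n))
    (hm : m = 6 * (8 * a + 17) + (2 * a + 4) + 1 + (a + 2)) (hX : 1 ≤ X)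
    (hL : 9 ≤ Real.log X) (hLn : 2 * (n₀ + 1) ≤ Real.log X) (hLm : Real.log X ^ m ≤ √X)
    (hQ0 : 0 ≤ Q) (hQ : Q ≤ X / Real.log X ^ (8 * a + 18)) {c : GaussianInt → ℂ}
    (hcs : ∀ z, c z ≠ 0 → IsOddPrimitive z) (hc : ∀ z, ‖c z‖ ≤ 1)
    (hSW : ∀ d : ℕ, 1 ≤ d → ∀ α : GaussianInt, ‖twistedSum c X 0 d α 0‖
      ≤ K₀ * (d ^ 2 * X / Real.log X ^ (5 * (2 * a + 4) + (a + 2)))) :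
    ‖totalDetSum c Q X‖ ≤ 40 * (18 * K₀ + 1400000) * (X ^ 2 / Real.log X ^ a) := by
  classical
  have hZc : ∀ z ∈ oddPrimitiveDisc X, IsCoprime z.re z.im := fun z hz =>
    (mem_oddPrimitiveDisc.1 hz).2.2.1
  have core := sum_classSum_Ioc_le_log_pow hK₀ hm hX hL hLm (inBox_oddPrimitiveDisc X) hZc
    (fun z hz => right_ne_zero_of_mul (mem_oddPrimitiveDisc.1 hz).2.2.2) hc
    (fun d hd α => by
      rw [sum_residue_eq_twistedSum hcs]
      exact hSW d hd α)
  set L := Real.log X with hLdef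
  have hL0 : 0 < L := by linarith
  have hL1 : 1 ≤ L := by linarith
  have hX0 : 0 < X := by linarith
  have hLD : L ^ (8 * a + 17) ≤ X := by
    calc L ^ (8 * a + 17) ≤ L ^ m := pow_le_pow_right₀ hL1 (by omega)
      _ ≤ √X := hLm
      _ ≤ X := by
        rw [Real.sqrt_le_iff]
        exact ⟨hX0.le, by nlinarith⟩
  have hPX : 1 ≤ X / L ^ (8 * a + 17) := (one_le_div (by positivity)).2 hLD
  have hP2 := half_le_floor hPX
  have hP1 : (⌊X / L ^ (8 * a + 17)⌋₊ : ℝ) ≤ X / L ^ (8 * a + 17) := Nat.floor_le (by positivity)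
  have hP0 : 0 < ⌊X / L ^ (8 * a + 17)⌋₊ := Nat.floor_pos.2 hPX
  set P := ⌊X / L ^ (8 * a + 17)⌋₊ with hP
  have hPr : (1 : ℝ) ≤ P := by exact_mod_cast hP0
  have hMP : ⌊Q⌋₊ * (n₀ + 1) ≤ P := by
    have : (⌊Q⌋₊ : ℝ) * (n₀ + 1) ≤ P := by
      calc (⌊Q⌋₊ : ℝ) * (n₀ + 1) ≤ X / L ^ (8 * a + 18) * (L / 2) := by
            gcongr
            · exact (Nat.floor_le hQ0).trans hQ
            · linarith
        _ = X / L ^ (8 * a + 17) / 2 := by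
            rw [pow_succ L (8 * a + 17)]
            field_simp
        _ ≤ P := hP2
    exact_mod_cast this
  have raise := sum_classSum_le_of_raise hZc c hn₀ hMP
  have hlog : Real.log (4 * P) ≤ 2 * L := by
    have h1 : 4 * (P : ℝ) ≤ X * X := by
      have h4 : 4 ≤ X := by linarith [Real.log_le_sub_one_of_pos hX0]
      have h5 : (P : ℝ) ≤ X := hP1.trans (div_le_self hX0.le (one_le_pow₀ hL1))
      gcongr
    have h2 := Real.log_le_log (by linarith) h1
    rw [Real.log_mul hX0.ne' hX0.ne'] at h2
    linarith
  have hlog0 : 0 ≤ Real.log (4 * P) := Real.log_nonneg (by linarith)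
  calc ‖totalDetSum c Q X‖ ≤ _ := norm_totalDetSum_le hcs
    _ ≤ _ := raise
    _ ≤ 10 * (2 * L) ^ 2 * ((18 * K₀ + 1400000) * (X ^ 2 / L ^ (a + 2))) := by
      have h0 := Finset.sum_nonneg fun n (_ : n ∈ Finset.Ioc P (4 * P)) =>
        classSum_nonneg (oddPrimitiveDisc X) c n
      gcongr
    _ = 40 * (18 * K₀ + 1400000) * (X ^ 2 / L ^ a) := by
      rw [pow_add L a]
      field_simp
      norm_num

end DetSums

/-- The constant `C` depends only on `A` and on the implied constants `K` of the
Siegel-Walfisz condition. -/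
theorem mainTheorem1 (A : ℝ) (hA : 0 < A) (K : ℝ → ℝ) :
    ∃ C : ℝ, 0 < C ∧ ∀ (X : ℝ), 2 ≤ X → ∀ (c : GaussianInt → ℂ),
      (∀ z : GaussianInt, c z ≠ 0 →
        DetSums.IsOddPrimitive z ∧ 1 < ‖(z : ℂ)‖ ^ 2 ∧ ‖(z : ℂ)‖ ^ 2 ≤ X) →
      (∀ z : GaussianInt, ‖c z‖ ≤ 1) →
      DetSums.SiegelWalfisz K X c →
      ∀ Q : ℝ, 1 ≤ Q →
        ‖DetSums.totalDetSum c Q X‖ ≤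
          C * ((Q * Real.log X ^ (28 * A + 148) + X * Real.log X ^ (-A)) * X) := by
  open DetSums in
  have hAa : A ≤ ⌈A⌉₊ := Nat.le_ceil A
  have haA : (⌈A⌉₊ : ℝ) ≤ A + 1 := (Nat.ceil_lt_add_one hA.le).le
  set a := ⌈A⌉₊ with ha
  -- the exponent at which the Siegel-Walfisz condition saves `L ^ (a + 2)` after the losses
  -- from the small complementary divisors
  set B := 5 * (2 * a + 4) + (a + 2) with hB
  obtain ⟨n₀, hn₀⟩ := exists_forall_le_card_primes_Ioc
  obtain ⟨X₀, hX₀2, hX₀⟩ := exists_forall_log_pow_le_sqrt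
    (6 * (8 * a + 17) + (2 * a + 4) + 1 + (a + 2)) (max 9 (2 * (n₀ + 1)))
  have hl₀ : 0 ≤ Real.log X₀ := Real.log_nonneg (by linarith)
  have hl2 : 0 < Real.log 2 := Real.log_pos (by norm_num)
  set κ := Real.log 2 ^ (28 * A + 148) with hκ
  have hκ0 : 0 < κ := Real.rpow_pos_of_pos hl2 _
  set C₁ := (18 + 288 * X₀ * (2 + Real.log X₀)) / κ with hC₁
  set C₂ := 40 * (18 * |K B| + 1400000) with hC₂
  have hC₁0 : 0 ≤ C₁ := by positivity
  have hC₂0 : 0 ≤ C₂ := by positivity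
  refine ⟨C₁ + C₂ + 594, by positivity, fun X hX c hcs hc hSW Q hQ => ?_⟩
  have hcs' : ∀ z, c z ≠ 0 → IsOddPrimitive z := fun z hz => (hcs z hz).1
  have hX0 : 0 < X := by linarith
  have hl2X : Real.log 2 ≤ Real.log X := Real.log_le_log (by norm_num) hX
  have triv := norm_totalDetSum_le_trivial (Q := Q) (by linarith : 1 ≤ X) (by linarith) hcs' hc
  have hLX : X < X₀ ∨ X₀ ≤ X := lt_or_ge _ _
  set L := Real.log X with hLdef
  have hL0 : 0 < L := by linarith
  have hE0 : 0 < L ^ (28 * A + 148) := Real.rpow_pos_of_pos hL0 _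
  have hF0 : 0 < L ^ (-A) := Real.rpow_pos_of_pos hL0 _
  set E := L ^ (28 * A + 148) with hE
  set F := L ^ (-A) with hF
  rcases hLX with hlt | hge
  · -- a bounded range of `X`: `L` is bounded from below by `log 2`
    have hLX₀ : L ≤ Real.log X₀ := Real.log_le_log hX0 hlt.le
    have hκE : κ ≤ E := Real.rpow_le_rpow hl2.le hl2X (by linarith)
    have h1 : 18 * Q * X + 288 * X ^ 2 * (2 + L) ≤ C₁ * (Q * E * X) := by
      calc 18 * Q * X + 288 * X ^ 2 * (2 + L)
          = 18 * Q * X + 1 * (288 * X * (2 + L)) * X := by ring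
        _ ≤ 18 * Q * X + Q * (288 * X₀ * (2 + Real.log X₀)) * X := by gcongr
        _ = C₁ * (Q * κ * X) := by
          rw [hC₁]
          field_simp
        _ ≤ C₁ * (Q * E * X) := by gcongr
    have h2 : 0 ≤ C₁ * (X * F * X) := by positivity
    have h3 : 0 ≤ (C₂ + 594) * ((Q * E + X * F) * X) := by positivity
    calc _ ≤ _ := triv
      _ ≤ _ := h1
      _ ≤ _ := by linarith
  obtain ⟨hL9, hLm⟩ := hX₀ X hge
  rw [← hLdef] at hL9 hLm
  have hL9' : 9 ≤ L := (le_max_left _ _).trans hL9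
  have hLn : 2 * ((n₀ : ℝ) + 1) ≤ L := (le_max_right _ _).trans hL9
  have hL1 : 1 ≤ L := by linarith
  rcases le_or_gt Q (X / L ^ (8 * a + 18)) with hQX | hQX
  · -- moduli small enough to be raised to `(P, 4 P]`
    have hmain := norm_totalDetSum_le_of_le (abs_nonneg (K B)) hn₀ rfl (by linarith) hL9' hLn hLm
      (by linarith) hQX hcs' hc (fun d hd α => by
        have hB0 : (0 : ℝ) < B := by
          rw [hB]
          positivity
        have h := hSW B hB0 0 d hd α 0
        rw [← hLdef, Real.rpow_neg hL0.le, Real.rpow_natCast] at h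
        refine h.trans ?_
        have e : (d : ℝ) ^ 2 * (((0 : ℕ) : ℝ) ^ 2 + 1) * ((0 : ℝ) ^ 2 + 1) * X * (L ^ B)⁻¹
            = d ^ 2 * X / L ^ B := by
          push_cast
          ring
        rw [e]
        gcongr
        exact le_abs_self _)
    have hFa : 1 / L ^ a ≤ F := by
      rw [hF, Real.rpow_neg hL0.le, one_div, ← Real.rpow_natCast L a]
      exact inv_anti₀ (Real.rpow_pos_of_pos hL0 _) (Real.rpow_le_rpow_of_exponent_le hL1 hAa)
    have h1 : C₂ * (X ^ 2 / L ^ a) ≤ C₂ * (X * F * X) := by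
      calc C₂ * (X ^ 2 / L ^ a) = C₂ * (X * (1 / L ^ a) * X) := by ring
        _ ≤ C₂ * (X * F * X) := by gcongr
    have h2 : 0 ≤ C₂ * (Q * E * X) := by positivity
    have h3 : 0 ≤ (C₁ + 594) * ((Q * E + X * F) * X) := by positivity
    calc _ ≤ _ := hmain
      _ ≤ _ := h1
      _ ≤ _ := by linarith
  · -- large moduli, where the trivial bound suffices
    have hEa : L ^ (8 * a + 18) * L ≤ E := by
      rw [← pow_succ, hE, ← Real.rpow_natCast]
      refine Real.rpow_le_rpow_of_exponent_le hL1 ?_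
      push_cast
      linarith
    have hE1 : 1 ≤ E := Real.one_le_rpow hL1 (by linarith)
    have hXQ : X ≤ Q * L ^ (8 * a + 18) := ((div_lt_iff₀ (by positivity)).1 hQX).le
    have h1 : 18 * Q * X + 288 * X ^ 2 * (2 + L) ≤ 594 * (Q * E * X) := by
      calc 18 * Q * X + 288 * X ^ 2 * (2 + L)
          = 18 * (Q * 1 * X) + 288 * (X * (2 + L) * X) := by ring
        _ ≤ 18 * (Q * E * X) + 288 * (Q * L ^ (8 * a + 18) * (2 * L) * X) := by
          gcongr
          linarith
        _ = 18 * (Q * E * X) + 576 * (Q * (L ^ (8 * a + 18) * L) * X) := by ring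
        _ ≤ 18 * (Q * E * X) + 576 * (Q * E * X) := by gcongr
        _ = 594 * (Q * E * X) := by ring
    have h2 : 0 ≤ 594 * (X * F * X) := by positivity
    have h3 : 0 ≤ (C₁ + C₂) * ((Q * E + X * F) * X) := by positivity
    calc _ ≤ _ := triv
      _ ≤ _ := h1
      _ ≤ _ := by linarith
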